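/- **Setting.** Let $\mathfrak h^3$ be the Heisenberg algebra (basis $e_1,e_2,e_3$, only non-zero bracket $[e_1,e_2]=e_3$). For a derivation $D$ of $\mathfrak h^3$ let $\mathbb R\ltimes\mathcal H^3$ denote the simply connected Lie group of the semidirect extension $\mathbb R\ltimes_D\mathfrak h^3$; all $D$ are allowed. A left-invariant metric is an inner product on the Lie algebra. Let $\rho,\tau,R$ be its Ricci tensor, scalar curvature and curvature tensor, and $R[\rho]_{ij}=R_{ikj\ell}\rho^{k\ell}$ (signs such that $R[g]=\rho$). For $t\in\mathbb R$ the metric is *$\mathcal F_t$-critical* (for $\mathcal F_t(g)=\int(\|\rho\|^2+t\tau^2)\,\mathrm{dvol}_g$) if it satisfies the Euler–Lagrange equation, which for a left-invariant metric in dimension four reads $$-\Delta\rho+\tfrac12(\|\rho\|^2+t\tau^2)g-2R[\rho]-2t\tau\rho=0 .$$ Its *energy* is $\mathcal E_t=\|\rho\|^2+t\tau^2$. It is *symmetric* if $\nabla R=0$. It is an *algebraic Ricci soliton* if the Ricci operator is $\lambda\,\mathrm{Id}$ plus a derivation of the Lie algebra, for some $\lambda\in\mathbb R$. Two left-invariant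 metrics, on possibly non-isomorphic groups of this type, are *homothetic* if there is a diffeomorphism $\varphi$ between the groups with $\varphi^*g'=\mu g$ for a constant $\mu>0$. **Families.** Each is given by its non-zero Lie brackets in an orthonormal basis $e_1,\dots,e_4$, together with a value of $t$. 1. $[e_1,e_2]=e_3$ (the product $\mathbb R\times\mathcal H^3$); $t=-3$. 2. $[e_1,e_2]=e_3$, $[e_1,e_4]=ae_1$, $[e_2,e_4]=de_2$, $[e_3,e_4]=(a+d)e_3$ with $a\in[-\frac{\sqrt3}{2},\frac12)$ and $d$ the only positive solution of $4(a^2+d^2+ad)-3=0$; $t=-\frac{3}{2(4ad+5)}$. 3. $[e_1,e_2]=e_3$, $[e_2,e_4]=-e_1$; $t=-\frac32$. 4. $[e_1,e_2]=e_3$, $[e_1,e_4]=ae_1$, $[e_2,e_4]=ae_2$, $[e_3,e_4]=2ae_3$ with $a\in(0,\frac12)\cup(\frac12,\infty)$; $t=-\frac{3(4a^2+1)}{44a^2+1}$. 5. $[e_1,e_2]=e_3$, $[e_1,e_4]=ae_1-ce_2$, $[e_2,e_4]=ce_1+de_2$, $[e_3,e_4]=(a+d)e_3$ with $c\in(0,\frac12)\cup(\sqrt{7/8},\infty)$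 and $(a,d)$ the only pair with $a<0<d$, $|a|<d$, $3a^2+4c^2+3d^2+10ad=0$ and $32c^4+(32ad+8)c^2-28ad-9=0$; $t=-\frac{3(32c^4-7)}{4(8c^4+40c^2-13)}$. 6. $[e_1,e_2]=e_3$, $[e_1,e_4]=ae_1+He_3$, $[e_2,e_4]=de_2$, $[e_3,e_4]=(a+d)e_3$ with $H\in(0,\sqrt{3/7})$, $d$ the only positive solution of $4d^6+5(3H^2-1)d^4+(18H^4+6H^2+13)d^2+(H^2+1)^2(7H^2-3)=0$, and $a=-\frac{(2d^2+2H^2-3)d}{2(d^2+H^2+1)}$, which is positive; $t=-\frac{4a^2+3d^2+2ad+3H^2+3}{12a^2+12d^2+20ad+H^2+1}$. **Theorem.** A non-symmetric left-invariant metric on $\mathbb R\ltimes\mathcal H^3$ is $\mathcal F_t$-critical if and only if it is homothetic to a member of one of the families (1)–(6) and $t$ is the value attached to that member. The existence and uniqueness of the dependent parameters in (2), (5), (6), and the positivity of $a$ in (6), hold as stated. The values of $t$ in family (2) fill exactly $[-\frac34,-\frac14)$. Moreover: * A metric homothetic to a member of families (1)–(3) has energy $\mathcal E_t=0$ at the attached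 $t$. The metrics listed in (1)–(3) are algebraic Ricci solitons. * A metric homothetic to a member of families (4)–(6) has $\mathcal E_t<0$ at the attached $t$. For the metrics listed in these families, the energy at that $t$ is, respectively, $-36a^2$, $\;-\frac{72c^2(4c^2-1)}{8c^2-7}$, and $$\tfrac14\{24a^3d+2ad(22d^2-19H^2-31)+3d^2(4d^2-7H^2-13)+4a^2(13d^2-6H^2-10)\}.$$ No left-invariant metric on any $\mathbb R\ltimes\mathcal H^3$ that is homothetic to a member of families (4)–(6) is an algebraic Ricci soliton. -/

import Mathlib

open scoped ContDiff

noncomputable section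

/-! ### The Heisenberg algebra and its semidirect extensions -/

/-- The three-dimensional Heisenberg algebra, with basis `e₁, e₂, e₃` and the only nonzero
bracket `[e₁, e₂] = e₃`. -/
def Heis : Type := Fin 3 → ℝ

namespace Heis

instance : NormedAddCommGroup Heis := inferInstanceAs (NormedAddCommGroup (Fin 3 → ℝ))
instance : NormedSpace ℝ Heis := inferInstanceAs (NormedSpace ℝ (Fin 3 → ℝ))
instance : FiniteDimensional ℝ Heis := inferInstanceAs (FiniteDimensional ℝ (Fin 3 → ℝ))

/-- The vector with coordinates `x, y, z`. -/
def mk (x y z : ℝ) : Heis := ![x, y, z]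

/-- The `i`-th coordinate. -/
def coord (v : Heis) (i : Fin 3) : ℝ := v i

@[ext] theorem ext {v w : Heis} (h0 : v.coord 0 = w.coord 0) (h1 : v.coord 1 = w.coord 1)
    (h2 : v.coord 2 = w.coord 2) : v = w := by
  funext i; fin_cases i
  exacts [h0, h1, h2]

@[simp] theorem coord_mk_zero (x y z : ℝ) : (mk x y z).coord 0 = x := rfl
@[simp] theorem coord_mk_one (x y z : ℝ) : (mk x y z).coord 1 = y := rfl
@[simp] theorem coord_mk_two (x y z : ℝ) : (mk x y z).coord 2 = z := rfl
@[simp] theorem coord_add (v w : Heis) (i : Fin 3) : (v + w).coord i = v.coord i + w.coord i := rfl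
@[simp] theorem coord_sub (v w : Heis) (i : Fin 3) : (v - w).coord i = v.coord i - w.coord i := rfl
@[simp] theorem coord_neg (v : Heis) (i : Fin 3) : (-v).coord i = -v.coord i := rfl
@[simp] theorem coord_zero (i : Fin 3) : (0 : Heis).coord i = 0 := rfl
@[simp] theorem coord_smul (r : ℝ) (v : Heis) (i : Fin 3) : (r • v).coord i = r * v.coord i := rfl

instance : Bracket Heis Heis where
  bracket v w := mk 0 0 (v.coord 0 * w.coord 1 - v.coord 1 * w.coord 0)

theorem bracket_def (v w : Heis) :
    ⁅v, w⁆ = mk 0 0 (v.coord 0 * w.coord 1 - v.coord 1 * w.coord 0) := rfl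

instance : LieRing Heis where
  add_lie u v w := by ext <;> simp [bracket_def]; ring
  lie_add u v w := by ext <;> simp [bracket_def]; ring
  lie_self u := by ext <;> simp [bracket_def]; ring
  leibniz_lie u v w := by ext <;> simp [bracket_def]

instance : LieAlgebra ℝ Heis where
  lie_smul r v w := by ext <;> simp [bracket_def]; ring

theorem lie_lie_left (u v w : Heis) : ⁅⁅u, v⁆, w⁆ = 0 := by ext <;> simp [bracket_def]
theorem lie_lie_right (u v w : Heis) : ⁅u, ⁅v, w⁆⁆ = 0 := by ext <;> simp [bracket_def]

/-- A derivation of the Heisenberg algebra as a bounded operator. -/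
def derCLM (D : LieDerivation ℝ Heis Heis) : Heis →L[ℝ] Heis :=
  LinearMap.toContinuousLinearMap D.toLinearMap

@[simp] theorem derCLM_apply (D : LieDerivation ℝ Heis Heis) (v : Heis) : derCLM D v = D v := rfl

/-- The one-parameter group `s ↦ exp (s D)` of automorphisms generated by a derivation `D`. -/
def flow (D : LieDerivation ℝ Heis Heis) (s : ℝ) : Heis →L[ℝ] Heis :=
  NormedSpace.exp (s • derCLM D)

theorem flow_zero (D : LieDerivation ℝ Heis Heis) (v : Heis) : flow D 0 v = v := by
  simp [flow]

theorem flow_add (D : LieDerivation ℝ Heis Heis) (s r : ℝ) (v : Heis) :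
    flow D (s + r) v = flow D s (flow D r v) := by
  have h : Commute (s • derCLM D) (r • derCLM D) :=
    ((Commute.refl (derCLM D)).smul_left s).smul_right r
  let _ : NormedAlgebra ℚ (Heis →L[ℝ] Heis) := NormedAlgebra.restrictScalars ℚ ℝ _
  simp only [flow, add_smul]
  rw [NormedSpace.exp_add_of_commute h]
  rfl

theorem hasDerivAt_flow (D : LieDerivation ℝ Heis Heis) (v : Heis) (s : ℝ) :
    HasDerivAt (fun s => flow D s v) (D (flow D s v)) s := by
  have h := hasDerivAt_exp_smul_const' (𝕂 := ℝ) (derCLM D) s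
  exact h.clm_apply (hasDerivAt_const s v) |>.congr_deriv (by simp [flow])

/-- The Lie bracket as a bounded bilinear map. -/
theorem isBoundedBilinearMap_lie : IsBoundedBilinearMap ℝ (fun p : Heis × Heis => ⁅p.1, p.2⁆) := by
  let f : Heis →ₗ[ℝ] Heis →ₗ[ℝ] Heis :=
    LinearMap.mk₂ ℝ (fun v w => ⁅v, w⁆) add_lie smul_lie lie_add (fun c v w => lie_smul c v w)
  let g : Heis →L[ℝ] Heis →L[ℝ] Heis :=
    LinearMap.toContinuousLinearMap
      ((LinearMap.toContinuousLinearMap : (Heis →ₗ[ℝ] Heis) ≃ₗ[ℝ] (Heis →L[ℝ] Heis)).toLinearMap ∘ₗ f)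
  exact g.isBoundedBilinearMap

theorem flow_lie (D : LieDerivation ℝ Heis Heis) (s : ℝ) (v w : Heis) :
    flow D s ⁅v, w⁆ = ⁅flow D s v, flow D s w⁆ := by
  have key : ∀ r : ℝ, HasDerivAt (fun r => flow D (s - r) ⁅flow D r v, flow D r w⁆) 0 r := by
    intro r
    have h1 : HasDerivAt (fun r => ⁅flow D r v, flow D r w⁆) (D ⁅flow D r v, flow D r w⁆) r := by
      have := (isBoundedBilinearMap_lie.hasFDerivAt (flow D r v, flow D r w)).comp_hasDerivAt r
        ((hasDerivAt_flow D v r).prodMk (hasDerivAt_flow D w r))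
      refine this.congr_deriv ?_
      rw [LieDerivation.apply_lie_eq_add]
      simp [IsBoundedBilinearMap.deriv_apply]
    have h2 : HasDerivAt (fun r => flow D (s - r)) (-(derCLM D * flow D (s - r))) r := by
      have := (hasDerivAt_exp_smul_const' (𝕂 := ℝ) (derCLM D) (s - r)).scomp r
        ((hasDerivAt_id r).const_sub s)
      exact this.congr_deriv (by simp [flow])
    have h3 := h2.clm_apply h1
    refine h3.congr_deriv ?_
    let _ : NormedAlgebra ℚ (Heis →L[ℝ] Heis) := NormedAlgebra.restrictScalars ℚ ℝ _
    have hc : Commute (derCLM D) (flow D (s - r)) :=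
      ((Commute.refl (derCLM D)).smul_right (s - r)).exp_right
    have := congrArg (fun T : Heis →L[ℝ] Heis => T ⁅flow D r v, flow D r w⁆) hc.eq
    change D (flow D (s - r) _) = flow D (s - r) (D _) at this
    simp [this]
  have hconst := is_const_of_deriv_eq_zero (fun r => (key r).differentiableAt)
    (fun r => (key r).deriv) 0 s
  simpa [flow_zero] using hconst

end Heis

/-- The simply connected Lie group `ℝ ⋉ H³` determined by a derivation `D` of the Heisenberg
algebra, in the global chart `𝔥³ × ℝ`, where the Heisenberg group is identified with its Lie
algebra through the exponential map.  The tangent space at every point is the same vector space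
`𝔥³ × ℝ`; the tangent space at the identity `(0, 0)` is the Lie algebra. -/
def SemiHeis (_D : LieDerivation ℝ Heis Heis) : Type := Heis × ℝ

namespace SemiHeis

variable {D : LieDerivation ℝ Heis Heis}

instance : NormedAddCommGroup (SemiHeis D) := inferInstanceAs (NormedAddCommGroup (Heis × ℝ))
instance : NormedSpace ℝ (SemiHeis D) := inferInstanceAs (NormedSpace ℝ (Heis × ℝ))
instance : FiniteDimensional ℝ (SemiHeis D) := inferInstanceAs (FiniteDimensional ℝ (Heis × ℝ))

/-- The point (or vector) with components `v` and `s`. -/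
def mk (v : Heis) (s : ℝ) : SemiHeis D := (v, s)

/-- The Heisenberg component. -/
def heis (p : SemiHeis D) : Heis := p.1

/-- The real component. -/
def real (p : SemiHeis D) : ℝ := p.2

@[ext] theorem ext {p q : SemiHeis D} (h1 : p.heis = q.heis) (h2 : p.real = q.real) : p = q :=
  Prod.ext h1 h2

@[simp] theorem heis_mk (v : Heis) (s : ℝ) : (mk v s : SemiHeis D).heis = v := rfl
@[simp] theorem real_mk (v : Heis) (s : ℝ) : (mk v s : SemiHeis D).real = s := rfl
@[simp] theorem heis_add (p q : SemiHeis D) : (p + q).heis = p.heis + q.heis := rfl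
@[simp] theorem real_add (p q : SemiHeis D) : (p + q).real = p.real + q.real := rfl
@[simp] theorem heis_zero : (0 : SemiHeis D).heis = 0 := rfl
@[simp] theorem real_zero : (0 : SemiHeis D).real = 0 := rfl
@[simp] theorem heis_smul (r : ℝ) (p : SemiHeis D) : (r • p).heis = r • p.heis := rfl
@[simp] theorem real_smul (r : ℝ) (p : SemiHeis D) : (r • p).real = r * p.real := rfl

/-! #### The Lie algebra structure: `[(v, s), (w, r)] = ([v, w] + s D w - r D v, 0)` -/

instance : Bracket (SemiHeis D) (SemiHeis D) where
  bracket p q := mk (⁅p.heis, q.heis⁆ + p.real • D q.heis - q.real • D p.heis) 0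

theorem bracket_def (p q : SemiHeis D) :
    ⁅p, q⁆ = mk (⁅p.heis, q.heis⁆ + p.real • D q.heis - q.real • D p.heis) 0 := rfl

instance : LieRing (SemiHeis D) where
  add_lie p q u := by
    apply SemiHeis.ext
    · simp only [bracket_def, heis_mk, heis_add, real_add, add_lie, map_add, smul_add, add_smul]
      abel
    · simp [bracket_def]
  lie_add p q u := by
    apply SemiHeis.ext
    · simp only [bracket_def, heis_mk, heis_add, real_add, lie_add, map_add, smul_add, add_smul]
      abel
    · simp [bracket_def]
  lie_self p := by
    apply SemiHeis.ext <;> simp [bracket_def]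
  leibniz_lie p q u := by
    apply SemiHeis.ext
    · simp only [bracket_def, heis_mk, heis_add, real_mk, lie_add, lie_sub, add_lie, sub_lie,
        map_add, map_sub, map_smul, smul_add, smul_sub, lie_smul, smul_lie, zero_smul,
        LieDerivation.apply_lie_eq_add, Heis.lie_lie_left, Heis.lie_lie_right, smul_smul]
      rw [← lie_skew (D q.heis) u.heis, ← lie_skew (D p.heis) u.heis,
        ← lie_skew (D p.heis) q.heis]
      rw [mul_comm q.real p.real, mul_comm u.real p.real, mul_comm u.real q.real]
      module
    · simp [bracket_def]

instance : LieAlgebra ℝ (SemiHeis D) where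
  lie_smul c p q := by
    apply SemiHeis.ext
    · simp only [bracket_def, heis_mk, heis_smul, real_smul, lie_smul, map_smul, smul_add,
        smul_sub, smul_smul, mul_comm]
    · simp [bracket_def]

/-! #### The group structure -/

instance : Mul (SemiHeis D) where
  mul p q := mk (p.heis + Heis.flow D p.real q.heis
    + (1 / 2 : ℝ) • ⁅p.heis, Heis.flow D p.real q.heis⁆) (p.real + q.real)

instance : One (SemiHeis D) where
  one := mk 0 0

instance : Inv (SemiHeis D) where
  inv p := mk (-(Heis.flow D (-p.real) p.heis)) (-p.real)

theorem mul_def (p q : SemiHeis D) :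
    p * q = mk (p.heis + Heis.flow D p.real q.heis
      + (1 / 2 : ℝ) • ⁅p.heis, Heis.flow D p.real q.heis⁆) (p.real + q.real) := rfl

theorem one_def : (1 : SemiHeis D) = mk 0 0 := rfl

theorem inv_def (p : SemiHeis D) :
    p⁻¹ = mk (-(Heis.flow D (-p.real) p.heis)) (-p.real) := rfl

instance : Group (SemiHeis D) :=
  Group.ofLeftAxioms
    (by
      intro p q u
      apply SemiHeis.ext
      · simp only [mul_def, heis_mk, real_mk, Heis.flow_add, map_add, map_smul, Heis.flow_lie,
          lie_add, add_lie, lie_smul, smul_lie, Heis.lie_lie_left, Heis.lie_lie_right, smul_add,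
          smul_zero, add_zero]
        abel
      · simp [mul_def, add_assoc])
    (by
      intro p
      apply SemiHeis.ext <;> simp [mul_def, one_def, Heis.flow_zero])
    (by
      intro p
      apply SemiHeis.ext <;> simp [mul_def, one_def, inv_def])


/-! #### Left-invariant vector fields -/

/-- The left-invariant vector field on `ℝ ⋉ H³` with value `u` at the identity. -/
def leftInvField (u p : SemiHeis D) : SemiHeis D := fderiv ℝ (fun q => p * q) 1 u

/-- Left translation by `p` is the affine map with this linear part. -/
def leftLin (p : SemiHeis D) : SemiHeis D →ₗ[ℝ] SemiHeis D where
  toFun u := mk (Heis.flow D p.real u.heis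
    + (1 / 2 : ℝ) • ⁅p.heis, Heis.flow D p.real u.heis⁆) u.real
  map_add' u v := by
    apply SemiHeis.ext
    · simp only [heis_mk, heis_add, map_add, lie_add]; module
    · simp
  map_smul' c u := by
    apply SemiHeis.ext
    · simp only [heis_mk, heis_smul, map_smul, lie_smul, RingHom.id_apply]; module
    · simp

theorem mul_eq_add_leftLin (p q : SemiHeis D) : p * q = p + leftLin p q := by
  apply SemiHeis.ext
  · simp [mul_def, leftLin, add_assoc]
  · simp [mul_def, leftLin]

theorem fderiv_mul_left (p q u : SemiHeis D) :
    fderiv ℝ (fun q => p * q) q u = leftLin p u := by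
  have h : (fun q : SemiHeis D => p * q)
      = fun q => p + LinearMap.toContinuousLinearMap (leftLin p) q := by
    funext q; exact mul_eq_add_leftLin p q
  rw [h, fderiv_const_add, ContinuousLinearMap.fderiv]
  rfl

/-- The projection to the Heisenberg component as a bounded operator. -/
def heisL : SemiHeis D →L[ℝ] Heis :=
  LinearMap.toContinuousLinearMap
    { toFun := heis, map_add' := fun _ _ => rfl, map_smul' := fun _ _ => rfl }

/-- The projection to the real component as a bounded operator. -/
def realL : SemiHeis D →L[ℝ] ℝ :=
  LinearMap.toContinuousLinearMap
    { toFun := real, map_add' := fun _ _ => rfl, map_smul' := fun _ _ => rfl }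

/-- The inclusion of the Heisenberg algebra as a bounded operator. -/
def inclL : Heis →L[ℝ] SemiHeis D :=
  LinearMap.toContinuousLinearMap
    { toFun := fun v => mk v 0
      map_add' := fun _ _ => by apply SemiHeis.ext <;> simp
      map_smul' := fun _ _ => by apply SemiHeis.ext <;> simp }

@[simp] theorem heisL_apply (p : SemiHeis D) : heisL p = p.heis := rfl
@[simp] theorem realL_apply (p : SemiHeis D) : realL p = p.real := rfl
@[simp] theorem inclL_apply (v : Heis) : (inclL v : SemiHeis D) = mk v 0 := rfl

/-- The bracket on `𝔥³ × ℝ` is the Lie bracket of left-invariant vector fields, so that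
`SemiHeis D` with its bracket is the Lie algebra of the group `SemiHeis D`. -/
theorem lieBracket_leftInvField (u v : SemiHeis D) :
    VectorField.lieBracket ℝ (leftInvField u) (leftInvField v) 1 = ⁅u, v⁆ := by
  have key : ∀ w x : SemiHeis D, fderiv ℝ (leftInvField w) 1 x
      = mk (x.real • D w.heis + (1 / 2 : ℝ) • ⁅x.heis, w.heis⁆) 0 := by
    intro w x
    have h1 : HasFDerivAt (fun p : SemiHeis D => Heis.flow D p.real w.heis)
        (realL.smulRight (D w.heis)) (1 : SemiHeis D) := by
      have := (Heis.hasDerivAt_flow D w.heis (1 : SemiHeis D).real).hasFDerivAt.comp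
        (1 : SemiHeis D) (realL (D := D)).hasFDerivAt
      refine this.congr_fderiv ?_
      apply ContinuousLinearMap.ext
      intro y
      simp [one_def, Heis.flow_zero]
    have h3 : HasFDerivAt (fun p : SemiHeis D => ⁅p.heis, Heis.flow D p.real w.heis⁆) _
        (1 : SemiHeis D) :=
      HasFDerivAt.comp (g := fun p : Heis × Heis => ⁅p.1, p.2⁆)
        (f := fun p : SemiHeis D => (p.heis, Heis.flow D p.real w.heis)) (1 : SemiHeis D)
        (Heis.isBoundedBilinearMap_lie.hasFDerivAt _)
        ((heisL (D := D)).hasFDerivAt.prodMk h1)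
    have h4 : HasFDerivAt (fun p : SemiHeis D => inclL (D := D) (Heis.flow D p.real w.heis
        + (1 / 2 : ℝ) • ⁅p.heis, Heis.flow D p.real w.heis⁆) + mk 0 w.real) _ (1 : SemiHeis D) :=
      ((inclL (D := D)).hasFDerivAt.comp (1 : SemiHeis D)
        (h1.add (h3.const_smul (1 / 2 : ℝ)))).add_const _
    have h5 : leftInvField w = fun p : SemiHeis D => inclL (D := D) (Heis.flow D p.real w.heis
        + (1 / 2 : ℝ) • ⁅p.heis, Heis.flow D p.real w.heis⁆) + mk 0 w.real := by
      funext p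
      refine (fderiv_mul_left p 1 w).trans ?_
      apply SemiHeis.ext <;> simp [leftLin]
    rw [h5, h4.fderiv]
    apply SemiHeis.ext <;> simp [one_def, Heis.flow_zero, IsBoundedBilinearMap.deriv_apply]
  have h1 : ∀ w : SemiHeis D, leftInvField w 1 = w := by
    intro w
    simp only [leftInvField, one_mul]
    simp
  rw [VectorField.lieBracket_eq]
  simp only [key, h1]
  apply SemiHeis.ext
  · simp only [bracket_def]
    change (u.real • D v.heis + (1 / 2 : ℝ) • ⁅u.heis, v.heis⁆)
      - (v.real • D u.heis + (1 / 2 : ℝ) • ⁅v.heis, u.heis⁆) = _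
    rw [← lie_skew u.heis v.heis, heis_mk]
    module
  · change (0 : ℝ) - 0 = 0
    simp

end SemiHeis

/-! ### Left-invariant metrics and their curvature -/

/-- A left-invariant Riemannian metric on `ℝ ⋉ H³`, given by an orthonormal basis of the Lie
algebra (a left-invariant orthonormal frame). -/
structure LeftInvMetric (D : LieDerivation ℝ Heis Heis) where
  /-- The orthonormal basis `e₁, e₂, e₃, e₄` of the Lie algebra (indexed by `0, 1, 2, 3`). -/
  frame : Module.Basis (Fin 4) ℝ (SemiHeis D)

namespace LeftInvMetric

variable {D : LieDerivation ℝ Heis Heis} (M : LeftInvMetric D)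

/-- The inner product on the Lie algebra. -/
def inner (u v : SemiHeis D) : ℝ := ∑ i, M.frame.repr u i * M.frame.repr v i

theorem frame_orthonormal (i j : Fin 4) :
    M.inner (M.frame i) (M.frame j) = if i = j then 1 else 0 := by
  simp [inner, Finsupp.single_apply]

/-- Every inner product on the Lie algebra is the inner product of some `LeftInvMetric`. -/
theorem exists_inner_eq (B : LinearMap.BilinForm ℝ (SemiHeis D)) (hs : B.IsSymm)
    (hp : ∀ u, u ≠ 0 → 0 < B u u) : ∃ M : LeftInvMetric D, ∀ u v, M.inner u v = B u v := by
  obtain ⟨b, hb⟩ := LinearMap.BilinForm.exists_orthogonal_basis (K := ℝ) (B := B) ⟨hs.eq⟩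
  have hrank : Module.finrank ℝ (SemiHeis D) = 4 := by
    change Module.finrank ℝ ((Fin 3 → ℝ) × ℝ) = 4
    simp
  have hpos : ∀ i, 0 < B (b i) (b i) := fun i => hp _ (b.ne_zero i)
  let c : Module.Basis (Fin 4) ℝ (SemiHeis D) :=
    (b.isUnitSMul (w := fun i => (√(B (b i) (b i)))⁻¹)
      (fun i => (inv_ne_zero (Real.sqrt_pos.2 (hpos i)).ne').isUnit)).reindex (finCongr hrank)
  refine ⟨⟨c⟩, fun u v => ?_⟩
  have hc : ∀ i j, B (c i) (c j) = if i = j then 1 else 0 := by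
    intro i j
    have hi := hpos ((finCongr hrank).symm i)
    by_cases hij : i = j
    · subst hij
      simp only [c, Module.Basis.reindex_apply, Module.Basis.isUnitSMul_apply, map_smul,
        LinearMap.smul_apply, smul_eq_mul, if_true]
      have h := Real.mul_self_sqrt hi.le
      have h0 := (Real.sqrt_pos.2 hi).ne'
      field_simp
      rw [pow_two, h]
    · have hne : (finCongr hrank).symm i ≠ (finCongr hrank).symm j := by simpa using hij
      have h := hb hne
      simp only [Function.onFun] at h
      simp only [c, Module.Basis.reindex_apply, Module.Basis.isUnitSMul_apply, map_smul,
        LinearMap.smul_apply, h, smul_zero, hij, if_false]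
  have h : B (∑ i, c.repr u i • c i) (∑ i, c.repr v i • c i)
      = ∑ i, c.repr u i * c.repr v i := by
    simp [-Module.Basis.sum_repr, hc, mul_comm]
  rw [c.sum_repr, c.sum_repr] at h
  exact h.symm

/-- The left-invariant Riemannian metric at the point `p`: tangent vectors at `p` are moved to
the identity by the differential of left translation by `p⁻¹`. -/
def metricAt (p u v : SemiHeis D) : ℝ :=
  M.inner (fderiv ℝ (fun q => p⁻¹ * q) p u) (fderiv ℝ (fun q => p⁻¹ * q) p v)

/-- The structure constants `c_{ij}^k` in the orthonormal frame: `[e_i, e_j] = ∑_k c_{ij}^k e_k`. -/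
def structConst (i j k : Fin 4) : ℝ := M.frame.repr ⁅M.frame i, M.frame j⁆ k

/-- The Levi-Civita connection `⟨∇_{e_i} e_j, e_k⟩`, by the Koszul formula
`2⟨∇_x y, z⟩ = ⟨[x, y], z⟩ - ⟨[y, z], x⟩ + ⟨[z, x], y⟩` for left-invariant fields. -/
def conn (i j k : Fin 4) : ℝ :=
  (M.structConst i j k - M.structConst j k i + M.structConst k i j) / 2

/-- The connection is compatible with the metric. -/
theorem conn_skew (i j k : Fin 4) : M.conn i j k = -M.conn i k j := by
  have h : ∀ a b c, M.structConst a b c = -M.structConst b a c := fun a b c => by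
    simp only [structConst]
    rw [← lie_skew, map_neg]
    rfl
  simp only [conn]
  rw [h k j i, h k i j, h j i k]
  ring

/-- The connection is torsion-free. -/
theorem conn_sub_conn (i j k : Fin 4) : M.conn i j k - M.conn j i k = M.structConst i j k := by
  have h : ∀ a b c, M.structConst a b c = -M.structConst b a c := fun a b c => by
    simp only [structConst]
    rw [← lie_skew, map_neg]
    rfl
  simp only [conn]
  rw [h k j i, h k i j, h j i k]
  ring

/-- The curvature tensor `R_{ijkl} = ⟨R(e_i, e_j) e_l, e_k⟩` with
`R(x, y) z = ∇_x ∇_y z - ∇_y ∇_x z - ∇_{[x, y]} z`, so that `R_{ijij}` is the sectional curvature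
of the plane spanned by `e_i, e_j`. -/
def riem (i j k l : Fin 4) : ℝ :=
  ∑ m, (M.conn j l m * M.conn i m k - M.conn i l m * M.conn j m k
    - M.structConst i j m * M.conn m l k)

/-- The Ricci tensor `ρ(e_i, e_j)`. -/
def ric (i j : Fin 4) : ℝ := ∑ k, M.riem i k j k

/-- The scalar curvature `τ`. -/
def scal : ℝ := ∑ i, M.ric i i

/-- The squared norm `‖ρ‖²` of the Ricci tensor. -/
def ricNormSq : ℝ := ∑ i, ∑ j, M.ric i j ^ 2

/-- The covariant derivative `(∇_{e_k} ρ)(e_i, e_j)`. -/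
def covRic (k i j : Fin 4) : ℝ :=
  -∑ m, (M.conn k i m * M.ric m j + M.conn k j m * M.ric i m)

/-- The second covariant derivative `(∇_{e_l} (∇ρ))(e_k; e_i, e_j)`. -/
def covCovRic (l k i j : Fin 4) : ℝ :=
  -∑ m, (M.conn l k m * M.covRic m i j + M.conn l i m * M.covRic k m j
    + M.conn l j m * M.covRic k i m)

/-- The rough Laplacian `(Δρ)(e_i, e_j)`. -/
def lapRic (i j : Fin 4) : ℝ := ∑ k, M.covCovRic k k i j

/-- The contraction `R[ρ]_{ij} = R_{ikjl} ρ^{kl}`. -/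
def riemRic (i j : Fin 4) : ℝ := ∑ k, ∑ l, M.riem i k j l * M.ric k l

/-- The energy `‖ρ‖² + t τ²` of the functional `F_t`. -/
def energy (t : ℝ) : ℝ := M.ricNormSq + t * M.scal ^ 2

/-- The gradient of `F_t : g ↦ ∫ (‖ρ‖² + t τ²) dvol` restricted to metrics of fixed volume in
dimension four:
`-Δρ + (2t+1)∇²τ - (t/2)(Δτ) g + (1/2)(‖ρ‖² + t τ²) g - 2 R[ρ] - 2 t τ ρ`.
Since `τ` is constant for a left-invariant metric, the terms `∇²τ` and `Δτ` vanish. -/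
def gradF (t : ℝ) (i j : Fin 4) : ℝ :=
  -M.lapRic i j + (1 / 2) * M.energy t * (if i = j then 1 else 0)
    - 2 * M.riemRic i j - 2 * t * M.scal * M.ric i j

/-- The metric satisfies the Euler-Lagrange equation of `F_t`. -/
def IsCritical (t : ℝ) : Prop := ∀ i j, M.gradF t i j = 0

/-- The covariant derivative `(∇_{e_p} R)_{ijkl}` of the curvature tensor. -/
def covRiem (p i j k l : Fin 4) : ℝ :=
  -∑ m, (M.conn p i m * M.riem m j k l + M.conn p j m * M.riem i m k l
    + M.conn p k m * M.riem i j m l + M.conn p l m * M.riem i j k m)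

/-- The metric is symmetric: `∇R = 0`.  (The manifold is simply connected and the metric is
complete.) -/
def IsSymmetric : Prop := ∀ p i j k l, M.covRiem p i j k l = 0

/-- The Ricci operator `Ric` of the Lie algebra, `⟨Ric x, y⟩ = ρ(x, y)`. -/
def ricOp : SemiHeis D →ₗ[ℝ] SemiHeis D :=
  M.frame.constr ℝ (fun i => ∑ j, M.ric i j • M.frame j)

/-- Algebraic Ricci solitons: `Ric = lam • Id + E` for a derivation `E` of the Lie algebra. -/
def IsAlgebraicRicciSoliton : Prop :=
  ∃ (lam : ℝ) (E : LieDerivation ℝ (SemiHeis D) (SemiHeis D)),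
    ∀ x, M.ricOp x = lam • x + E x

end LeftInvMetric

/-- Two left-invariant metrics, on possibly non-isomorphic groups, are homothetic if there is a
smooth diffeomorphism `φ` between the groups with `φ^* g' = μ g` for some constant `μ > 0`. -/
def Homothetic {D D' : LieDerivation ℝ Heis Heis}
    (M : LeftInvMetric D) (M' : LeftInvMetric D') : Prop :=
  ∃ (φ : SemiHeis D ≃ SemiHeis D') (μ : ℝ), ContDiff ℝ ∞ φ ∧ ContDiff ℝ ∞ φ.symm ∧ 0 < μ ∧
    ∀ p u v, M'.metricAt (φ p) (fderiv ℝ φ p u) (fderiv ℝ φ p v) = μ * M.metricAt p u v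

/-! ### Metrics given by Lie brackets -/

/-- The derivation `e₁ ↦ -(a₁ e₁ + b₁ e₂ + c₁ e₃)`, `e₂ ↦ -(a₂ e₁ + b₂ e₂ + c₂ e₃)`,
`e₃ ↦ -(a₁ + b₂) e₃` of the Heisenberg algebra. -/
def bracketDer (a₁ b₁ c₁ a₂ b₂ c₂ : ℝ) : LieDerivation ℝ Heis Heis where
  toFun v := Heis.mk (-(a₁ * v.coord 0 + a₂ * v.coord 1)) (-(b₁ * v.coord 0 + b₂ * v.coord 1))
    (-(c₁ * v.coord 0 + c₂ * v.coord 1 + (a₁ + b₂) * v.coord 2))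
  map_add' v w := by ext <;> simp <;> ring
  map_smul' r v := by ext <;> simp <;> ring
  leibniz' v w := by ext <;> simp [Heis.bracket_def]; ring

/-- The coordinates of a vector of `𝔥³ × ℝ`. -/
def coordEquiv (D : LieDerivation ℝ Heis Heis) : SemiHeis D ≃ₗ[ℝ] (Fin 4 → ℝ) where
  toFun p := ![p.heis.coord 0, p.heis.coord 1, p.heis.coord 2, p.real]
  invFun x := SemiHeis.mk (Heis.mk (x 0) (x 1) (x 2)) (x 3)
  map_add' p q := by funext i; fin_cases i <;> simp
  map_smul' r p := by funext i; fin_cases i <;> simp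
  left_inv p := by
    apply SemiHeis.ext
    · ext <;> simp
    · simp
  right_inv x := by funext i; fin_cases i <;> simp

/-- The metric Lie group with orthonormal basis `e₁, …, e₄` and Lie brackets
`[e₁, e₂] = e₃`, `[e₁, e₄] = a₁ e₁ + b₁ e₂ + c₁ e₃`, `[e₂, e₄] = a₂ e₁ + b₂ e₂ + c₂ e₃`,
`[e₃, e₄] = (a₁ + b₂) e₃`. -/
def bracketMetric (a₁ b₁ c₁ a₂ b₂ c₂ : ℝ) : LeftInvMetric (bracketDer a₁ b₁ c₁ a₂ b₂ c₂) where
  frame := Module.Basis.ofEquivFun (coordEquiv _)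

theorem bracketMetric_brackets (a₁ b₁ c₁ a₂ b₂ c₂ : ℝ) :
    let e := (bracketMetric a₁ b₁ c₁ a₂ b₂ c₂).frame
    ⁅e 0, e 1⁆ = e 2 ∧ ⁅e 0, e 2⁆ = 0 ∧ ⁅e 1, e 2⁆ = 0 ∧
      ⁅e 0, e 3⁆ = a₁ • e 0 + b₁ • e 1 + c₁ • e 2 ∧
      ⁅e 1, e 3⁆ = a₂ • e 0 + b₂ • e 1 + c₂ • e 2 ∧
      ⁅e 2, e 3⁆ = (a₁ + b₂) • e 2 := by
  intro e
  have he : ∀ i, e i = (coordEquiv (bracketDer a₁ b₁ c₁ a₂ b₂ c₂)).symm (Pi.single i 1) :=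
    fun i => by simp [e, bracketMetric]
  have hs : ∀ x, (coordEquiv (bracketDer a₁ b₁ c₁ a₂ b₂ c₂)).symm x
      = SemiHeis.mk (Heis.mk (x 0) (x 1) (x 2)) (x 3) := fun _ => rfl
  have hD : ∀ v, bracketDer a₁ b₁ c₁ a₂ b₂ c₂ v
      = Heis.mk (-(a₁ * v.coord 0 + a₂ * v.coord 1)) (-(b₁ * v.coord 0 + b₂ * v.coord 1))
        (-(c₁ * v.coord 0 + c₂ * v.coord 1 + (a₁ + b₂) * v.coord 2)) := fun _ => rfl
  simp only [he, hs]
  refine ⟨?_, ?_, ?_, ?_, ?_, ?_⟩ <;> apply SemiHeis.ext <;> try apply Heis.ext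
  all_goals simp [SemiHeis.bracket_def, Heis.bracket_def, hD]

/-! ### The six families -/

/-- `[e₁, e₂] = e₃`, i.e. the direct product `ℝ × H³`. -/
def family1 := bracketMetric 0 0 0 0 0 0

/-- `[e₁, e₂] = e₃`, `[e₁, e₄] = a e₁`, `[e₂, e₄] = d e₂`, `[e₃, e₄] = (a + d) e₃`. -/
def family2 (a d : ℝ) := bracketMetric a 0 0 0 d 0

/-- `[e₁, e₂] = e₃`, `[e₂, e₄] = -e₁`. -/
def family3 := bracketMetric 0 0 0 (-1) 0 0

/-- `[e₁, e₂] = e₃`, `[e₁, e₄] = a e₁`, `[e₂, e₄] = a e₂`, `[e₃, e₄] = 2a e₃`. -/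
def family4 (a : ℝ) := bracketMetric a 0 0 0 a 0

/-- `[e₁, e₂] = e₃`, `[e₁, e₄] = a e₁ - c e₂`, `[e₂, e₄] = c e₁ + d e₂`,
`[e₃, e₄] = (a + d) e₃`. -/
def family5 (a c d : ℝ) := bracketMetric a (-c) 0 c d 0

/-- `[e₁, e₂] = e₃`, `[e₁, e₄] = a e₁ + H e₃`, `[e₂, e₄] = d e₂`, `[e₃, e₄] = (a + d) e₃`. -/
def family6 (a d H : ℝ) := bracketMetric a 0 H 0 d 0

/-- Range of the free parameter `a` in family (2). -/
def Range2 (a : ℝ) : Prop := -(√3 / 2) ≤ a ∧ a < 1 / 2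

/-- In family (2), `d` is a positive solution of the stated equation. -/
def Solves2 (a d : ℝ) : Prop := 0 < d ∧ 4 * (a ^ 2 + d ^ 2 + a * d) - 3 = 0

/-- Range of the parameter `a` in family (4). -/
def Range4 (a : ℝ) : Prop := (0 < a ∧ a < 1 / 2) ∨ 1 / 2 < a

/-- Range of the free parameter `c` in family (5). -/
def Range5 (c : ℝ) : Prop := (0 < c ∧ c < 1 / 2) ∨ √(7 / 8) < c

/-- In family (5), `a < 0 < d` is a solution of the stated system with `|a| < d`. -/
def Solves5 (c a d : ℝ) : Prop :=
  a < 0 ∧ 0 < d ∧ |a| < d ∧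
    3 * a ^ 2 + 4 * c ^ 2 + 3 * d ^ 2 + 10 * a * d = 0 ∧
    32 * c ^ 4 + (32 * a * d + 8) * c ^ 2 - 28 * a * d - 9 = 0

/-- Range of the free parameter `H` in family (6). -/
def Range6 (H : ℝ) : Prop := 0 < H ∧ H < √(3 / 7)

/-- In family (6), `d` is a positive solution of the stated equation. -/
def Solves6 (H d : ℝ) : Prop :=
  0 < d ∧ 4 * d ^ 6 + 5 * (3 * H ^ 2 - 1) * d ^ 4 + (18 * H ^ 4 + 6 * H ^ 2 + 13) * d ^ 2
    + (H ^ 2 + 1) ^ 2 * (7 * H ^ 2 - 3) = 0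

/-- The parameter `a` of family (6) as a function of `H` and `d`. -/
def a6 (H d : ℝ) : ℝ := -((2 * d ^ 2 + 2 * H ^ 2 - 3) * d) / (2 * (d ^ 2 + H ^ 2 + 1))

/-- The value of `t` for family (2). -/
def t2 (a d : ℝ) : ℝ := -3 / (2 * (4 * a * d + 5))

/-- The value of `t` for family (4). -/
def t4 (a : ℝ) : ℝ := -(3 * (4 * a ^ 2 + 1)) / (44 * a ^ 2 + 1)

/-- The value of `t` for family (5). -/
def t5 (c : ℝ) : ℝ := -(3 * (32 * c ^ 4 - 7)) / (4 * (8 * c ^ 4 + 40 * c ^ 2 - 13))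

/-- The value of `t` for family (6). -/
def t6 (a d H : ℝ) : ℝ :=
  -(4 * a ^ 2 + 3 * d ^ 2 + 2 * a * d + 3 * H ^ 2 + 3)
    / (12 * a ^ 2 + 12 * d ^ 2 + 20 * a * d + H ^ 2 + 1)

/-- The metric is homothetic to a member of one of the families (1)-(3), and `t` is the value
attached to that member. -/
def InZeroEnergyFamilies {D : LieDerivation ℝ Heis Heis} (M : LeftInvMetric D) (t : ℝ) : Prop :=
  (Homothetic M family1 ∧ t = -3) ∨
  (∃ a d, Range2 a ∧ Solves2 a d ∧ Homothetic M (family2 a d) ∧ t = t2 a d) ∨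
  (Homothetic M family3 ∧ t = -3 / 2)

/-- The metric is homothetic to a member of one of the families (4)-(6), and `t` is the value
attached to that member. -/
def InNegativeEnergyFamilies {D : LieDerivation ℝ Heis Heis} (M : LeftInvMetric D) (t : ℝ) :
    Prop :=
  (∃ a, Range4 a ∧ Homothetic M (family4 a) ∧ t = t4 a) ∨
  (∃ a c d, Range5 c ∧ Solves5 c a d ∧ Homothetic M (family5 a c d) ∧ t = t5 c) ∨
  (∃ d H, Range6 H ∧ Solves6 H d ∧ Homothetic M (family6 (a6 H d) d H) ∧ t = t6 (a6 H d) d H)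

end

/-!
# Critical metrics for quadratic curvature functionals on `ℝ ⋉ H³`

The gradient of `F_t`, the Ricci tensor and `∇R` are computed from the structure constants of an
orthonormal basis of the Lie algebra, while homotheties are arbitrary diffeomorphisms, which need
not respect the group structures. The proof has an analytic half, which shows that the two are
compatible, and an algebraic half, which solves the equations.

*Homotheties.*  In the left-invariant orthonormal frames the differential of a smooth map is a
function `diffMatrix` with values in `4 × 4` matrices.  It satisfies a structure equation
(`diffMatrix_structure`), and for a homothety its rows are orthogonal of constant length.  The Koszul
formula then shows that its derivative is the difference of the two constant Levi-Civita
connections (`fderiv_diffMatrix`), and commuting second derivatives that it intertwines the curvature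
tensors (`riem_eq`).  Covariant derivatives of constant tensors follow by the Leibniz rule
(`act2_eq`, `act3_eq`, `act4_eq`).  Hence criticality, local symmetry, the sign of the energy and the
Einstein condition are invariant under homotheties.

Conversely, homotheties are constructed in three ways.  An isomorphism of Lie algebras that scales
the inner products integrates to an isomorphism of the groups (`LieHomothety.groupEquiv`).  If the
derivation acts on the plane of `e₁, e₂` by a multiple of the identity plus a skew part, the skew
part can be dropped without changing the isometry class (`homothetic_untwist`).  Finally, the
nilpotent groups carry several Heisenberg ideals, and an isomorphism exchanging them removes the
parameter `H` (`homothetic_nilpotent`).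

*Equations.*  Every left-invariant metric is, up to homothety, some `bracketMetric a b H c d 0`
(`LieHomothety.exists_normalForm`).  The Euler–Lagrange equation of this metric is a system of
nine polynomial equations in `a, b, H, c, d` and the product `T = -2 t τ` (`isCritical_iff`).

If `H = 0`, a rotation gives `b = -c`, and the system factors in terms of `a + d` and `a - d`
(`classify_zero`).  The solutions are families (1) to (5) and the complex hyperbolic plane, which is
symmetric (`isSymmetric_ch`).

If `H ≠ 0`, one equation determines `T` and another makes `b` a multiple of `c`.  When `c d ≠ 0`,
three of the remaining equations are inconsistent (`no_sol`): depending on the ratio `a / d`, a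
combination of them is a sum of positive terms.  The other solutions (`classify_of_ne_zero`) are
either nilpotent, and then homothetic to family (1) or (3), or have `b = c = 0`, and then elimination
of `a` leaves the cubic in `d ^ 2` of family (6), which is strictly increasing (`cubic6_strictMono`).

For every non-symmetric solution the equations determine `T`, and since `τ < 0` (`S_pos`), `T`
determines `t`.

*Solitons.*  That the metrics of families (1) to (3) are algebraic Ricci solitons is verified on the
structure constants.  For the families with negative energy, homotheties do not preserve the
soliton condition.  However, a critical algebraic Ricci soliton in normal form has zero energy or is
Einstein (`energy_eq_zero_or_einstein`), both of these are invariant under homotheties, and neither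
holds for a member of families (4) to (6).
-/


noncomputable section
/-! ### Curvature and the Euler–Lagrange equation of the normal form -/

namespace NormalForm

variable (a b H c d : ℝ)

/-- The structure constants of `bracketMetric a b H c d 0`. -/
def sc (a b H c d : ℝ) : Fin 4 → Fin 4 → Fin 4 → ℝ :=
  ![![![0, 0, 0, 0], ![0, 0, 1, 0], ![0, 0, 0, 0], ![a, b, H, 0]],
    ![![0, 0, -1, 0], ![0, 0, 0, 0], ![0, 0, 0, 0], ![c, d, 0, 0]],
    ![![0, 0, 0, 0], ![0, 0, 0, 0], ![0, 0, 0, 0], ![0, 0, a + d, 0]],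
    ![![-a, -b, -H, 0], ![-c, -d, 0, 0], ![0, 0, -(a + d), 0], ![0, 0, 0, 0]]]

theorem structConst_eq : (bracketMetric a b H c d 0).structConst = sc a b H c d := by
  have hs : ∀ x, (coordEquiv (bracketDer a b H c d 0)).symm x
      = SemiHeis.mk (Heis.mk (x 0) (x 1) (x 2)) (x 3) := fun _ => rfl
  have hD : ∀ v, bracketDer a b H c d 0 v
      = Heis.mk (-(a * v.coord 0 + c * v.coord 1)) (-(b * v.coord 0 + d * v.coord 1))
        (-(H * v.coord 0 + 0 * v.coord 1 + (a + d) * v.coord 2)) := fun _ => rfl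
  have hc : ∀ p, coordEquiv (bracketDer a b H c d 0) p
      = ![p.heis.coord 0, p.heis.coord 1, p.heis.coord 2, p.real] := fun _ => rfl
  funext i j k
  simp only [LeftInvMetric.structConst, bracketMetric, Module.Basis.coe_ofEquivFun,
    Module.Basis.ofEquivFun_repr_apply, hs, hc]
  fin_cases i <;> fin_cases j <;> fin_cases k <;>
    simp [SemiHeis.bracket_def, Heis.bracket_def, hD, sc]

/-- The Levi-Civita connection of `bracketMetric a b H c d 0`. -/
def cn (a b H c d : ℝ) : Fin 4 → Fin 4 → Fin 4 → ℝ :=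
  ![![![0, 0, 0, -a],
      ![0, 0, 1 / 2, (-b - c) / 2],
      ![0, -1 / 2, 0, -H / 2],
      ![a, (b + c) / 2, H / 2, 0]],
    ![![0, 0, -1 / 2, (-b - c) / 2],
      ![0, 0, 0, -d],
      ![1 / 2, 0, 0, 0],
      ![(b + c) / 2, d, 0, 0]],
    ![![0, -1 / 2, 0, -H / 2],
      ![1 / 2, 0, 0, 0],
      ![0, 0, 0, -a - d],
      ![H / 2, 0, a + d, 0]],
    ![![0, (-b + c) / 2, -H / 2, 0],
      ![(b - c) / 2, 0, 0, 0],
      ![H / 2, 0, 0, 0],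
      ![0, 0, 0, 0]]]

theorem conn_eq : (bracketMetric a b H c d 0).conn = cn a b H c d := by
  funext i j k
  simp only [LeftInvMetric.conn, structConst_eq]
  fin_cases i <;> fin_cases j <;> fin_cases k <;> simp [sc, cn] <;> ring

/-- The Ricci tensor of `bracketMetric a b H c d 0`. -/
def rc (a b H c d : ℝ) : Fin 4 → Fin 4 → ℝ :=
  ![![(-4 * a ^ 2 - 4 * a * d - b ^ 2 - H ^ 2 + c ^ 2 - 1) / 2, (-a * b - 3 * a * c - 3 * b * d
      - c * d) / 2, (-2 * a * H - 3 * H * d) / 2, 0],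
    ![(-a * b - 3 * a * c - 3 * b * d - c * d) / 2, (-4 * a * d + b ^ 2 - c ^ 2 - 4 * d ^ 2
      - 1) / 2, (b * H) / 2, -H / 2],
    ![(-2 * a * H - 3 * H * d) / 2, (b * H) / 2, (-4 * a ^ 2 - 8 * a * d + H ^ 2 - 4 * d ^ 2
      + 1) / 2, 0],
    ![0, -H / 2, 0, (-4 * a ^ 2 - 4 * a * d - b ^ 2 - 2 * b * c - H ^ 2 - c ^ 2 - 4 * d ^ 2) / 2]]

theorem ric_eq : (bracketMetric a b H c d 0).ric = rc a b H c d := by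
  funext i j
  simp only [LeftInvMetric.ric, LeftInvMetric.riem, Fin.sum_univ_four, conn_eq, structConst_eq]
  fin_cases i <;> fin_cases j <;> simp [sc, cn, rc] <;> ring

theorem scal_eq : (bracketMetric a b H c d 0).scal
    = -(12 * a ^ 2 + 20 * a * d + (b + c) ^ 2 + 12 * d ^ 2 + H ^ 2 + 1) / 2 := by
  simp [LeftInvMetric.scal, ric_eq, Fin.sum_univ_four, rc]
  ring

theorem ricNormSq_eq : (bracketMetric a b H c d 0).ricNormSq =
    (48 * a ^ 4 + 128 * a ^ 3 * d + 18 * a ^ 2 * b ^ 2 + 28 * a ^ 2 * b * c + 16 * a ^ 2 * H ^ 2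
      + 18 * a ^ 2 * c ^ 2 + 176 * a ^ 2 * d ^ 2 + 20 * a * b ^ 2 * d + 56 * a * b * c * d
      + 24 * a * H ^ 2 * d + 20 * a * c ^ 2 * d + 128 * a * d ^ 3 + 3 * b ^ 4 + 4 * b ^ 3 * c
      + 6 * b ^ 2 * H ^ 2 + 2 * b ^ 2 * c ^ 2 + 18 * b ^ 2 * d ^ 2 + 4 * b * H ^ 2 * c
      + 4 * b * c ^ 3 + 28 * b * c * d ^ 2 + 3 * H ^ 4 + 18 * H ^ 2 * d ^ 2 + 3 * c ^ 4
      + 18 * c ^ 2 * d ^ 2 + 48 * d ^ 4 + 6 * H ^ 2 + 3) / 4 := by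
  simp [LeftInvMetric.ricNormSq, ric_eq, Fin.sum_univ_four, rc]
  ring

/-- The covariant derivative `∇_{e₁} ρ` of the Ricci tensor of `bracketMetric a b H c d 0`. -/
def dr0 (a b H c d : ℝ) : Fin 4 → Fin 4 → ℝ :=
  ![![0, (3 * H * d) / 4, (-a * b - 3 * a * c - 3 * b * d - c * d) / 4, (a * b ^ 2 + 2 * a * H ^ 2
      - a * c ^ 2 - 8 * a * d ^ 2 + 3 * b ^ 2 * d + 4 * b * c * d + 3 * H ^ 2 * d + c ^ 2 * d
      + 2 * a) / 4],
    ![(3 * H * d) / 4, (-2 * b * H - H * c) / 2, (4 * a ^ 2 + 4 * a * d + b ^ 2 - 2 * H ^ 2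
      - c ^ 2 - 2) / 4, (-2 * a ^ 2 * b + 2 * a ^ 2 * c + 6 * a * b * d + 2 * a * c * d
      - 2 * b ^ 3 - 4 * b ^ 2 * c - 2 * b * H ^ 2 - 2 * b * c ^ 2 - H ^ 2 * c + b + c) / 4],
    ![(-a * b - 3 * a * c - 3 * b * d - c * d) / 4, (4 * a ^ 2 + 4 * a * d + b ^ 2 - 2 * H ^ 2
      - c ^ 2 - 2) / 4, (b * H) / 2, (4 * a ^ 2 * H + 10 * a * H * d - 2 * b ^ 2 * H
      - 3 * b * H * c - 2 * H ^ 3 - H * c ^ 2 - 2 * H) / 4],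
    ![(a * b ^ 2 + 2 * a * H ^ 2 - a * c ^ 2 - 8 * a * d ^ 2 + 3 * b ^ 2 * d + 4 * b * c * d
      + 3 * H ^ 2 * d + c ^ 2 * d + 2 * a) / 4, (-2 * a ^ 2 * b + 2 * a ^ 2 * c + 6 * a * b * d
      + 2 * a * c * d - 2 * b ^ 3 - 4 * b ^ 2 * c - 2 * b * H ^ 2 - 2 * b * c ^ 2 - H ^ 2 * c + b
      + c) / 4, (4 * a ^ 2 * H + 10 * a * H * d - 2 * b ^ 2 * H - 3 * b * H * c - 2 * H ^ 3
      - H * c ^ 2 - 2 * H) / 4, (b * H + H * c) / 2]]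

/-- The covariant derivative `∇_{e₂} ρ` of the Ricci tensor of `bracketMetric a b H c d 0`. -/
def dr1 (a b H c d : ℝ) : Fin 4 → Fin 4 → ℝ :=
  ![![(-2 * a * H - 3 * H * d) / 2, (-H * c) / 4, (-4 * a * d + b ^ 2 + 2 * H ^ 2 - c ^ 2
      - 4 * d ^ 2 + 2) / 4, (2 * a * b * d + 6 * a * c * d - 2 * b ^ 2 * c - 4 * b * c ^ 2
      + 2 * b * d ^ 2 - 2 * c ^ 3 - 2 * c * d ^ 2 + b + c) / 4],
    ![(-H * c) / 4, -H * d, (a * b + 3 * a * c + 3 * b * d + c * d) / 4, (-8 * a ^ 2 * d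
      + a * b ^ 2 + 4 * a * b * c + 3 * a * c ^ 2 - b ^ 2 * d - 2 * H ^ 2 * d + c ^ 2 * d
      + 2 * d) / 4],
    ![(-4 * a * d + b ^ 2 + 2 * H ^ 2 - c ^ 2 - 4 * d ^ 2 + 2) / 4, (a * b + 3 * a * c + 3 * b * d
      + c * d) / 4, (2 * a * H + 3 * H * d) / 2, (2 * a * b * H + 2 * a * H * c + b * H * d
      + 3 * H * c * d) / 4],
    ![(2 * a * b * d + 6 * a * c * d - 2 * b ^ 2 * c - 4 * b * c ^ 2 + 2 * b * d ^ 2 - 2 * c ^ 3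
      - 2 * c * d ^ 2 + b + c) / 4, (-8 * a ^ 2 * d + a * b ^ 2 + 4 * a * b * c + 3 * a * c ^ 2
      - b ^ 2 * d - 2 * H ^ 2 * d + c ^ 2 * d + 2 * d) / 4, (2 * a * b * H + 2 * a * H * c
      + b * H * d + 3 * H * c * d) / 4, H * d]]

/-- The covariant derivative `∇_{e₃} ρ` of the Ricci tensor of `bracketMetric a b H c d 0`. -/
def dr2 (a b H c d : ℝ) : Fin 4 → Fin 4 → ℝ :=
  ![![(-a * b - 3 * a * c - 3 * b * d - c * d) / 2, (2 * a ^ 2 + b ^ 2 - c ^ 2 - 2 * d ^ 2) / 2,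
      (b * H) / 4, (2 * a ^ 2 * H + 5 * a * H * d - b * H * c - H * c ^ 2 + H * d ^ 2) / 2],
    ![(2 * a ^ 2 + b ^ 2 - c ^ 2 - 2 * d ^ 2) / 2, (a * b + 3 * a * c + 3 * b * d + c * d) / 2,
      (H * d) / 4, (-a * b * H + 3 * a * H * c + b * H * d + H * c * d) / 4],
    ![(b * H) / 4, (H * d) / 4, 0, (8 * a ^ 2 * d - 2 * a * b ^ 2 - 4 * a * b * c - 2 * a * H ^ 2
      - 2 * a * c ^ 2 + 8 * a * d ^ 2 - 2 * b ^ 2 * d - 4 * b * c * d - H ^ 2 * d - 2 * c ^ 2 * d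
      - 2 * a - 2 * d) / 4],
    ![(2 * a ^ 2 * H + 5 * a * H * d - b * H * c - H * c ^ 2 + H * d ^ 2) / 2, (-a * b * H
      + 3 * a * H * c + b * H * d + H * c * d) / 4, (8 * a ^ 2 * d - 2 * a * b ^ 2 - 4 * a * b * c
      - 2 * a * H ^ 2 - 2 * a * c ^ 2 + 8 * a * d ^ 2 - 2 * b ^ 2 * d - 4 * b * c * d - H ^ 2 * d
      - 2 * c ^ 2 * d - 2 * a - 2 * d) / 4, 0]]

/-- The covariant derivative `∇_{e₄} ρ` of the Ricci tensor of `bracketMetric a b H c d 0`. -/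
def dr3 (a b H c d : ℝ) : Fin 4 → Fin 4 → ℝ :=
  ![![(-a * b ^ 2 - 2 * a * b * c - 2 * a * H ^ 2 + 3 * a * c ^ 2 - 3 * b ^ 2 * d + 2 * b * c * d
      - 3 * H ^ 2 * d + c ^ 2 * d) / 2, (4 * a ^ 2 * b - 4 * a ^ 2 * c + 2 * b ^ 3 - 2 * b ^ 2 * c
      + 2 * b * H ^ 2 - 2 * b * c ^ 2 - 4 * b * d ^ 2 - H ^ 2 * c + 2 * c ^ 3
      + 4 * c * d ^ 2) / 4, (-4 * a * H * d + 2 * b ^ 2 * H - b * H * c + 2 * H ^ 3 - H * c ^ 2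
      - 4 * H * d ^ 2 + 2 * H) / 4, (-b * H + H * c) / 4],
    ![(4 * a ^ 2 * b - 4 * a ^ 2 * c + 2 * b ^ 3 - 2 * b ^ 2 * c + 2 * b * H ^ 2 - 2 * b * c ^ 2
      - 4 * b * d ^ 2 - H ^ 2 * c + 2 * c ^ 3 + 4 * c * d ^ 2) / 4, (a * b ^ 2 + 2 * a * b * c
      - 3 * a * c ^ 2 + 3 * b ^ 2 * d - 2 * b * c * d - c ^ 2 * d) / 2, (3 * a * b * H + a * H * c
      + 6 * b * H * d - 2 * H * c * d) / 4, 0],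
    ![(-4 * a * H * d + 2 * b ^ 2 * H - b * H * c + 2 * H ^ 3 - H * c ^ 2 - 4 * H * d ^ 2
      + 2 * H) / 4, (3 * a * b * H + a * H * c + 6 * b * H * d - 2 * H * c * d) / 4,
      (2 * a * H ^ 2 + 3 * H ^ 2 * d) / 2, 0],
    ![(-b * H + H * c) / 4, 0, 0, 0]]

/-- The covariant derivative of the Ricci tensor of `bracketMetric a b H c d 0`. -/
def dr (a b H c d : ℝ) : Fin 4 → Fin 4 → Fin 4 → ℝ :=
  ![dr0 a b H c d, dr1 a b H c d, dr2 a b H c d, dr3 a b H c d]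

theorem covRic_eq0 : (bracketMetric a b H c d 0).covRic 0 = dr0 a b H c d := by
  funext i j
  simp only [LeftInvMetric.covRic, Fin.sum_univ_four, conn_eq, ric_eq]
  fin_cases i <;> fin_cases j <;> simp [cn, rc, dr0] <;> ring

theorem covRic_eq1 : (bracketMetric a b H c d 0).covRic 1 = dr1 a b H c d := by
  funext i j
  simp only [LeftInvMetric.covRic, Fin.sum_univ_four, conn_eq, ric_eq]
  fin_cases i <;> fin_cases j <;> simp [cn, rc, dr1] <;> ring

theorem covRic_eq2 : (bracketMetric a b H c d 0).covRic 2 = dr2 a b H c d := by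
  funext i j
  simp only [LeftInvMetric.covRic, Fin.sum_univ_four, conn_eq, ric_eq]
  fin_cases i <;> fin_cases j <;> simp [cn, rc, dr2] <;> ring

theorem covRic_eq3 : (bracketMetric a b H c d 0).covRic 3 = dr3 a b H c d := by
  funext i j
  simp only [LeftInvMetric.covRic, Fin.sum_univ_four, conn_eq, ric_eq]
  fin_cases i <;> fin_cases j <;> simp [cn, rc, dr3] <;> ring

theorem covRic_eq : (bracketMetric a b H c d 0).covRic = dr a b H c d := by
  funext k
  fin_cases k
  exacts [covRic_eq0 a b H c d, covRic_eq1 a b H c d, covRic_eq2 a b H c d, covRic_eq3 a b H c d]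

/-- `-2τ` for `bracketMetric a b H c d 0`. -/
def S (a b H c d : ℝ) : ℝ := 12 * a ^ 2 + 20 * a * d + (b + c) ^ 2 + 12 * d ^ 2 + H ^ 2 + 1

theorem S_pos : 0 < S a b H c d := by
  unfold S
  nlinarith [sq_nonneg (a + d), sq_nonneg (a - d), sq_nonneg (b + c), sq_nonneg H]

/-- Eight times the `(e₁, e₁)` component of the gradient of `F_t`, with `T = -2 t τ`. -/
def g00 (a b H c d T : ℝ) : ℝ :=
  -16 * a ^ 4 - 18 * a ^ 2 * b ^ 2 + 28 * a ^ 2 * b * c - 10 * a ^ 2 * c ^ 2 + 48 * a ^ 2 * d ^ 2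
    + 28 * a * b ^ 2 * d + 24 * a * b * c * d + 40 * a * H ^ 2 * d - 20 * a * c ^ 2 * d
    + 64 * a * d ^ 3 - 9 * b ^ 4 - 4 * b ^ 3 * c - 18 * b ^ 2 * H ^ 2 + 2 * b ^ 2 * c ^ 2
    + 30 * b ^ 2 * d ^ 2 - 4 * b * H ^ 2 * c + 12 * b * c ^ 3 - 4 * b * c * d ^ 2 - 9 * H ^ 4
    + 30 * H ^ 2 * d ^ 2 + 15 * c ^ 4 + 38 * c ^ 2 * d ^ 2 + 48 * d ^ 4 - 4 * a ^ 2 * T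
    + 4 * a * d * T - 3 * b ^ 2 * T + 2 * b * c * T - 3 * H ^ 2 * T + 5 * c ^ 2 * T
    + 12 * d ^ 2 * T - 18 * H ^ 2 - 3 * T - 9

/-- Eight times the `(e₂, e₂)` component of the gradient of `F_t`, with `T = -2 t τ`. -/
def g11 (a b H c d T : ℝ) : ℝ :=
  48 * a ^ 4 + 64 * a ^ 3 * d + 38 * a ^ 2 * b ^ 2 - 4 * a ^ 2 * b * c + 16 * a ^ 2 * H ^ 2
    + 30 * a ^ 2 * c ^ 2 + 48 * a ^ 2 * d ^ 2 - 20 * a * b ^ 2 * d + 24 * a * b * c * d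
    + 8 * a * H ^ 2 * d + 28 * a * c ^ 2 * d + 15 * b ^ 4 + 12 * b ^ 3 * c + 18 * b ^ 2 * H ^ 2
    + 2 * b ^ 2 * c ^ 2 - 10 * b ^ 2 * d ^ 2 + 4 * b * H ^ 2 * c - 4 * b * c ^ 3
    + 28 * b * c * d ^ 2 + 3 * H ^ 4 + 2 * H ^ 2 * d ^ 2 - 9 * c ^ 4 - 18 * c ^ 2 * d ^ 2
    - 16 * d ^ 4 + 12 * a ^ 2 * T + 4 * a * d * T + 5 * b ^ 2 * T + 2 * b * c * T + H ^ 2 * T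
    - 3 * c ^ 2 * T - 4 * d ^ 2 * T - 6 * H ^ 2 - 3 * T - 9

/-- Eight times the `(e₃, e₃)` component of the gradient of `F_t`, with `T = -2 t τ`. -/
def g22 (a b H c d T : ℝ) : ℝ :=
  -16 * a ^ 4 - 64 * a ^ 3 * d + 2 * a ^ 2 * b ^ 2 - 4 * a ^ 2 * b * c + 2 * a ^ 2 * c ^ 2
    - 80 * a ^ 2 * d ^ 2 - 12 * a * b ^ 2 * d - 8 * a * b * c * d - 40 * a * H ^ 2 * d
    - 12 * a * c ^ 2 * d - 64 * a * d ^ 3 + 3 * b ^ 4 + 4 * b ^ 3 * c + 18 * b ^ 2 * H ^ 2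
    + 2 * b ^ 2 * c ^ 2 + 2 * b ^ 2 * d ^ 2 + 12 * b * H ^ 2 * c + 4 * b * c ^ 3
    - 4 * b * c * d ^ 2 + 15 * H ^ 4 - 10 * H ^ 2 * d ^ 2 + 3 * c ^ 4 + 2 * c ^ 2 * d ^ 2
    - 16 * d ^ 4 - 4 * a ^ 2 * T - 12 * a * d * T + b ^ 2 * T + 2 * b * c * T + 5 * H ^ 2 * T
    + c ^ 2 * T - 4 * d ^ 2 * T + 30 * H ^ 2 + 5 * T + 15

/-- Eight times the `(e₄, e₄)` component of the gradient of `F_t`, with `T = -2 t τ`. -/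
def g33 (a b H c d T : ℝ) : ℝ :=
  -16 * a ^ 4 - 22 * a ^ 2 * b ^ 2 - 20 * a ^ 2 * b * c - 16 * a ^ 2 * H ^ 2 - 22 * a ^ 2 * c ^ 2
    - 16 * a ^ 2 * d ^ 2 + 4 * a * b ^ 2 * d - 40 * a * b * c * d - 8 * a * H ^ 2 * d
    + 4 * a * c ^ 2 * d - 9 * b ^ 4 - 12 * b ^ 3 * c - 18 * b ^ 2 * H ^ 2 - 6 * b ^ 2 * c ^ 2
    - 22 * b ^ 2 * d ^ 2 - 12 * b * H ^ 2 * c - 12 * b * c ^ 3 - 20 * b * c * d ^ 2 - 9 * H ^ 4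
    - 22 * H ^ 2 * d ^ 2 - 9 * c ^ 4 - 22 * c ^ 2 * d ^ 2 - 16 * d ^ 4 - 4 * a ^ 2 * T
    + 4 * a * d * T - 3 * b ^ 2 * T - 6 * b * c * T - 3 * H ^ 2 * T - 3 * c ^ 2 * T
    - 4 * d ^ 2 * T - 6 * H ^ 2 + T + 3

/-- Eight times the `(e₁, e₂)` component of the gradient of `F_t`, with `T = -2 t τ`. -/
def g01 (a b H c d T : ℝ) : ℝ :=
  -28 * a ^ 3 * b - 36 * a ^ 3 * c - 92 * a ^ 2 * b * d - 36 * a ^ 2 * c * d - 12 * a * b ^ 3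
    - 12 * a * b ^ 2 * c - 12 * a * b * H ^ 2 - 4 * a * b * c ^ 2 - 36 * a * b * d ^ 2
    - 4 * a * H ^ 2 * c - 36 * a * c ^ 3 - 92 * a * c * d ^ 2 - 36 * b ^ 3 * d - 4 * b ^ 2 * c * d
    - 36 * b * H ^ 2 * d - 12 * b * c ^ 2 * d - 36 * b * d ^ 3 + 8 * H ^ 2 * c * d
    - 12 * c ^ 3 * d - 28 * c * d ^ 3 - 4 * a * b * T - 12 * a * c * T - 12 * b * d * T
    - 4 * c * d * T

/-- Eight times the `(e₁, e₃)` component of the gradient of `F_t`, with `T = -2 t τ`. -/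
def g02 (a b H c d T : ℝ) : ℝ :=
  -32 * a ^ 3 * H - 64 * a ^ 2 * H * d - 24 * a * b ^ 2 * H - 16 * a * b * H * c - 24 * a * H ^ 3
    + 4 * a * H * c ^ 2 - 48 * a * H * d ^ 2 - 36 * b ^ 2 * H * d - 12 * b * H * c * d
    - 36 * H ^ 3 * d - 8 * H * c ^ 2 * d - 36 * H * d ^ 3 - 8 * a * H * T - 12 * H * d * T
    - 24 * a * H - 36 * H * d

/-- Eight times the `(e₁, e₄)` component of the gradient of `F_t`, with `T = -2 t τ`. -/
def g03 (a b H c d _T : ℝ) : ℝ :=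
  4 * a * H * c + 12 * b * H * d - 8 * H * c * d

/-- Eight times the `(e₂, e₃)` component of the gradient of `F_t`, with `T = -2 t τ`. -/
def g12 (a b H c d T : ℝ) : ℝ :=
  16 * a ^ 2 * b * H - 12 * a ^ 2 * H * c - 28 * a * b * H * d + 16 * a * H * c * d
    + 12 * b ^ 3 * H + 8 * b ^ 2 * H * c + 12 * b * H ^ 3 - 12 * b * H * d ^ 2
    + 16 * H * c * d ^ 2 + 4 * b * H * T + 12 * b * H

/-- Eight times the `(e₂, e₄)` component of the gradient of `F_t`, with `T = -2 t τ`. -/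
def g13 (a b H c d T : ℝ) : ℝ :=
  -16 * a ^ 2 * H - 8 * a * H * d - 12 * b ^ 2 * H - 8 * b * H * c - 12 * H ^ 3 - 12 * H * d ^ 2
    - 4 * H * T - 12 * H

theorem gradF_00 (t : ℝ) : (bracketMetric a b H c d 0).gradF t 0 0
    = 1 / 8 * g00 a b H c d (t * S a b H c d) := by
  simp only [LeftInvMetric.gradF, LeftInvMetric.energy, LeftInvMetric.lapRic,
    LeftInvMetric.covCovRic, LeftInvMetric.riemRic, LeftInvMetric.riem, Fin.sum_univ_four,
    conn_eq, covRic_eq, structConst_eq, ric_eq, scal_eq, ricNormSq_eq]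
  simp [sc, cn, rc, dr, dr0, dr1, dr2, dr3, S, g00]
  ring

theorem gradF_01 (t : ℝ) : (bracketMetric a b H c d 0).gradF t 0 1
    = 1 / 8 * g01 a b H c d (t * S a b H c d) := by
  simp only [LeftInvMetric.gradF, LeftInvMetric.energy, LeftInvMetric.lapRic,
    LeftInvMetric.covCovRic, LeftInvMetric.riemRic, LeftInvMetric.riem, Fin.sum_univ_four,
    conn_eq, covRic_eq, structConst_eq, ric_eq, scal_eq, ricNormSq_eq]
  simp [sc, cn, rc, dr, dr0, dr1, dr2, dr3, S, g01]
  ring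

theorem gradF_02 (t : ℝ) : (bracketMetric a b H c d 0).gradF t 0 2
    = 1 / 8 * g02 a b H c d (t * S a b H c d) := by
  simp only [LeftInvMetric.gradF, LeftInvMetric.energy, LeftInvMetric.lapRic,
    LeftInvMetric.covCovRic, LeftInvMetric.riemRic, LeftInvMetric.riem, Fin.sum_univ_four,
    conn_eq, covRic_eq, structConst_eq, ric_eq, scal_eq, ricNormSq_eq]
  simp [sc, cn, rc, dr, dr0, dr1, dr2, dr3, S, g02]
  ring

theorem gradF_03 (t : ℝ) : (bracketMetric a b H c d 0).gradF t 0 3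
    = 1 / 8 * g03 a b H c d (t * S a b H c d) := by
  simp only [LeftInvMetric.gradF, LeftInvMetric.energy, LeftInvMetric.lapRic,
    LeftInvMetric.covCovRic, LeftInvMetric.riemRic, LeftInvMetric.riem, Fin.sum_univ_four,
    conn_eq, covRic_eq, structConst_eq, ric_eq, scal_eq, ricNormSq_eq]
  simp [sc, cn, rc, dr, dr0, dr1, dr2, dr3, g03]
  ring

theorem gradF_10 (t : ℝ) : (bracketMetric a b H c d 0).gradF t 1 0
    = 1 / 8 * g01 a b H c d (t * S a b H c d) := by
  simp only [LeftInvMetric.gradF, LeftInvMetric.energy, LeftInvMetric.lapRic,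
    LeftInvMetric.covCovRic, LeftInvMetric.riemRic, LeftInvMetric.riem, Fin.sum_univ_four,
    conn_eq, covRic_eq, structConst_eq, ric_eq, scal_eq, ricNormSq_eq]
  simp [sc, cn, rc, dr, dr0, dr1, dr2, dr3, S, g01]
  ring

theorem gradF_11 (t : ℝ) : (bracketMetric a b H c d 0).gradF t 1 1
    = 1 / 8 * g11 a b H c d (t * S a b H c d) := by
  simp only [LeftInvMetric.gradF, LeftInvMetric.energy, LeftInvMetric.lapRic,
    LeftInvMetric.covCovRic, LeftInvMetric.riemRic, LeftInvMetric.riem, Fin.sum_univ_four,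
    conn_eq, covRic_eq, structConst_eq, ric_eq, scal_eq, ricNormSq_eq]
  simp [sc, cn, rc, dr, dr0, dr1, dr2, dr3, S, g11]
  ring

theorem gradF_12 (t : ℝ) : (bracketMetric a b H c d 0).gradF t 1 2
    = 1 / 8 * g12 a b H c d (t * S a b H c d) := by
  simp only [LeftInvMetric.gradF, LeftInvMetric.energy, LeftInvMetric.lapRic,
    LeftInvMetric.covCovRic, LeftInvMetric.riemRic, LeftInvMetric.riem, Fin.sum_univ_four,
    conn_eq, covRic_eq, structConst_eq, ric_eq, scal_eq, ricNormSq_eq]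
  simp [sc, cn, rc, dr, dr0, dr1, dr2, dr3, S, g12]
  ring

theorem gradF_13 (t : ℝ) : (bracketMetric a b H c d 0).gradF t 1 3
    = 1 / 8 * g13 a b H c d (t * S a b H c d) := by
  simp only [LeftInvMetric.gradF, LeftInvMetric.energy, LeftInvMetric.lapRic,
    LeftInvMetric.covCovRic, LeftInvMetric.riemRic, LeftInvMetric.riem, Fin.sum_univ_four,
    conn_eq, covRic_eq, structConst_eq, ric_eq, scal_eq, ricNormSq_eq]
  simp [sc, cn, rc, dr, dr0, dr1, dr2, dr3, S, g13]
  ring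

theorem gradF_20 (t : ℝ) : (bracketMetric a b H c d 0).gradF t 2 0
    = 1 / 8 * g02 a b H c d (t * S a b H c d) := by
  simp only [LeftInvMetric.gradF, LeftInvMetric.energy, LeftInvMetric.lapRic,
    LeftInvMetric.covCovRic, LeftInvMetric.riemRic, LeftInvMetric.riem, Fin.sum_univ_four,
    conn_eq, covRic_eq, structConst_eq, ric_eq, scal_eq, ricNormSq_eq]
  simp [sc, cn, rc, dr, dr0, dr1, dr2, dr3, S, g02]
  ring

theorem gradF_21 (t : ℝ) : (bracketMetric a b H c d 0).gradF t 2 1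
    = 1 / 8 * g12 a b H c d (t * S a b H c d) := by
  simp only [LeftInvMetric.gradF, LeftInvMetric.energy, LeftInvMetric.lapRic,
    LeftInvMetric.covCovRic, LeftInvMetric.riemRic, LeftInvMetric.riem, Fin.sum_univ_four,
    conn_eq, covRic_eq, structConst_eq, ric_eq, scal_eq, ricNormSq_eq]
  simp [sc, cn, rc, dr, dr0, dr1, dr2, dr3, S, g12]
  ring

theorem gradF_22 (t : ℝ) : (bracketMetric a b H c d 0).gradF t 2 2
    = 1 / 8 * g22 a b H c d (t * S a b H c d) := by
  simp only [LeftInvMetric.gradF, LeftInvMetric.energy, LeftInvMetric.lapRic,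
    LeftInvMetric.covCovRic, LeftInvMetric.riemRic, LeftInvMetric.riem, Fin.sum_univ_four,
    conn_eq, covRic_eq, structConst_eq, ric_eq, scal_eq, ricNormSq_eq]
  simp [sc, cn, rc, dr, dr0, dr1, dr2, dr3, S, g22]
  ring

theorem gradF_23 (t : ℝ) : (bracketMetric a b H c d 0).gradF t 2 3 = 0 := by
  simp only [LeftInvMetric.gradF, LeftInvMetric.energy, LeftInvMetric.lapRic,
    LeftInvMetric.covCovRic, LeftInvMetric.riemRic, LeftInvMetric.riem, Fin.sum_univ_four,
    conn_eq, covRic_eq, structConst_eq, ric_eq, scal_eq, ricNormSq_eq]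
  simp [sc, cn, rc, dr, dr0, dr1, dr2, dr3]
  ring

theorem gradF_30 (t : ℝ) : (bracketMetric a b H c d 0).gradF t 3 0
    = 1 / 8 * g03 a b H c d (t * S a b H c d) := by
  simp only [LeftInvMetric.gradF, LeftInvMetric.energy, LeftInvMetric.lapRic,
    LeftInvMetric.covCovRic, LeftInvMetric.riemRic, LeftInvMetric.riem, Fin.sum_univ_four,
    conn_eq, covRic_eq, structConst_eq, ric_eq, scal_eq, ricNormSq_eq]
  simp [sc, cn, rc, dr, dr0, dr1, dr2, dr3, g03]
  ring

theorem gradF_31 (t : ℝ) : (bracketMetric a b H c d 0).gradF t 3 1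
    = 1 / 8 * g13 a b H c d (t * S a b H c d) := by
  simp only [LeftInvMetric.gradF, LeftInvMetric.energy, LeftInvMetric.lapRic,
    LeftInvMetric.covCovRic, LeftInvMetric.riemRic, LeftInvMetric.riem, Fin.sum_univ_four,
    conn_eq, covRic_eq, structConst_eq, ric_eq, scal_eq, ricNormSq_eq]
  simp [sc, cn, rc, dr, dr0, dr1, dr2, dr3, S, g13]
  ring

theorem gradF_32 (t : ℝ) : (bracketMetric a b H c d 0).gradF t 3 2 = 0 := by
  simp only [LeftInvMetric.gradF, LeftInvMetric.energy, LeftInvMetric.lapRic,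
    LeftInvMetric.covCovRic, LeftInvMetric.riemRic, LeftInvMetric.riem, Fin.sum_univ_four,
    conn_eq, covRic_eq, structConst_eq, ric_eq, scal_eq, ricNormSq_eq]
  simp [sc, cn, rc, dr, dr0, dr1, dr2, dr3]
  ring

theorem gradF_33 (t : ℝ) : (bracketMetric a b H c d 0).gradF t 3 3
    = 1 / 8 * g33 a b H c d (t * S a b H c d) := by
  simp only [LeftInvMetric.gradF, LeftInvMetric.energy, LeftInvMetric.lapRic,
    LeftInvMetric.covCovRic, LeftInvMetric.riemRic, LeftInvMetric.riem, Fin.sum_univ_four,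
    conn_eq, covRic_eq, structConst_eq, ric_eq, scal_eq, ricNormSq_eq]
  simp [sc, cn, rc, dr, dr0, dr1, dr2, dr3, S, g33]
  ring

/-- The components `(e₃, e₄)` vanish identically. -/
theorem isCritical_iff (t T : ℝ) (hT : T = t * S a b H c d) :
    (bracketMetric a b H c d 0).IsCritical t ↔
      g00 a b H c d T = 0 ∧ g11 a b H c d T = 0 ∧ g22 a b H c d T = 0 ∧ g33 a b H c d T = 0 ∧
      g01 a b H c d T = 0 ∧ g02 a b H c d T = 0 ∧ g03 a b H c d T = 0 ∧ g12 a b H c d T = 0 ∧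
      g13 a b H c d T = 0 := by
  simp only [LeftInvMetric.IsCritical, Fin.forall_fin_succ]
  simp [gradF_00, gradF_01, gradF_02, gradF_03, gradF_10, gradF_11, gradF_12, gradF_13,
    gradF_20, gradF_21, gradF_22, gradF_23, gradF_30, gradF_31, gradF_32, gradF_33, ← hT]
  tauto

end NormalForm
end

noncomputable section
/-! ### Critical metrics whose derivation has a central component -/

namespace NormalForm

/-- The `(e₁, e₂)` component of the Euler–Lagrange equation when `H ≠ 0` and `c, d ≠ 0`, divided by
`c d`, in terms of `k = a / d`, `w = d ^ 2`, `y = c ^ 2` and `h = H ^ 2`.  The `(e₁, e₄)`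
and `(e₂, e₄)` components have been used to eliminate `b = c (2 - k) / 3` and `T`. -/
def red01 (k w y h : ℝ) : ℝ :=
  9 * (k + 1) * (k - 2) * (k ^ 2 + 5 * k + 2) * w + (k + 1) * (8 * k ^ 2 - 47 * k - 1) * y
    + 9 * (8 * k + 5) * h + 9 * (9 - k) * (k + 1)

/-- The `(e₂, e₂)` component of the Euler–Lagrange equation in the variables of `red01`. -/
def red11 (k w y h : ℝ) : ℝ :=
  -54 * k ^ 4 * w * y + 648 * k ^ 3 * w ^ 2 + 414 * k ^ 3 * w * y + 4 * k ^ 3 * y ^ 2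
    + 540 * k ^ 2 * w ^ 2 + 627 * k ^ 2 * w * y - 648 * k ^ 2 * w * h - 3 * k ^ 2 * y ^ 2
    - 648 * k ^ 2 * w - 18 * k ^ 2 * y - 108 * k * w ^ 2 + 516 * k * w * y - 162 * k * w * h
    - 54 * k * y ^ 2 + 36 * k * y * h - 162 * k * w + 72 * k * y - 108 * w ^ 2 + 141 * w * y
    + 297 * w * h - 155 * y ^ 2 + 171 * y * h + 567 * w + 171 * y

/-- The `(e₄, e₄)` component of the Euler–Lagrange equation in the variables of `red01`. -/
def red33 (k w y h : ℝ) : ℝ :=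
  2 * k ^ 4 * w * y - 72 * k ^ 3 * w ^ 2 - 46 * k ^ 3 * w * y - 4 * k ^ 3 * y ^ 2
    + 36 * k ^ 2 * w ^ 2 + 105 * k ^ 2 * w * y + 72 * k ^ 2 * w * h + 39 * k ^ 2 * y ^ 2
    + 72 * k ^ 2 * w + 6 * k ^ 2 * y - 36 * k * w ^ 2 - 148 * k * w * y - 126 * k * w * h
    - 90 * k * y ^ 2 - 36 * k * y * h - 126 * k * w - 72 * k * y - 36 * w ^ 2 - 85 * w * y
    - 9 * w * h - 25 * y ^ 2 + 153 * y * h + 81 * w + 201 * y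

/-- All monomials below are positive, so a combination with nonnegative coefficients, the
coefficient of `w y` being positive, cannot vanish. -/
theorem positive_combination_ne_zero {w y h p₀ p₁ p₂ p₃ p₄ p₅ p₆ : ℝ}
    (hw : 0 < w) (hy : 0 < y) (hh : 0 < h) (h₀ : 0 ≤ p₀) (h₁ : 0 < p₁) (h₂ : 0 ≤ p₂)
    (h₃ : 0 ≤ p₃) (h₄ : 0 ≤ p₄) (h₅ : 0 ≤ p₅) (h₆ : 0 ≤ p₆) :
    p₀ * w ^ 2 + p₁ * (w * y) + p₂ * (w * h) + p₃ * w + p₄ * y ^ 2 + p₅ * (y * h) + p₆ * y ≠ 0 := by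
  positivity

theorem no_sol_le {k w y h : ℝ} (hw : 0 < w) (hy : 0 < y) (hh : 0 < h)
    (hk : k ≤ -9 / 2)
    (h1 : red11 k w y h = 0) (h3 : red33 k w y h = 0) : False := by
  unfold red11 at h1
  unfold red33 at h3
  obtain ⟨s, hs, rfl⟩ : ∃ s, 0 ≤ s ∧ k = -9 / 2 - s :=
    ⟨-9 / 2 - k, by linarith, by ring⟩
  have c0 : 0 ≤ 720 * s ^ 3 + 9216 * s ^ 2 + 39132 * s + 55152 := by positivity
  have c1 : 0 < 56 * s ^ 4 + 1468 * s ^ 3 + 12492 * s ^ 2 + 44323 * s + 114145 / 2 := by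
      positivity
  have c2 : 0 ≤ 720 * s ^ 2 + 6444 * s + 14112 := by positivity
  have c3 : 0 ≤ 720 * s ^ 2 + 6444 * s + 13932 := by positivity
  have c4 : 0 ≤ 8 * s ^ 3 + 150 * s ^ 2 + 900 * s + 3743 / 2 := by positivity
  have c5 : 0 ≤ 72 * s + 306 := by positivity
  have c6 : 0 ≤ 24 * s ^ 2 + 360 * s + 1164 := by positivity
  refine positive_combination_ne_zero hw hy hh c0 c1 c2 c3 c4 c5 c6 ?_
  linear_combination -h1 + h3

theorem no_sol_neg_one {k w y h : ℝ} (hw : 0 < w) (hy : 0 < y) (hh : 0 < h)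
    (hk0 : -1 ≤ k) (hk1 : k ≤ -5 / 8)
    (hE : red01 k w y h = 0) (h3 : red33 k w y h = 0) : False := by
  unfold red01 at hE
  unfold red33 at h3
  obtain ⟨s, hs, rfl⟩ : ∃ s, 0 ≤ s ∧ k = -1 + s := ⟨k + 1, by linarith, by ring⟩
  obtain ⟨u, hu, hus⟩ : ∃ u, 0 ≤ u ∧ u = 3 / 8 - s := ⟨3 / 8 - s, by linarith, rfl⟩
  have c0 : 0 ≤ 9 * s ^ 4 - 72 * s ^ 3 + 153 * s ^ 2 - 270 * s + 108 := by
    calc 0 ≤ 100953 / 4096 + 4215 * u ^ 4 + 11740 * s * u ^ 3 + 11018 * s ^ 2 * u ^ 2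
          + 3484 * s ^ 3 * u := by positivity
      _ = 9 * s ^ 4 - 72 * s ^ 3 + 153 * s ^ 2 - 270 * s + 108 := by rw [hus]; ring
  have c1 : 0 < 2 * s ^ 4 - 46 * s ^ 3 + 192 * s ^ 2 - 450 * s + 216 := by
    calc 0 < 147177 / 2048 + 21866 / 3 * u ^ 4 + 61864 / 3 * s * u ^ 3 + 58492 / 3 * s ^ 2 * u ^ 2
          + 18488 / 3 * s ^ 3 * u := by positivity
      _ = 2 * s ^ 4 - 46 * s ^ 3 + 192 * s ^ 2 - 450 * s + 216 := by rw [hus]; ring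
  have c2 : 0 ≤ 72 * s ^ 2 - 198 * s + 162 := by
    calc 0 ≤ 783 / 8 + 456 * u ^ 2 + 384 * s * u := by positivity
      _ = 72 * s ^ 2 - 198 * s + 162 := by rw [hus]; ring
  have c3 : 0 ≤ 63 * s ^ 2 - 180 * s + 279 := by
    calc 0 ≤ 14103 / 64 + 417 * u ^ 2 + 354 * s * u := by positivity
      _ = 63 * s ^ 2 - 180 * s + 279 := by rw [hus]; ring
  have c4 : 0 ≤ -4 * s ^ 3 + 51 * s ^ 2 - 180 * s + 108 := by
    calc 0 ≤ 6075 / 128 + 1148 * u ^ 3 + 2164 * s * u ^ 2 + 1020 * s ^ 2 * u := by positivity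
      _ = -4 * s ^ 3 + 51 * s ^ 2 - 180 * s + 108 := by rw [hus]; ring
  have c5 : 0 ≤ -36 * s + 189 := by
    calc 0 ≤ 351 / 2 + 36 * u := by positivity
      _ = -36 * s + 189 := by rw [hus]; ring
  have c6 : 0 ≤ 6 * s ^ 2 - 84 * s + 279 := by
    calc 0 ≤ 7947 / 32 + 218 * u ^ 2 + 212 * s * u := by positivity
      _ = 6 * s ^ 2 - 84 * s + 279 := by rw [hus]; ring
  refine positive_combination_ne_zero hw hy hh c0 c1 c2 c3 c4 c5 c6 ?_
  linear_combination h3 + w * hE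

theorem no_sol_zero_left {k w y h : ℝ} (hw : 0 < w) (hy : 0 < y) (hh : 0 < h)
    (hk0 : -9 / 20 ≤ k) (hk1 : k ≤ 0)
    (hE : red01 k w y h = 0) (h1 : red11 k w y h = 0) (h3 : red33 k w y h = 0) : False := by
  unfold red01 at hE
  unfold red11 at h1
  unfold red33 at h3
  obtain ⟨s, hs, rfl⟩ : ∃ s, 0 ≤ s ∧ k = -9 / 20 + s := ⟨k + 9 / 20, by linarith, by ring⟩
  obtain ⟨u, hu, hus⟩ : ∃ u, 0 ≤ u ∧ u = 9 / 20 - s := ⟨9 / 20 - s, by linarith, rfl⟩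
  have c0 : 0 ≤ 9 * s ^ 5 + 171 / 4 * s ^ 4 + 10233 / 40 * s ^ 3 + 11439 / 160 * s ^ 2
      - 677943 / 32000 * s + 18639819 / 3200000 := by
    calc 0 ≤ 276741 / 80000 + 31153 / 243 * u ^ 5 + 30220 / 243 * s * u ^ 4
          + 437200 / 243 * s ^ 3 * u ^ 2 + 862600 / 243 * s ^ 4 * u + 142840 / 81 * s ^ 5 := by
          positivity
      _ = 9 * s ^ 5 + 171 / 4 * s ^ 4 + 10233 / 40 * s ^ 3 + 11439 / 160 * s ^ 2
          - 677943 / 32000 * s + 18639819 / 3200000 := by rw [hus]; ring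
  have c1 : 0 < -24 * s ^ 4 + 461 / 5 * s ^ 3 - 2031 / 100 * s ^ 2 - 27969 / 2000 * s
      + 639529 / 40000 := by
    calc 0 < 181 / 16 + 9236 / 81 * u ^ 4 + 73540 / 243 * s * u ^ 3 + 10000 / 81 * s ^ 2 * u ^ 2
          + 10000 / 243 * s ^ 4 := by positivity
      _ = -24 * s ^ 4 + 461 / 5 * s ^ 3 - 2031 / 100 * s ^ 2 - 27969 / 2000 * s + 639529 / 40000
          := by rw [hus]; ring
  have c2 : 0 ≤ 216 * s ^ 2 + 2853 / 5 * s + 19449 / 100 := by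
    calc 0 ≤ 19449 / 100 + 1268 * s * u + 1484 * s ^ 2 := by positivity
      _ = 216 * s ^ 2 + 2853 / 5 * s + 19449 / 100 := by rw [hus]; ring
  have c3 : 0 ≤ -9 * s ^ 3 + 4023 / 20 * s ^ 2 - 181827 / 400 * s + 3261141 / 8000 := by
    calc 0 ≤ 243 + 16261 / 9 * u ^ 3 + 28580 / 9 * s * u ^ 2 + 12400 / 9 * s ^ 2 * u := by
          positivity
      _ = -9 * s ^ 3 + 4023 / 20 * s ^ 2 - 181827 / 400 * s + 3261141 / 8000 := by rw [hus]; ring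
  have c6 : 0 ≤ 48 * s ^ 2 - 1656 / 5 * s + 13083 / 25 := by
    calc 0 ≤ 384 + 688 * u ^ 2 + 640 * s * u := by positivity
      _ = 48 * s ^ 2 - 1656 / 5 * s + 13083 / 25 := by rw [hus]; ring
  refine positive_combination_ne_zero hw hy hh c0 c1 c2 c3 le_rfl le_rfl c6 ?_
  linear_combination (-(-9 / 20 + s) + 1) * h1 + (-9 * (-9 / 20 + s) - 7) * h3 + (-4 * (-9 / 20
    + s) + 20) * y * hE + ((-9 / 20 + s) + 3) * w * hE

theorem no_sol_zero_two {k w y h : ℝ} (hw : 0 < w) (hy : 0 < y) (hh : 0 < h)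
    (hk0 : 0 ≤ k) (hk1 : k ≤ 2)
    (hE : red01 k w y h = 0) (h1 : red11 k w y h = 0) (h3 : red33 k w y h = 0) : False := by
  unfold red01 at hE
  unfold red11 at h1
  unfold red33 at h3
  obtain ⟨u, hu, huk⟩ : ∃ u, 0 ≤ u ∧ u = 2 - k := ⟨2 - k, by linarith, rfl⟩
  have c0 : 0 ≤ 9 * k ^ 5 + 63 * k ^ 4 + 351 * k ^ 3 + 477 * k ^ 2 + 216 * k + 36 := by
    calc 0 ≤ 36 + 27 / 2 * k * u ^ 4 + 909 / 8 * k ^ 2 * u ^ 3 + 2781 / 8 * k ^ 3 * u ^ 2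
          + 3519 / 8 * k ^ 4 * u + 1611 / 8 * k ^ 5 := by positivity
      _ = 9 * k ^ 5 + 63 * k ^ 4 + 351 * k ^ 3 + 477 * k ^ 2 + 216 * k + 36 := by rw [huk]; ring
  have c1 : 0 < -24 * k ^ 4 + 49 * k ^ 3 + 75 * k ^ 2 + 15 * k + 13 := by
    calc 0 < 13 + 15 / 8 * k * u ^ 3 + 195 / 8 * k ^ 2 * u ^ 2 + 541 / 8 * k ^ 3 * u
          + 169 / 8 * k ^ 4 := by positivity
      _ = -24 * k ^ 4 + 49 * k ^ 3 + 75 * k ^ 2 + 15 * k + 13 := by rw [huk]; ring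
  have c2 : 0 ≤ 216 * k ^ 2 + 765 * k + 495 := by
    calc 0 ≤ 495 + 765 / 2 * k * u + 1197 / 2 * k ^ 2 := by positivity
      _ = 216 * k ^ 2 + 765 * k + 495 := by rw [huk]; ring
  have c3 : 0 ≤ -9 * k ^ 3 + 189 * k ^ 2 - 279 * k + 243 := by
    calc 0 ≤ 57 + 93 / 4 * u ^ 3 + 99 / 4 * k ^ 2 * u + 39 * k ^ 3 := by positivity
      _ = -9 * k ^ 3 + 189 * k ^ 2 - 279 * k + 243 := by rw [huk]; ring
  have c6 : 0 ≤ 48 * k ^ 2 - 288 * k + 384 := by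
    calc 0 ≤ 96 * u ^ 2 + 48 * k * u := by positivity
      _ = 48 * k ^ 2 - 288 * k + 384 := by rw [huk]; ring
  refine positive_combination_ne_zero hw hy hh c0 c1 c2 c3 le_rfl le_rfl c6 ?_
  linear_combination (-k + 1) * h1 + (-9 * k - 7) * h3 + (-4 * k + 20) * y * hE + (k + 3) * w * hE

theorem no_sol_two_four {k w y h : ℝ} (hw : 0 < w) (hy : 0 < y) (hh : 0 < h)
    (hk0 : 2 ≤ k) (hk1 : k ≤ 4)
    (hE : red01 k w y h = 0) (h1 : red11 k w y h = 0) (h3 : red33 k w y h = 0) : False := by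
  unfold red01 at hE
  unfold red11 at h1
  unfold red33 at h3
  obtain ⟨s, hs, rfl⟩ : ∃ s, 0 ≤ s ∧ k = 2 + s := ⟨k - 2, by linarith, by ring⟩
  obtain ⟨u, hu, hus⟩ : ∃ u, 0 ≤ u ∧ u = 2 - s := ⟨2 - s, by linarith, rfl⟩
  have c0 : 0 ≤ 540 * s ^ 5 + 7830 * s ^ 4 + 43236 * s ^ 3 + 109278 * s ^ 2 + 119988 * s + 39420
      := by
    calc 0 ≤ 39420 + 29997 / 4 * s * u ^ 4 + 174627 / 4 * s ^ 2 * u ^ 3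
          + 387135 / 4 * s ^ 3 * u ^ 2 + 386037 / 4 * s ^ 4 * u + 36423 * s ^ 5 := by positivity
      _ = 540 * s ^ 5 + 7830 * s ^ 4 + 43236 * s ^ 3 + 109278 * s ^ 2 + 119988 * s + 39420 := by
          rw [hus]; ring
  have c1 : 0 < 167 * s ^ 4 + 1566 * s ^ 3 + 3768 * s ^ 2 + 4212 * s + 4671 := by
    calc 0 < 4671 + 1053 / 2 * s * u ^ 3 + 5043 / 2 * s ^ 2 * u ^ 2 + 8493 / 2 * s ^ 3 * u
          + 4837 / 2 * s ^ 4 := by positivity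
      _ = 167 * s ^ 4 + 1566 * s ^ 3 + 3768 * s ^ 2 + 4212 * s + 4671 := by rw [hus]; ring
  have c2 : 0 ≤ 504 * s ^ 2 + 7074 * s + 15039 := by
    calc 0 ≤ 15039 + 3537 * s * u + 4041 * s ^ 2 := by positivity
      _ = 504 * s ^ 2 + 7074 * s + 15039 := by rw [hus]; ring
  have c3 : 0 ≤ -540 * s ^ 3 - 3006 * s ^ 2 + 1674 * s + 15669 := by
    calc 0 ≤ 2673 + 3249 / 2 * u ^ 3 + 5292 * s * u ^ 2 + 8415 / 2 * s ^ 2 * u := by positivity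
      _ = -540 * s ^ 3 - 3006 * s ^ 2 + 1674 * s + 15669 := by rw [hus]; ring
  have c4 : 0 ≤ 28 * s ^ 3 - 42 * s ^ 2 + 90 * s := by
    calc 0 ≤ 45 / 2 * s * u ^ 2 + 24 * s ^ 2 * u + 59 / 2 * s ^ 3 := by positivity
      _ = 28 * s ^ 3 - 42 * s ^ 2 + 90 * s := by rw [hus]; ring
  have c5 : 0 ≤ 252 * s := by positivity
  have c6 : 0 ≤ -111 * s ^ 2 + 276 * s := by
    calc 0 ≤ 138 * s * u + 27 * s ^ 2 := by positivity
      _ = -111 * s ^ 2 + 276 * s := by rw [hus]; ring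
  refine positive_combination_ne_zero hw hy hh c0 c1 c2 c3 c4 c5 c6 ?_
  linear_combination 5 * h1 - 8 * h3 - 3 * y * hE + (60 * (2 + s) + 30) * w * hE

theorem no_sol_four_five {k w y h : ℝ} (hw : 0 < w) (hy : 0 < y) (hh : 0 < h)
    (hk0 : 4 ≤ k) (hk1 : k ≤ 5)
    (hE : red01 k w y h = 0) (h1 : red11 k w y h = 0) : False := by
  unfold red01 at hE
  unfold red11 at h1
  obtain ⟨s, hs, rfl⟩ : ∃ s, 0 ≤ s ∧ k = 4 + s := ⟨k - 4, by linarith, by ring⟩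
  obtain ⟨u, hu, hus⟩ : ∃ u, 0 ≤ u ∧ u = 1 - s := ⟨1 - s, by linarith, rfl⟩
  have c0 : 0 ≤ 3024 * s ^ 5 + 68040 * s ^ 4 + 580608 * s ^ 3 + 2364768 * s ^ 2 + 4637304 * s
      + 3566808 := by
    calc 0 ≤ 3566808 + 4637304 * s * u ^ 4 + 20913984 * s ^ 2 * u ^ 3 + 35498736 * s ^ 3 * u ^ 2
          + 26872776 * s ^ 4 * u + 7653744 * s ^ 5 := by positivity
      _ = 3024 * s ^ 5 + 68040 * s ^ 4 + 580608 * s ^ 3 + 2364768 * s ^ 2 + 4637304 * s + 3566808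
          := by rw [hus]; ring
  have c1 : 0 < 45 * s ^ 5 + 2760 * s ^ 4 + 24387 * s ^ 3 + 69510 * s ^ 2 + 68388 * s + 65166
      := by
    calc 0 < 65166 + 68388 * s * u ^ 4 + 343062 * s ^ 2 * u ^ 3 + 643245 * s ^ 3 * u ^ 2
          + 533616 * s ^ 4 * u + 165090 * s ^ 5 := by positivity
      _ = 45 * s ^ 5 + 2760 * s ^ 4 + 24387 * s ^ 3 + 69510 * s ^ 2 + 68388 * s + 65166 := by
          rw [hus]; ring
  have c2 : 0 ≤ 15120 * s ^ 2 + 97524 * s + 129654 := by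
    calc 0 ≤ 129654 + 97524 * s * u + 112644 * s ^ 2 := by positivity
      _ = 15120 * s ^ 2 + 97524 * s + 129654 := by rw [hus]; ring
  have c3 : 0 ≤ -3024 * s ^ 3 - 16632 * s ^ 2 + 756 * s + 42714 := by
    calc 0 ≤ 23814 + 18900 * u ^ 3 + 57456 * s * u ^ 2 + 41580 * s ^ 2 * u := by positivity
      _ = -3024 * s ^ 3 - 16632 * s ^ 2 + 756 * s + 42714 := by rw [hus]; ring
  have c4 : 0 ≤ 40 * s ^ 4 + 277 * s ^ 3 + 294 * s ^ 2 - 121 * s + 158 := by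
    calc 0 ≤ 511 / 4 + 121 / 4 * u ^ 4 + 225 / 2 * s ^ 2 * u ^ 2 + 623 * s ^ 3 * u
          + 2081 / 4 * s ^ 4 := by positivity
      _ = 40 * s ^ 4 + 277 * s ^ 3 + 294 * s ^ 2 - 121 * s + 158 := by rw [hus]; ring
  have c5 : 0 ≤ 360 * s ^ 2 + 1593 * s + 1746 := by
    calc 0 ≤ 1746 + 1593 * s * u + 1953 * s ^ 2 := by positivity
      _ = 360 * s ^ 2 + 1593 * s + 1746 := by rw [hus]; ring
  have c6 : 0 ≤ -45 * s ^ 3 - 180 * s ^ 2 + 117 * s + 594 := by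
    calc 0 ≤ 486 + 108 * u ^ 3 + 441 * s * u ^ 2 + 378 * s ^ 2 * u := by positivity
      _ = -45 * s ^ 3 - 180 * s ^ 2 + 117 * s + 594 := by rw [hus]; ring
  refine positive_combination_ne_zero hw hy hh c0 c1 c2 c3 c4 c5 c6 ?_
  linear_combination 14 * h1 + (5 * (4 + s) - 28) * y * hE + (336 * (4 + s) - 504) * w * hE

theorem no_sol_five_six {k w y h : ℝ} (hw : 0 < w) (hy : 0 < y) (hh : 0 < h)
    (hk0 : 5 ≤ k) (hk1 : k ≤ 6)
    (hE : red01 k w y h = 0) (h3 : red33 k w y h = 0) : False := by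
  unfold red01 at hE
  unfold red33 at h3
  obtain ⟨s, hs, rfl⟩ : ∃ s, 0 ≤ s ∧ k = 5 + s := ⟨k - 5, by linarith, by ring⟩
  obtain ⟨u, hu, hus⟩ : ∃ u, 0 ≤ u ∧ u = 1 - s := ⟨1 - s, by linarith, rfl⟩
  have c0 : 0 ≤ 45 * s ^ 5 + 1350 * s ^ 4 + 15921 * s ^ 3 + 91692 * s ^ 2 + 256608 * s + 277668
      := by
    calc 0 ≤ 277668 + 256608 * s * u ^ 4 + 1118124 * s ^ 2 * u ^ 3 + 1830645 * s ^ 3 * u ^ 2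
          + 1334700 * s ^ 4 * u + 365616 * s ^ 5 := by positivity
      _ = 45 * s ^ 5 + 1350 * s ^ 4 + 15921 * s ^ 3 + 91692 * s ^ 2 + 256608 * s + 277668 := by
          rw [hus]; ring
  have c1 : 0 < 34 * s ^ 4 + 663 * s ^ 3 + 4095 * s ^ 2 + 8424 * s + 1620 := by
    calc 0 < 1620 + 8424 * s * u ^ 3 + 29367 * s ^ 2 * u ^ 2 + 34125 * s ^ 3 * u + 13216 * s ^ 4
          := by positivity
      _ = 34 * s ^ 4 + 663 * s ^ 3 + 4095 * s ^ 2 + 8424 * s + 1620 := by rw [hus]; ring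
  have c2 : 0 ≤ 144 * s ^ 2 + 2403 * s + 8667 := by
    calc 0 ≤ 8667 + 2403 * s * u + 2547 * s ^ 2 := by positivity
      _ = 144 * s ^ 2 + 2403 * s + 8667 := by rw [hus]; ring
  have c3 : 0 ≤ -45 * s ^ 3 - 576 * s ^ 2 - 1242 * s + 2727 := by
    calc 0 ≤ 864 + 1863 * u ^ 3 + 4347 * s * u ^ 2 + 2529 * s ^ 2 * u := by positivity
      _ = -45 * s ^ 3 - 576 * s ^ 2 - 1242 * s + 2727 := by rw [hus]; ring
  have c4 : 0 ≤ 12 * s ^ 3 + 63 * s ^ 2 := by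
    calc 0 ≤ 63 * s ^ 2 * u + 75 * s ^ 3 := by positivity
      _ = 12 * s ^ 3 + 63 * s ^ 2 := by rw [hus]; ring
  have c5 : 0 ≤ 108 * s + 81 := by positivity
  have c6 : 0 ≤ -18 * s ^ 2 + 36 * s + 27 := by
    calc 0 ≤ 27 + 36 * s * u + 18 * s ^ 2 := by positivity
      _ = -18 * s ^ 2 + 36 * s + 27 := by rw [hus]; ring
  refine positive_combination_ne_zero hw hy hh c0 c1 c2 c3 c4 c5 c6 ?_
  linear_combination -3 * h3 + (5 * (5 + s) + 5) * w * hE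

theorem no_sol_ge {k w y h : ℝ} (hw : 0 < w) (hy : 0 < y) (hh : 0 < h)
    (hk : 9 ≤ k)
    (hE : red01 k w y h = 0) (h1 : red11 k w y h = 0) (h3 : red33 k w y h = 0) : False := by
  unfold red01 at hE
  unfold red11 at h1
  unfold red33 at h3
  obtain ⟨s, hs, rfl⟩ : ∃ s, 0 ≤ s ∧ k = 9 + s :=
    ⟨k - 9, by linarith, by ring⟩
  have c0 : 0 ≤ 90 * s ^ 4 + 2880 * s ^ 3 + 33066 * s ^ 2 + 156780 * s + 241416 := by positivity
  have c1 : 0 < 74 * s ^ 4 + 2356 * s ^ 3 + 26646 * s ^ 2 + 121544 * s + 167272 := by positivity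
  have c2 : 0 ≤ 720 * s ^ 2 + 13716 * s + 65268 := by positivity
  have c3 : 0 ≤ 630 * s ^ 2 + 12096 * s + 58158 := by positivity
  have c4 : 0 ≤ 8 * s ^ 3 + 180 * s ^ 2 + 1164 * s + 1856 := by positivity
  have c5 : 0 ≤ 72 * s + 720 := by positivity
  have c6 : 0 ≤ 6 * s ^ 2 + 108 * s + 678 := by positivity
  refine positive_combination_ne_zero hw hy hh c0 c1 c2 c3 c4 c5 c6 ?_
  linear_combination -h1 + h3 + 10 * w * hE + 2 * y * hE

theorem no_sol_gap_left {k w y h : ℝ} (hw : 0 < w) (hy : 0 < y) (hh : 0 < h)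
    (hk0 : -9 / 2 ≤ k) (hk1 : k ≤ -1) (hE : red01 k w y h = 0) : False := by
  unfold red01 at hE
  have h1 : 0 ≤ -(k + 1) := by linarith
  have c1 : 0 ≤ (-(k + 1)) * ((2 - k) * -(k ^ 2 + 5 * k + 2)) :=
    mul_nonneg h1 (mul_nonneg (by linarith) (by nlinarith))
  have c2 : 0 ≤ (-(k + 1)) * (8 * k ^ 2 - 47 * k - 1) := mul_nonneg h1 (by nlinarith)
  have c3 : 0 ≤ (-(k + 1)) * (9 - k) := mul_nonneg h1 (by linarith)
  nlinarith [mul_nonneg c1 hw.le, mul_nonneg c2 hy.le,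
    mul_pos (show 0 < -(8 * k + 5) by linarith) hh]

theorem no_sol_gap_mid {k w y h : ℝ} (hw : 0 < w) (hy : 0 < y) (hh : 0 < h)
    (hk0 : -5 / 8 ≤ k) (hk1 : k ≤ -9 / 20) (hE : red01 k w y h = 0) : False := by
  unfold red01 at hE
  have h1 : 0 < k + 1 := by linarith
  have c1 : 0 ≤ (k + 1) * ((2 - k) * -(k ^ 2 + 5 * k + 2)) :=
    mul_nonneg h1.le (mul_nonneg (by linarith) (by nlinarith))
  have c2 : 0 ≤ (k + 1) * (8 * k ^ 2 - 47 * k - 1) := mul_nonneg h1.le (by nlinarith)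
  have c3 : 0 < (k + 1) * (9 - k) := mul_pos h1 (by linarith)
  nlinarith [mul_nonneg c1 hw.le, mul_nonneg c2 hy.le,
    mul_nonneg (show 0 ≤ 8 * k + 5 by linarith) hh.le]

theorem no_sol_gap_right {k w y h : ℝ} (hw : 0 < w) (hy : 0 < y) (hh : 0 < h)
    (hk0 : 6 ≤ k) (hk1 : k ≤ 9) (hE : red01 k w y h = 0) : False := by
  unfold red01 at hE
  have h1 : 0 < k + 1 := by linarith
  have c1 : 0 ≤ (k + 1) * ((k - 2) * (k ^ 2 + 5 * k + 2)) :=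
    mul_nonneg h1.le (mul_nonneg (by linarith) (by nlinarith))
  have c2 : 0 ≤ (k + 1) * (8 * k ^ 2 - 47 * k - 1) := mul_nonneg h1.le (by nlinarith)
  have c3 : 0 ≤ (k + 1) * (9 - k) := mul_nonneg h1.le (by linarith)
  nlinarith [mul_nonneg c1 hw.le, mul_nonneg c2 hy.le,
    mul_pos (show 0 < 8 * k + 5 by linarith) hh]

/-- A metric with `H ≠ 0` and `c, d ≠ 0` is never critical.  Divide the `k`-line into intervals.
On three of them all four terms of `red01` have the same sign.  On each of the others a combination
of the three equations, with polynomial multipliers, is a polynomial in the positive quantities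
`w, y, h` whose coefficients are nonnegative for `k` in that interval; the coefficients are
certified nonnegative by writing them with nonnegative coefficients in the distances of `k` from
the endpoints. -/
theorem no_sol {k w y h : ℝ} (hw : 0 < w) (hy : 0 < y) (hh : 0 < h)
    (hE : red01 k w y h = 0) (h1 : red11 k w y h = 0) (h3 : red33 k w y h = 0) : False := by
  rcases le_total k (-9 / 2) with a | a
  · exact no_sol_le hw hy hh (by linarith) h1 h3
  rcases le_total k (-1) with b | b
  · exact no_sol_gap_left hw hy hh a b hE
  rcases le_total k (-5 / 8) with c | c
  · exact no_sol_neg_one hw hy hh b (by linarith) hE h3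
  rcases le_total k (-9 / 20) with d | d
  · exact no_sol_gap_mid hw hy hh c d hE
  rcases le_total k 0 with e | e
  · exact no_sol_zero_left hw hy hh (by linarith) e hE h1 h3
  rcases le_total k 2 with f | f
  · exact no_sol_zero_two hw hy hh e f hE h1 h3
  rcases le_total k 4 with g | g
  · exact no_sol_two_four hw hy hh f g hE h1 h3
  rcases le_total k 5 with i | i
  · exact no_sol_four_five hw hy hh g i hE h1
  rcases le_total k 6 with j | j
  · exact no_sol_five_six hw hy hh i j hE h3
  rcases le_total k 9 with l | l
  · exact no_sol_gap_right hw hy hh j l hE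
  · exact no_sol_ge hw hy hh l hE h1 h3

/-- The solutions with `H ≠ 0` have `b = 0`; they are the products `c = 0` and the metrics with
`c ^ 2 = H ^ 2 + 1`, both with `a = d = 0`, and the curves with `c = 0 ≠ d`.  The `(e₂, e₄)`
component, divided by `H`, determines `T`. -/
theorem classify_of_ne_zero {a b H c d T : ℝ} (hH : H ≠ 0)
    (h00 : g00 a b H c d T = 0) (h11 : g11 a b H c d T = 0) (h22 : g22 a b H c d T = 0)
    (h33 : g33 a b H c d T = 0) (h01 : g01 a b H c d T = 0) (h03 : g03 a b H c d T = 0)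
    (h13 : g13 a b H c d T = 0) :
    T = -(4 * a ^ 2 + 2 * a * d + 3 * b ^ 2 + 2 * b * c + 3 * d ^ 2 + 3 * H ^ 2 + 3) ∧ b = 0 ∧
      ((a = 0 ∧ d = 0 ∧ (c = 0 ∨ c ^ 2 = H ^ 2 + 1)) ∨
        (c = 0 ∧ d ≠ 0 ∧
          2 * a * (d ^ 2 + H ^ 2 + 1) + d * (2 * (d ^ 2 + H ^ 2 + 1) - 5) = 0 ∧
          -4 * a ^ 2 * d + 2 * a * d ^ 2 + 6 * a * H ^ 2 + 2 * d ^ 3 - d * H ^ 2 + 6 * a - 6 * d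
            = 0)) := by
  have hT : T = -(4 * a ^ 2 + 2 * a * d + 3 * b ^ 2 + 2 * b * c + 3 * d ^ 2 + 3 * H ^ 2 + 3) := by
    unfold g13 at h13
    apply mul_left_cancel₀ hH
    linear_combination (-1 / 4) * h13
  refine ⟨hT, ?_⟩
  have hL : a * c + 3 * b * d - 2 * c * d = 0 := by
    unfold g03 at h03
    apply mul_left_cancel₀ hH
    linear_combination (1 / 4) * h03
  have hH2 : 0 < H ^ 2 := by positivity
  subst hT
  unfold g00 at h00
  unfold g11 at h11
  unfold g22 at h22
  unfold g33 at h33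
  unfold g01 at h01
  by_cases hc : c = 0
  · subst hc
    by_cases hb : b = 0
    · subst hb
      refine ⟨rfl, ?_⟩
      by_cases hd : d = 0
      · subst hd
        left
        refine ⟨?_, rfl, Or.inl rfl⟩
        have h : a ^ 2 * (H ^ 2 + 1) = 0 := by linear_combination (1 / 24) * h00
        rcases mul_eq_zero.1 h with h | h
        · simpa using h
        · nlinarith
      · right
        have ha : a ≠ 0 := by
          rintro rfl
          have e1 : d ^ 2 * (4 * d ^ 2 + H ^ 2 - 9) = 0 := by
            linear_combination (1 / 6) * h00 - (1 / 2) * h33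
          have e2 : d ^ 2 * (-4 * d ^ 2 + 11 * H ^ 2 + 21) = 0 := by linear_combination h11
          have e1' := (mul_eq_zero.1 e1).resolve_left (pow_ne_zero 2 hd)
          have e2' := (mul_eq_zero.1 e2).resolve_left (pow_ne_zero 2 hd)
          nlinarith
        have hp : -4 * a ^ 2 * d + 2 * a * d ^ 2 + 6 * a * H ^ 2 + 2 * d ^ 3 - d * H ^ 2 + 6 * a
            - 6 * d = 0 := by
          apply mul_left_cancel₀ ha
          linear_combination (1 / 8) * h00 + (3 / 8) * h33
        have hq : 8 * a ^ 3 - 4 * a ^ 2 * d + 20 * a * d ^ 2 + 38 * a * H ^ 2 + 12 * d ^ 3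
            + 3 * d * H ^ 2 + 18 * a - 27 * d = 0 := by
          apply mul_left_cancel₀ hd
          linear_combination (1 / 2) * h00 - (3 / 2) * h33
        -- eliminating between the two cubics in `a` leaves a product of two factors
        have hf : (2 * a * (d ^ 2 + H ^ 2 + 1) + d * (2 * (d ^ 2 + H ^ 2 + 1) - 5)) * (2 * a + d)
            = 0 := by
          linear_combination (2 * a / 3 - d) * hp + (d / 3) * hq
        refine ⟨rfl, hd, (mul_eq_zero.1 hf).resolve_right ?_, hp⟩
        intro h
        obtain rfl : d = -2 * a := by linarith
        have : a * (8 * H ^ 2 + 18) = 0 := by linear_combination hp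
        rcases mul_eq_zero.1 this with h | h
        · exact ha h
        · nlinarith
    · exfalso
      have hd : d = 0 := by
        have : b * d = 0 := by linear_combination hL / 3
        exact (mul_eq_zero.1 this).resolve_left hb
      subst hd
      have hb2 : 0 < b ^ 2 := by positivity
      nlinarith [mul_nonneg (sq_nonneg a) hb2.le, mul_nonneg (sq_nonneg a) hH2.le, sq_nonneg a]
  · have hc2 : 0 < c ^ 2 := by positivity
    by_cases hd : d = 0
    · subst hd
      have ha : a = 0 := by
        have : a * c = 0 := by linear_combination hL
        exact (mul_eq_zero.1 this).resolve_right hc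
      subst ha
      have e1 : c ^ 2 * (c ^ 2 - b ^ 2 - H ^ 2 - 1) + b ^ 2 = 0 := by
        linear_combination (1 / 24) * h00 - (1 / 24) * h11
      have e2 : b * (3 * b + 2 * c) = 0 := by
        linear_combination (1 / 8) * h00 - (1 / 8) * h22 - (3 / 2) * e1
      rcases mul_eq_zero.1 e2 with hb | hb
      · subst hb
        refine ⟨rfl, Or.inl ⟨rfl, rfl, Or.inr ?_⟩⟩
        have : c ^ 2 * (c ^ 2 - H ^ 2 - 1) = 0 := by linear_combination e1
        have := (mul_eq_zero.1 this).resolve_left hc2.ne'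
        linarith
      · exfalso
        obtain rfl : b = -(2 / 3) * c := by linarith
        have e3 : 5 * c ^ 2 - 9 * H ^ 2 - 5 = 0 := by
          apply mul_left_cancel₀ hc2.ne'
          linear_combination 9 * e1
        have e4 : c ^ 2 * (12 * H ^ 2 / 30 + 8 / 54) = 0 := by
          linear_combination (1 / 2) * h00 - (197 / 270 * c ^ 2) * e3
        have : 0 < c ^ 2 * (12 * H ^ 2 / 30 + 8 / 54) := by positivity
        linarith
    · exfalso
      -- `hL` determines `b` and leaves three equations in `k = a / d` and the squares
      obtain ⟨k, rfl⟩ : ∃ k, a = k * d := ⟨a / d, by field_simp⟩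
      obtain rfl : b = c * (2 - k) / 3 := by
        apply mul_left_cancel₀ hd
        linear_combination hL / 3
      refine no_sol (k := k) (w := d ^ 2) (y := c ^ 2) (h := H ^ 2) (by positivity) hc2 hH2
        ?_ ?_ ?_
      · unfold red01
        apply mul_left_cancel₀ (mul_ne_zero hc hd)
        linear_combination (9 / 4) * h01
      · unfold red11
        linear_combination 27 * h11
      · unfold red33
        linear_combination 9 * h33

end NormalForm
end

noncomputable section

/-! ### Critical metrics whose derivation has no central component -/
namespace NormalForm
variable (a b H c d : ℝ)
theorem energy_eq (t T : ℝ) (hT : T = t * S a b H c d) :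
    (bracketMetric a b H c d 0).energy t
      = (bracketMetric a b H c d 0).ricNormSq + T * S a b H c d / 4 := by
  rw [LeftInvMetric.energy, scal_eq, hT]
  unfold S
  ring

/-- The Euler–Lagrange equations for `H = 0` and a diagonal symmetric part, combined so that they
are written in `a + d` and `a - d`. -/
theorem isCritical_zero_iff (t T : ℝ) (hT : T = t * S a (-c) 0 c d) :
    (bracketMetric a (-c) 0 c d 0).IsCritical t ↔
      (a + d) * (a - d) * (3 * (a + d) ^ 2 + (a - d) ^ 2 + 8 * c ^ 2 + T) = 0 ∧
      (a - d) * c * ((a + d) ^ 2 - 2 * (a - d) ^ 2 - 4 * c ^ 2 - T) = 0 ∧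
      (1 - (a + d) ^ 2) * T = 3 * (a + d) ^ 4 + (a + d) ^ 2 * (a - d) ^ 2 - 3 ∧
      (a - d) ^ 2 * (3 * (a + d) ^ 2 + (a - d) ^ 2 + 8 * c ^ 2 + T) = 0 := by
  rw [isCritical_iff a (-c) 0 c d t T hT]
  unfold g00 g11 g22 g33 g01 g02 g03 g12 g13
  constructor
  · rintro ⟨h00, h11, h22, h33, h01, -⟩
    refine ⟨?_, ?_, ?_, ?_⟩
    · linear_combination (-1 / 16) * h00 + (1 / 16) * h11
    · linear_combination (1 / 8) * h01
    · linear_combination (3 / 16) * h22 + (1 / 16) * h33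
    · linear_combination (1 / 16) * h22 - (5 / 16) * h33
  · rintro ⟨hA, hB, h1, h2⟩
    refine ⟨?_, ?_, ?_, ?_, ?_, by ring, by ring, by ring, by ring⟩
    · linear_combination (-8) * hA - 3 * h1 + h2
    · linear_combination 8 * hA - 3 * h1 + h2
    · linear_combination 5 * h1 + h2
    · linear_combination h1 - 3 * h2
    · linear_combination 8 * hB

/-- The solutions with `H = 0`: either the symmetric part of the derivation is a multiple of the
identity on the plane of `e₁, e₂`, or `T` is determined and the solutions are the diagonal
metrics with `c = 0` or the metrics with skew part `c ≠ 0`. -/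
theorem classify_zero {a c d T : ℝ}
    (hB : (a - d) * c * ((a + d) ^ 2 - 2 * (a - d) ^ 2 - 4 * c ^ 2 - T) = 0)
    (h1 : (1 - (a + d) ^ 2) * T = 3 * (a + d) ^ 4 + (a + d) ^ 2 * (a - d) ^ 2 - 3)
    (h2 : (a - d) ^ 2 * (3 * (a + d) ^ 2 + (a - d) ^ 2 + 8 * c ^ 2 + T) = 0) :
    (a = d ∧ (4 * a ^ 2 = 1 ∨ T = -(3 * (4 * a ^ 2 + 1)))) ∨
      (a ≠ d ∧ T = -(3 * (a + d) ^ 2 + (a - d) ^ 2 + 8 * c ^ 2) ∧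
        ((c = 0 ∧ 3 * (a + d) ^ 2 + (a - d) ^ 2 = 3) ∨
          (c ≠ 0 ∧ (a - d) ^ 2 = 4 * (a + d) ^ 2 + 4 * c ^ 2 ∧
            (a + d) ^ 2 * (7 - 8 * c ^ 2) = 3 - 12 * c ^ 2))) := by
  by_cases had : a = d
  · subst had
    refine Or.inl ⟨rfl, ?_⟩
    have : (4 * a ^ 2 - 1) * (T + 3 * (4 * a ^ 2 + 1)) = 0 := by linear_combination -h1
    rcases mul_eq_zero.1 this with h | h
    · left; linarith
    · right; linarith
  · have hq : a - d ≠ 0 := sub_ne_zero.2 had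
    obtain rfl : T = -(3 * (a + d) ^ 2 + (a - d) ^ 2 + 8 * c ^ 2) := by
      have := (mul_eq_zero.1 h2).resolve_left (pow_ne_zero 2 hq)
      linarith
    refine Or.inr ⟨had, rfl, ?_⟩
    by_cases hc : c = 0
    · subst hc
      left
      exact ⟨rfl, by linear_combination -h1⟩
    · right
      have hx : (a - d) ^ 2 = 4 * (a + d) ^ 2 + 4 * c ^ 2 := by
        have := (mul_eq_zero.1 hB).resolve_left (mul_ne_zero hq hc)
        linear_combination -this
      refine ⟨hc, hx, by linear_combination -h1 - hx⟩

/-! ### The dependent parameters -/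

theorem existsUnique_solves2 {a : ℝ} (ha : Range2 a) : ∃! d, Solves2 a d := by
  obtain ⟨h1, h2⟩ := ha
  have h3 : √3 ^ 2 = 3 := Real.sq_sqrt (by norm_num)
  have h0 := Real.sqrt_nonneg 3
  have ha2 : a ^ 2 ≤ 3 / 4 := by
    have : (√3 / 2) ^ 2 = 3 / 4 := by rw [div_pow, h3]; norm_num
    rw [← this]
    have : 1 / 2 ≤ √3 / 2 := by nlinarith
    exact sq_le_sq' h1 (by linarith)
  have hs : √(3 - 3 * a ^ 2) ^ 2 = 3 - 3 * a ^ 2 := Real.sq_sqrt (by linarith)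
  have hs0 := Real.sqrt_nonneg (3 - 3 * a ^ 2)
  have hlt : a < √(3 - 3 * a ^ 2) := by
    by_contra h
    push Not at h
    nlinarith
  refine ⟨(√(3 - 3 * a ^ 2) - a) / 2, ⟨by linarith, by linear_combination hs⟩, ?_⟩
  rintro d ⟨hd, he⟩
  have : (2 * d + a - √(3 - 3 * a ^ 2)) * (2 * d + a + √(3 - 3 * a ^ 2)) = 0 := by
    linear_combination he - hs
  rcases mul_eq_zero.1 this with h | h
  · linarith
  · -- the other root is negative, as `-a ≤ √(3 - 3 a²)` on the range of `a`
    exfalso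
    have : -a ≤ √(3 - 3 * a ^ 2) := Real.le_sqrt_of_sq_le (by nlinarith)
    linarith

/-- In terms of `(a + d) ^ 2` and `(a - d) ^ 2` the equations of family (5) are linear. -/
theorem solves5_iff {a c d : ℝ} (hc : Range5 c) :
    Solves5 c a d ↔ 0 < a + d ∧ a < d ∧ (a + d) ^ 2 * (7 - 8 * c ^ 2) = 3 - 12 * c ^ 2 ∧
      (a - d) ^ 2 = 4 * (a + d) ^ 2 + 4 * c ^ 2 := by
  have hc0 : 0 < c := by
    rcases hc with h | h
    · exact h.1
    · exact (Real.sqrt_nonneg _).trans_lt h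
  constructor
  · rintro ⟨ha, hd, had, h1, h2⟩
    rw [abs_of_neg ha] at had
    refine ⟨by linarith, by linarith, ?_, by linear_combination -h1⟩
    linear_combination (1 / 3 : ℝ) * h2 + (7 - 8 * c ^ 2) / 3 * h1
  · rintro ⟨hp, hq, h1, h2⟩
    have had : a * d < 0 := by nlinarith [sq_nonneg (a + d)]
    have ha : a < 0 := by
      by_contra h
      push Not at h
      nlinarith
    have hd : 0 < d := by linarith
    refine ⟨ha, hd, by rw [abs_of_neg ha]; linarith, by linear_combination -h2, ?_⟩
    linear_combination 3 * h1 + (7 - 8 * c ^ 2) * h2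

/-- On the range of family (5) the equation for `(a + d) ^ 2` has a positive solution. -/
theorem range5_pos {c : ℝ} (hc : Range5 c) :
    0 < c ∧ 7 - 8 * c ^ 2 ≠ 0 ∧ 0 < (3 - 12 * c ^ 2) / (7 - 8 * c ^ 2) := by
  rcases hc with ⟨h0, h1⟩ | h
  · have : c ^ 2 < 1 / 4 := by nlinarith
    exact ⟨h0, by linarith, div_pos (by linarith) (by linarith)⟩
  · have h0 : 0 < c := (Real.sqrt_nonneg _).trans_lt h
    have : 7 / 8 < c ^ 2 := (Real.sqrt_lt' h0).1 h
    exact ⟨h0, by linarith, div_pos_of_neg_of_neg (by linarith) (by linarith)⟩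

theorem range5_of_pos {c P : ℝ} (hc : 0 < c) (hP : 0 < P)
    (h : P * (7 - 8 * c ^ 2) = 3 - 12 * c ^ 2) : Range5 c := by
  rcases lt_or_ge (c ^ 2) (7 / 8) with h1 | h1
  · left
    refine ⟨hc, ?_⟩
    have : 0 < 3 - 12 * c ^ 2 := by rw [← h]; exact mul_pos hP (by linarith)
    nlinarith
  · right
    refine (Real.sqrt_lt' hc).2 (lt_of_le_of_ne h1 ?_)
    intro h2
    rw [← h2] at h
    norm_num at h

theorem existsUnique_solves5 {c : ℝ} (hc : Range5 c) : ∃! p : ℝ × ℝ, Solves5 c p.1 p.2 := by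
  obtain ⟨hc0, hne, hP⟩ := range5_pos hc
  set P := (3 - 12 * c ^ 2) / (7 - 8 * c ^ 2) with hPd
  have hPe : P * (7 - 8 * c ^ 2) = 3 - 12 * c ^ 2 := div_mul_cancel₀ _ hne
  have hsP := Real.sq_sqrt hP.le
  have hsP0 := Real.sqrt_pos.2 hP
  have hX : 0 < 4 * P + 4 * c ^ 2 := by positivity
  have hsX := Real.sq_sqrt hX.le
  have hsX0 := Real.sqrt_pos.2 hX
  refine ⟨((√P - √(4 * P + 4 * c ^ 2)) / 2, (√P + √(4 * P + 4 * c ^ 2)) / 2), ?_, ?_⟩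
  · refine (solves5_iff hc).2 ⟨by ring_nf; positivity, by linarith, ?_, ?_⟩
    · linear_combination hPe + (7 - 8 * c ^ 2) * hsP
    · linear_combination hsX - 4 * hsP
  · rintro ⟨a, d⟩ h
    obtain ⟨h1, h2, h3, h4⟩ := (solves5_iff hc).1 h
    simp only at h1 h2 h3 h4
    have e1 : (a + d) ^ 2 = P := mul_right_cancel₀ hne (h3.trans hPe.symm)
    have e2 : √P = a + d := by rw [← e1, Real.sqrt_sq h1.le]
    have e3 : √(4 * P + 4 * c ^ 2) = d - a := by
      rw [← e1, ← h4, ← Real.sqrt_sq (show 0 ≤ d - a by linarith)]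
      congr 1
      ring
    rw [e2, e3]
    ext <;> simp only <;> ring

/-- The left-hand side of the equation of family (6), as a cubic in `w = d²`. -/
def cubic6 (h w : ℝ) : ℝ :=
  4 * w ^ 3 + 5 * (3 * h - 1) * w ^ 2 + (18 * h ^ 2 + 6 * h + 13) * w + (h + 1) ^ 2 * (7 * h - 3)

theorem cubic6_strictMono {h v w : ℝ} (h0 : 0 ≤ h) (hv : 0 ≤ v) (hvw : v < w) :
    cubic6 h v < cubic6 h w := by
  unfold cubic6
  have : 0 < 4 * (w ^ 2 + w * v + v ^ 2) + 5 * (3 * h - 1) * (w + v)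
      + (18 * h ^ 2 + 6 * h + 13) := by
    nlinarith [sq_nonneg (w - v), sq_nonneg (w - 1), sq_nonneg (v - 1),
      mul_nonneg h0 (hv.trans hvw.le), mul_nonneg h0 hv, mul_nonneg hv (hv.trans hvw.le)]
  nlinarith [mul_pos (sub_pos.2 hvw) this]

theorem solves6_iff {H d : ℝ} : Solves6 H d ↔ 0 < d ∧ cubic6 (H ^ 2) (d ^ 2) = 0 := by
  unfold Solves6 cubic6
  refine and_congr_right fun _ => ?_
  constructor <;> intro h <;> linear_combination h

theorem range6_iff {H : ℝ} : Range6 H ↔ 0 < H ∧ H ^ 2 < 3 / 7 := by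
  unfold Range6
  refine and_congr_right fun h => Real.lt_sqrt h.le

theorem cubic6_bound {h w : ℝ} (h0 : 0 ≤ h) (hz : cubic6 h w = 0) : w < 3 / 10 := by
  by_contra hcon
  push Not at hcon
  have h1 : 0 < cubic6 h (3 / 10) := by
    unfold cubic6
    nlinarith [mul_nonneg h0 h0, mul_nonneg h0 (mul_nonneg h0 h0)]
  rcases hcon.eq_or_lt with h2 | h2
  · rw [← h2] at hz; linarith
  · have := cubic6_strictMono h0 (by norm_num) h2
    linarith

theorem existsUnique_solves6 {H : ℝ} (hH : Range6 H) : ∃! d, Solves6 H d := by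
  obtain ⟨h0, h1⟩ := range6_iff.1 hH
  have hH2 : 0 ≤ H ^ 2 := sq_nonneg H
  have hcont : Continuous (cubic6 (H ^ 2)) := by unfold cubic6; fun_prop
  have hneg : cubic6 (H ^ 2) 0 < 0 := by
    unfold cubic6
    nlinarith [mul_pos (show 0 < (H ^ 2 + 1) ^ 2 by positivity)
      (show 0 < 3 - 7 * H ^ 2 by linarith)]
  have hpos : 0 < cubic6 (H ^ 2) 1 := by
    unfold cubic6
    nlinarith [mul_nonneg hH2 hH2, mul_nonneg hH2 (mul_nonneg hH2 hH2)]
  obtain ⟨w, hw, hz⟩ := intermediate_value_Icc (zero_le_one' ℝ) hcont.continuousOn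
    (show (0 : ℝ) ∈ Set.Icc _ _ from ⟨hneg.le, hpos.le⟩)
  have hw0 : 0 < w := lt_of_le_of_ne hw.1 (by rintro rfl; linarith)
  refine ⟨√w, solves6_iff.2 ⟨Real.sqrt_pos.2 hw0, by rwa [Real.sq_sqrt hw0.le]⟩, ?_⟩
  intro d hd
  obtain ⟨hd0, hdz⟩ := solves6_iff.1 hd
  have : d ^ 2 = w := by
    rcases lt_trichotomy (d ^ 2) w with h | h | h
    · have := cubic6_strictMono hH2 (sq_nonneg d) h; linarith
    · exact h
    · have := cubic6_strictMono hH2 hw0.le h; linarith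
  rw [← this, Real.sqrt_sq hd0.le]

theorem a6_rel (H d : ℝ) :
    2 * a6 H d * (d ^ 2 + H ^ 2 + 1) + d * (2 * (d ^ 2 + H ^ 2 + 1) - 5) = 0 := by
  have : d ^ 2 + H ^ 2 + 1 ≠ 0 := by positivity
  unfold a6
  field_simp
  ring

theorem eq_a6 {a H d : ℝ}
    (h : 2 * a * (d ^ 2 + H ^ 2 + 1) + d * (2 * (d ^ 2 + H ^ 2 + 1) - 5) = 0) : a = a6 H d := by
  have : d ^ 2 + H ^ 2 + 1 ≠ 0 := by positivity
  unfold a6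
  rw [eq_div_iff (by positivity)]
  linear_combination h

theorem cubic6_bound' {H d : ℝ} (hH : Range6 H) (hd : Solves6 H d) :
    0 < d ∧ d ^ 2 < 3 / 10 ∧ H ^ 2 < 3 / 7 := by
  obtain ⟨hd0, hz⟩ := solves6_iff.1 hd
  exact ⟨hd0, cubic6_bound (sq_nonneg H) hz, (range6_iff.1 hH).2⟩

theorem a6_pos {H d : ℝ} (hH : Range6 H) (hd : Solves6 H d) : 0 < a6 H d := by
  obtain ⟨hd0, hw, hh⟩ := cubic6_bound' hH hd
  unfold a6
  apply div_pos _ (by positivity)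
  nlinarith [mul_pos hd0 (show 0 < 3 - 2 * d ^ 2 - 2 * H ^ 2 by linarith)]

theorem a6_le {H d : ℝ} (hd : 0 < d) : a6 H d ≤ 3 / 2 * d := by
  unfold a6
  rw [div_le_iff₀ (by positivity)]
  nlinarith [mul_pos hd (show 0 < 5 * d ^ 2 + 5 * H ^ 2 by positivity)]

/-- The equation of family (6) is the remaining critical-point equation, once `a` is eliminated. -/
theorem cubic6_eq {a H d : ℝ}
    (hL : 2 * a * (d ^ 2 + H ^ 2 + 1) + d * (2 * (d ^ 2 + H ^ 2 + 1) - 5) = 0) :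
    (d ^ 2 + H ^ 2 + 1) ^ 2 * (-4 * a ^ 2 * d + 2 * a * d ^ 2 + 6 * a * H ^ 2 + 2 * d ^ 3
      - d * H ^ 2 + 6 * a - 6 * d) = -(d * cubic6 (H ^ 2) (d ^ 2)) := by
  unfold cubic6
  linear_combination (-2 * a * d * (d ^ 2 + H ^ 2 + 1)
    + (d ^ 2 + 3 * H ^ 2 + 3) * (d ^ 2 + H ^ 2 + 1) + d ^ 2 * (2 * (d ^ 2 + H ^ 2 + 1) - 5)) * hL

/-- The two equations left by `classify_of_ne_zero` when `c = 0 ≠ d` are also sufficient. -/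
theorem isCritical_six {a H d t : ℝ} (hd : d ≠ 0)
    (hT : t * S a 0 H 0 d = -(4 * a ^ 2 + 2 * a * d + 3 * d ^ 2 + 3 * H ^ 2 + 3))
    (hL : 2 * a * (d ^ 2 + H ^ 2 + 1) + d * (2 * (d ^ 2 + H ^ 2 + 1) - 5) = 0)
    (hp : -4 * a ^ 2 * d + 2 * a * d ^ 2 + 6 * a * H ^ 2 + 2 * d ^ 3 - d * H ^ 2 + 6 * a - 6 * d
      = 0) : (bracketMetric a 0 H 0 d 0).IsCritical t := by
  rw [isCritical_iff a 0 H 0 d t _ hT.symm]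
  unfold g00 g11 g22 g33 g01 g02 g03 g12 g13
  have hq : 8 * a ^ 3 - 4 * a ^ 2 * d + 20 * a * d ^ 2 + 38 * a * H ^ 2 + 12 * d ^ 3
      + 3 * d * H ^ 2 + 18 * a - 27 * d = 0 := by
    apply mul_left_cancel₀ hd
    linear_combination 3 * (2 * a + d) * hL - (2 * a - 3 * d) * hp
  refine ⟨?_, ?_, ?_, ?_, by ring, by ring, by ring, by ring, by ring⟩
  · linear_combination 4 * a * hp + d * hq
  · linear_combination -4 * (a + 2 * d) * hp + d * hq
  · linear_combination 4 * (2 * d - a / 3) * hp - 5 / 3 * d * hq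
  · linear_combination 4 / 3 * a * hp - d / 3 * hq

end NormalForm
end

noncomputable section

/-! ### The six families are critical -/

namespace NormalForm

theorem S_zero (a c d : ℝ) : S a (-c) 0 c d = 11 * (a + d) ^ 2 + (a - d) ^ 2 + 1 := by
  unfold S
  ring

theorem energy_zero_eq (a c d t T : ℝ) (hT : T = t * S a (-c) 0 c d) :
    (bracketMetric a (-c) 0 c d 0).energy t
      = (24 * (a + d) ^ 4 + 8 * (a + d) ^ 2 * (a - d) ^ 2 + 3
        + (3 * (a + d) ^ 2 + (a - d) ^ 2) ^ 2 + 8 * c ^ 2 * (a - d) ^ 2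
        + T * (11 * (a + d) ^ 2 + (a - d) ^ 2 + 1)) / 4 := by
  rw [energy_eq a (-c) 0 c d t T hT, ricNormSq_eq, S_zero]
  ring

/-! #### The product and the nilpotent group -/

theorem family1_t {t : ℝ} : t * S 0 0 0 0 0 = -3 ↔ t = -3 := by
  norm_num [S]

theorem family3_t {t : ℝ} : t * S 0 0 0 (-1) 0 = -3 ↔ t = -3 / 2 := by
  norm_num [S]
  constructor <;> intro h <;> linarith

theorem family1_isCritical : family1.IsCritical (-3) := by
  rw [family1, isCritical_iff 0 0 0 0 0 _ _ (family1_t.2 rfl).symm]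
  norm_num [g00, g11, g22, g33, g01, g02, g03, g12, g13]

theorem family1_energy : family1.energy (-3) = 0 := by
  rw [family1, energy_eq 0 0 0 0 0 _ _ (family1_t.2 rfl).symm, ricNormSq_eq]
  norm_num [S]

theorem family3_isCritical : family3.IsCritical (-3 / 2) := by
  rw [family3, isCritical_iff 0 0 0 (-1) 0 _ _ (family3_t.2 rfl).symm]
  norm_num [g00, g11, g22, g33, g01, g02, g03, g12, g13]

theorem family3_energy : family3.energy (-3 / 2) = 0 := by
  rw [family3, energy_eq 0 0 0 (-1) 0 _ _ (family3_t.2 rfl).symm, ricNormSq_eq]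
  norm_num [S]

/-! #### The diagonal family -/

theorem solves2_iff {a d : ℝ} :
    Solves2 a d ↔ 0 < d ∧ 3 * (a + d) ^ 2 + (a - d) ^ 2 = 3 := by
  unfold Solves2
  refine and_congr_right fun _ => ⟨fun h => ?_, fun h => ?_⟩ <;> linear_combination h

/-- The equation of family (2) confines `a` to the range of that family. -/
theorem range2_of_lt {a d : ℝ} (hp : 0 ≤ a + d) (hq : a < d)
    (h : 3 * (a + d) ^ 2 + (a - d) ^ 2 = 3) : Range2 a ∧ Solves2 a d := by
  refine ⟨⟨?_, ?_⟩, solves2_iff.2 ⟨by linarith, h⟩⟩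
  · have : d - a ≤ √3 := Real.le_sqrt_of_sq_le (by nlinarith)
    linarith
  · have : a + d < 1 := by nlinarith [sq_pos_of_pos (sub_pos.2 hq)]
    linarith

theorem lt_of_solves2 {a d : ℝ} (ha : Range2 a) (h : Solves2 a d) :
    a < d ∧ (a + d) ^ 2 < 1 := by
  obtain ⟨h0, h1⟩ := solves2_iff.1 h
  have hlt : a < d := by
    by_contra hc
    have := ha.2
    nlinarith
  exact ⟨hlt, by nlinarith [sq_pos_of_pos (sub_pos.2 hlt)]⟩

theorem S_two {a d : ℝ} (h : Solves2 a d) : S a 0 0 0 d = 2 * (4 * a * d + 5) := by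
  have := h.2
  unfold S
  linear_combination 3 * this

theorem t2_mul {a d t : ℝ} (h : Solves2 a d) : t * S a 0 0 0 d = -3 ↔ t = t2 a d := by
  have hS := S_pos a 0 0 0 d
  unfold t2
  rw [← S_two h, eq_div_iff hS.ne']

theorem family2_isCritical {a d : ℝ} (h : Solves2 a d) :
    (family2 a d).IsCritical (t2 a d) := by
  have h1 := isCritical_zero_iff a 0 d (t2 a d) (-3)
  rw [neg_zero] at h1
  obtain ⟨-, h2⟩ := solves2_iff.1 h
  refine (h1 ((t2_mul h).2 rfl).symm).2 ⟨?_, by ring, ?_, ?_⟩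
  · linear_combination (a + d) * (a - d) * h2
  · linear_combination -(a + d) ^ 2 * h2
  · linear_combination (a - d) ^ 2 * h2

theorem energy_of_diagonal {a d t : ℝ} (h : 3 * (a + d) ^ 2 + (a - d) ^ 2 = 3)
    (hT : t * S a 0 0 0 d = -3) : (bracketMetric a 0 0 0 d 0).energy t = 0 := by
  have h1 := energy_zero_eq a 0 d t (-3)
  rw [neg_zero] at h1
  rw [h1 hT.symm]
  linear_combination ((3 * (a + d) ^ 2 + (a - d) ^ 2) / 4 + 2 * (a + d) ^ 2) * h

theorem family2_energy {a d : ℝ} (h : Solves2 a d) : (family2 a d).energy (t2 a d) = 0 :=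
  energy_of_diagonal (solves2_iff.1 h).2 ((t2_mul h).2 rfl)

theorem t2_eq {a d : ℝ} (h : Solves2 a d) : t2 a d = -3 / (4 * (2 * (a + d) ^ 2 + 1)) := by
  unfold t2
  congr 1
  linear_combination -2 * h.2

theorem setOf_t2 :
    {t | ∃ a d, Range2 a ∧ Solves2 a d ∧ t = t2 a d} = Set.Ico (-3 / 4) (-1 / 4) := by
  ext t
  constructor
  · rintro ⟨a, d, ha, hd, rfl⟩
    have hP := (lt_of_solves2 ha hd).2
    rw [t2_eq hd]
    constructor
    · rw [div_le_div_iff₀ (by norm_num) (by positivity)]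
      nlinarith [sq_nonneg (a + d)]
    · rw [div_lt_div_iff₀ (by positivity) (by norm_num)]
      linarith
  · rintro ⟨h1, h2⟩
    have ht : t < 0 := by linarith
    set P := (-3 / (4 * t) - 1) / 2 with hP
    have hPt : 4 * t * (2 * P + 1) = -3 := by
      have : t ≠ 0 := ht.ne
      rw [hP]
      field_simp
      ring
    have hP0 : 0 ≤ P := by
      by_contra hc
      nlinarith
    have hP1 : P < 1 := by
      by_contra hc
      nlinarith
    have hp := Real.sq_sqrt hP0
    have hr := Real.sq_sqrt (show 0 ≤ 3 - 3 * P by linarith)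
    have hr0 : 0 < √(3 - 3 * P) := Real.sqrt_pos.2 (by linarith)
    obtain ⟨h3, h4⟩ := range2_of_lt (a := (√P - √(3 - 3 * P)) / 2) (d := (√P + √(3 - 3 * P)) / 2)
      (by ring_nf; positivity) (by linarith) (by linear_combination 3 * hp + hr)
    refine ⟨_, _, h3, h4, ?_⟩
    rw [t2_eq h4, eq_div_iff (by positivity)]
    linear_combination 8 * t * hp + hPt

/-! #### The family with a conformal symmetric part -/

theorem t4_mul {a t : ℝ} : t * S a 0 0 0 a = -(3 * (4 * a ^ 2 + 1)) ↔ t = t4 a := by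
  have : S a 0 0 0 a = 44 * a ^ 2 + 1 := by
    unfold S
    ring
  unfold t4
  rw [this, eq_div_iff (by positivity)]

theorem family4_isCritical (a : ℝ) : (family4 a).IsCritical (t4 a) := by
  have h1 := isCritical_zero_iff a 0 a (t4 a) (-(3 * (4 * a ^ 2 + 1)))
  rw [neg_zero] at h1
  refine (h1 (t4_mul.2 rfl).symm).2 ⟨?_, ?_, ?_, ?_⟩ <;> ring

theorem family4_energy (a : ℝ) : (family4 a).energy (t4 a) = -36 * a ^ 2 := by
  have h1 := energy_zero_eq a 0 a (t4 a) (-(3 * (4 * a ^ 2 + 1)))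
  rw [neg_zero] at h1
  rw [family4, h1 (t4_mul.2 rfl).symm]
  ring

/-! #### The family with a skew part -/

theorem t5_mul {a c d t : ℝ} (hc : 7 - 8 * c ^ 2 ≠ 0)
    (h1 : (a + d) ^ 2 * (7 - 8 * c ^ 2) = 3 - 12 * c ^ 2)
    (h2 : (a - d) ^ 2 = 4 * (a + d) ^ 2 + 4 * c ^ 2) :
    t * S a (-c) 0 c d = -(3 * (a + d) ^ 2 + (a - d) ^ 2 + 8 * c ^ 2) ↔ t = t5 c := by
  have hS := S_pos a (-c) 0 c d
  have e1 : S a (-c) 0 c d * (7 - 8 * c ^ 2) = -(4 * (8 * c ^ 4 + 40 * c ^ 2 - 13)) := by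
    rw [S_zero]
    linear_combination (7 - 8 * c ^ 2) * h2 + 15 * h1
  have e2 : -(3 * (a + d) ^ 2 + (a - d) ^ 2 + 8 * c ^ 2) * (7 - 8 * c ^ 2)
      = 3 * (32 * c ^ 4 - 7) := by
    linear_combination -(7 - 8 * c ^ 2) * h2 - 7 * h1
  have h4 : 4 * (8 * c ^ 4 + 40 * c ^ 2 - 13) ≠ 0 := by
    rw [← neg_ne_zero, ← e1]
    exact mul_ne_zero hS.ne' hc
  unfold t5
  rw [← mul_left_inj' hc, mul_assoc, e1, e2, eq_div_iff h4]
  constructor <;> intro h <;> linear_combination -h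

theorem family5_isCritical {a c d : ℝ} (hc : Range5 c) (h : Solves5 c a d) :
    (family5 a c d).IsCritical (t5 c) := by
  obtain ⟨-, -, h1, h2⟩ := (solves5_iff hc).1 h
  refine (isCritical_zero_iff a c d (t5 c) _
    ((t5_mul (range5_pos hc).2.1 h1 h2).2 rfl).symm).2 ⟨by ring, ?_, ?_, by ring⟩
  · linear_combination -(a - d) * c * h2
  · linear_combination -h2 - h1

/-- On family (5) the energy is manifestly negative in terms of `a + d`. -/
theorem energy_of_skew {a c d t : ℝ}
    (hT : t * S a (-c) 0 c d = -(3 * (a + d) ^ 2 + (a - d) ^ 2 + 8 * c ^ 2))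
    (h1 : (a + d) ^ 2 * (7 - 8 * c ^ 2) = 3 - 12 * c ^ 2)
    (h2 : (a - d) ^ 2 = 4 * (a + d) ^ 2 + 4 * c ^ 2) :
    (bracketMetric a (-c) 0 c d 0).energy t = -24 * (a + d) ^ 2 * c ^ 2 := by
  rw [energy_zero_eq a c d t _ hT.symm]
  linear_combination (-1 / 4) * h2 - (1 / 4) * h1

theorem family5_energy' {a c d : ℝ} (hc : Range5 c) (h : Solves5 c a d) :
    (family5 a c d).energy (t5 c) = -24 * (a + d) ^ 2 * c ^ 2 := by
  obtain ⟨-, -, h1, h2⟩ := (solves5_iff hc).1 h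
  exact energy_of_skew ((t5_mul (range5_pos hc).2.1 h1 h2).2 rfl) h1 h2

theorem family5_energy {a c d : ℝ} (hc : Range5 c) (h : Solves5 c a d) :
    (family5 a c d).energy (t5 c) = -(72 * c ^ 2 * (4 * c ^ 2 - 1)) / (8 * c ^ 2 - 7) := by
  obtain ⟨-, -, h1, h2⟩ := (solves5_iff hc).1 h
  have hc' := (range5_pos hc).2.1
  rw [family5_energy' hc h, eq_div_iff (by contrapose! hc'; linarith)]
  linear_combination 24 * c ^ 2 * h1

/-! #### The family with `H ≠ 0` -/

theorem t6_mul {a d H t : ℝ} :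
    t * S a 0 H 0 d = -(4 * a ^ 2 + 2 * a * d + 3 * d ^ 2 + 3 * H ^ 2 + 3) ↔ t = t6 a d H := by
  have hS := S_pos a 0 H 0 d
  have : 12 * a ^ 2 + 12 * d ^ 2 + 20 * a * d + H ^ 2 + 1 = S a 0 H 0 d := by
    unfold S
    ring
  unfold t6
  rw [this, eq_div_iff hS.ne']
  constructor <;> intro h <;> linear_combination h

theorem family6_isCritical {d H : ℝ} (h : Solves6 H d) :
    (family6 (a6 H d) d H).IsCritical (t6 (a6 H d) d H) := by
  obtain ⟨hd, hz⟩ := solves6_iff.1 h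
  refine isCritical_six hd.ne' (t6_mul.2 rfl) (a6_rel H d) ?_
  have h1 := cubic6_eq (a6_rel H d)
  rw [hz, mul_zero, neg_zero] at h1
  exact (mul_eq_zero.1 h1).resolve_left (by positivity)

theorem family6_energy (a d H : ℝ) : (family6 a d H).energy (t6 a d H) =
    1 / 4 * (24 * a ^ 3 * d + 2 * a * d * (22 * d ^ 2 - 19 * H ^ 2 - 31)
      + 3 * d ^ 2 * (4 * d ^ 2 - 7 * H ^ 2 - 13)
      + 4 * a ^ 2 * (13 * d ^ 2 - 6 * H ^ 2 - 10)) := by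
  rw [family6, energy_eq a 0 H 0 d _ _ (t6_mul.2 rfl).symm, ricNormSq_eq]
  unfold S
  ring

theorem family6_energy_neg {d H : ℝ} (hH : Range6 H) (h : Solves6 H d) :
    (family6 (a6 H d) d H).energy (t6 (a6 H d) d H) < 0 := by
  obtain ⟨hd, hw, -⟩ := cubic6_bound' hH h
  have ha := a6_pos hH h
  have hle := a6_le (H := H) hd
  rw [family6_energy]
  set a := a6 H d
  have had := mul_pos ha hd
  have h1 : a ^ 2 ≤ 27 / 40 := by
    calc a ^ 2 ≤ (3 / 2 * d) ^ 2 := by gcongr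
      _ ≤ 27 / 40 := by nlinarith
  have h2 : a * d * (24 * a ^ 2 + 2 * (22 * d ^ 2 - 19 * H ^ 2 - 31)) < 0 :=
    mul_neg_of_pos_of_neg had (by nlinarith [sq_nonneg H])
  have h3 : d ^ 2 * (4 * d ^ 2 - 7 * H ^ 2 - 13) < 0 :=
    mul_neg_of_pos_of_neg (by positivity) (by nlinarith [sq_nonneg H])
  have h4 : a ^ 2 * (13 * d ^ 2 - 6 * H ^ 2 - 10) < 0 :=
    mul_neg_of_pos_of_neg (by positivity) (by nlinarith [sq_nonneg H])
  linarith

/-- The constant term of `cubic6` is negative at a solution with `d ≠ 0`, by monotonicity; this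
bounds `H`. -/
theorem range6_of_eq {a d H : ℝ} (hd : 0 < d) (hH : 0 < H)
    (hL : 2 * a * (d ^ 2 + H ^ 2 + 1) + d * (2 * (d ^ 2 + H ^ 2 + 1) - 5) = 0)
    (hp : -4 * a ^ 2 * d + 2 * a * d ^ 2 + 6 * a * H ^ 2 + 2 * d ^ 3 - d * H ^ 2 + 6 * a - 6 * d
      = 0) : Range6 H ∧ Solves6 H d := by
  have hz := cubic6_eq hL
  rw [hp, mul_zero, zero_eq_neg] at hz
  have hz := (mul_eq_zero.1 hz).resolve_left hd.ne'
  refine ⟨range6_iff.2 ⟨hH, ?_⟩, solves6_iff.2 ⟨hd, hz⟩⟩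
  have h0 := cubic6_strictMono (sq_nonneg H) le_rfl (show 0 < d ^ 2 by positivity)
  rw [hz] at h0
  unfold cubic6 at h0
  have : 0 < (H ^ 2 + 1) ^ 2 := by positivity
  by_contra hc
  nlinarith

end NormalForm
end

noncomputable section

/-! ### The complex hyperbolic plane -/

namespace NormalForm

/-- Twice the Levi-Civita connection of the complex hyperbolic plane. -/
def connCH : Fin 4 → Fin 4 → Fin 4 → ℤ :=
  ![![![0, 0, 0, -1], ![0, 0, 1, 0], ![0, -1, 0, 0], ![1, 0, 0, 0]],
    ![![0, 0, -1, 0], ![0, 0, 0, -1], ![1, 0, 0, 0], ![0, 1, 0, 0]],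
    ![![0, -1, 0, 0], ![1, 0, 0, 0], ![0, 0, 0, -2], ![0, 0, 2, 0]],
    ![![0, 0, 0, 0], ![0, 0, 0, 0], ![0, 0, 0, 0], ![0, 0, 0, 0]]]

/-- The complex structure `J e₁ = e₂`, `J e₃ = e₄`. -/
def cplx : Fin 4 → Fin 4 → ℤ :=
  ![![0, 1, 0, 0], ![-1, 0, 0, 0], ![0, 0, 0, 1], ![0, 0, -1, 0]]

/-- Minus four times the curvature tensor of the complex hyperbolic plane. -/
def riemCH (i j k l : Fin 4) : ℤ :=
  (if i = k ∧ j = l then 1 else 0) - (if i = l ∧ j = k then 1 else 0)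
    + cplx i k * cplx j l - cplx i l * cplx j k + 2 * cplx i j * cplx k l

theorem conn_ch : (bracketMetric (1 / 2) 0 0 0 (1 / 2) 0).conn
    = fun i j k => (connCH i j k : ℝ) / 2 := by
  rw [conn_eq]
  funext i j k
  fin_cases i <;> fin_cases j <;> fin_cases k <;> simp [cn, connCH] <;> norm_num

theorem riemCH_eq : ∀ i j k l : Fin 4, -riemCH i j k l = ∑ m, (connCH j l m * connCH i m k
    - connCH i l m * connCH j m k - (connCH i j m - connCH j i m) * connCH m l k) := by
  decide +kernel

theorem covRiemCH_eq : ∀ p i j k l : Fin 4, ∑ m, (connCH p i m * riemCH m j k l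
    + connCH p j m * riemCH i m k l + connCH p k m * riemCH i j m l
    + connCH p l m * riemCH i j k m) = 0 := by
  decide +kernel

/-- The value `a = 1 / 2` left out of family (4) is the complex hyperbolic plane.  Its curvature
tensor is a polynomial in the metric and the parallel complex structure; `∇R = 0` is checked on the
finitely many components, which are integers after scaling. -/
theorem isSymmetric_ch : (bracketMetric (1 / 2) 0 0 0 (1 / 2) 0).IsSymmetric := by
  have hR : ∀ i j k l, (bracketMetric (1 / 2) 0 0 0 (1 / 2) 0).riem i j k l
      = -(riemCH i j k l : ℝ) / 4 := by
    intro i j k l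
    have h := congrArg (Int.cast (R := ℝ)) (riemCH_eq i j k l)
    push_cast at h
    rw [h, LeftInvMetric.riem, Finset.sum_div]
    refine Finset.sum_congr rfl fun m _ => ?_
    rw [← LeftInvMetric.conn_sub_conn, conn_ch]
    push_cast
    ring
  intro p i j k l
  have h := congrArg (Int.cast (R := ℝ)) (covRiemCH_eq p i j k l)
  push_cast at h
  rw [LeftInvMetric.covRiem, conn_ch]
  simp only [hR]
  rw [← mul_eq_zero_iff_left (show (8 : ℝ) ≠ 0 by norm_num)]
  rw [← h, mul_neg, Finset.mul_sum, ← Finset.sum_neg_distrib]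
  refine Finset.sum_congr rfl fun m _ => ?_
  ring

end NormalForm
end

noncomputable section

/-! ### Smooth maps in left-invariant frames -/

namespace Heis

theorem contDiff_flow (D : LieDerivation ℝ Heis Heis) : ContDiff ℝ ∞ (flow D) := by
  have h : ContDiff ℝ ∞ (NormedSpace.exp : (Heis →L[ℝ] Heis) → (Heis →L[ℝ] Heis)) :=
    contDiff_iff_contDiffAt.2 fun x => (NormedSpace.exp_analytic (𝕂 := ℝ) x).contDiffAt
  exact h.comp (contDiff_id.smul contDiff_const)

/-- A solution of `g' = D g` is an orbit of the flow of `D`. -/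
theorem flow_eq_of_hasDerivAt (D : LieDerivation ℝ Heis Heis) {g : ℝ → Heis}
    (hg : ∀ s, HasDerivAt g (D (g s)) s) (s : ℝ) : flow D s (g 0) = g s := by
  have key : ∀ r, HasDerivAt (fun r => flow D (s - r) (g r)) 0 r := by
    intro r
    have h2 : HasDerivAt (fun r => flow D (s - r)) (-(flow D (s - r) * derCLM D)) r := by
      have := (hasDerivAt_exp_smul_const (𝕂 := ℝ) (derCLM D) (s - r)).scomp r
        ((hasDerivAt_id r).const_sub s)
      exact this.congr_deriv (by simp [flow])
    exact (h2.clm_apply (hg r)).congr_deriv (by simp)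
  have := is_const_of_deriv_eq_zero (fun r => (key r).differentiableAt)
    (fun r => (key r).deriv) 0 s
  simpa [flow_zero] using this

end Heis

namespace SemiHeis

variable {D : LieDerivation ℝ Heis Heis}

theorem leftLin_one (u : SemiHeis D) : leftLin 1 u = u := by
  apply SemiHeis.ext <;> simp [leftLin, one_def, Heis.flow_zero]

theorem leftLin_mul (p q u : SemiHeis D) : leftLin (p * q) u = leftLin p (leftLin q u) := by
  have h : p * q + leftLin (p * q) u = p * q + leftLin p (leftLin q u) := by
    rw [← mul_eq_add_leftLin, mul_assoc, mul_eq_add_leftLin q u, mul_eq_add_leftLin p,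
      mul_eq_add_leftLin p q, map_add, add_assoc]
  exact add_left_cancel h

theorem leftLin_inv_leftLin (p u : SemiHeis D) : leftLin p⁻¹ (leftLin p u) = u := by
  rw [← leftLin_mul, inv_mul_cancel, leftLin_one]

theorem leftLin_leftLin_inv (p u : SemiHeis D) : leftLin p (leftLin p⁻¹ u) = u := by
  rw [← leftLin_mul, mul_inv_cancel, leftLin_one]

theorem leftInvField_eq (u p : SemiHeis D) : leftInvField u p = leftLin p u :=
  fderiv_mul_left p 1 u

variable {E : Type*} [NormedAddCommGroup E] [NormedSpace ℝ E]

theorem contDiff_heis {n : WithTop ℕ∞} {f : E → SemiHeis D} (hf : ContDiff ℝ n f) :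
    ContDiff ℝ n fun x => (f x).heis := (heisL (D := D)).contDiff.comp hf

theorem contDiff_real {n : WithTop ℕ∞} {f : E → SemiHeis D} (hf : ContDiff ℝ n f) :
    ContDiff ℝ n fun x => (f x).real := (realL (D := D)).contDiff.comp hf

theorem contDiff_lie {n : WithTop ℕ∞} {f g : E → Heis} (hf : ContDiff ℝ n f)
    (hg : ContDiff ℝ n g) : ContDiff ℝ n fun x => ⁅f x, g x⁆ :=
  Heis.isBoundedBilinearMap_lie.contDiff.comp (hf.prodMk hg)

theorem contDiff_mk {n : WithTop ℕ∞} {f : E → Heis} {g : E → ℝ} (hf : ContDiff ℝ n f)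
    (hg : ContDiff ℝ n g) : ContDiff ℝ n fun x => (mk (f x) (g x) : SemiHeis D) :=
  hf.prodMk hg

theorem contDiff_leftLin {f g : E → SemiHeis D} (hf : ContDiff ℝ ∞ f) (hg : ContDiff ℝ ∞ g) :
    ContDiff ℝ ∞ fun x => leftLin (f x) (g x) := by
  have h : ContDiff ℝ ∞ fun x => Heis.flow D (f x).real (g x).heis :=
    ((Heis.contDiff_flow D).comp (contDiff_real hf)).clm_apply (contDiff_heis hg)
  exact contDiff_mk (h.add ((contDiff_lie (contDiff_heis hf) h).const_smul (1 / 2 : ℝ)))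
    (contDiff_real hg)

theorem contDiff_inv {f : E → SemiHeis D} (hf : ContDiff ℝ ∞ f) :
    ContDiff ℝ ∞ fun x => (f x)⁻¹ := by
  have h : ContDiff ℝ ∞ fun x => Heis.flow D (-(f x).real) (f x).heis :=
    ((Heis.contDiff_flow D).comp (contDiff_real hf).neg).clm_apply (contDiff_heis hf)
  exact contDiff_mk h.neg (contDiff_real hf).neg

/-- Left-invariant fields close under the Lie bracket at every point. -/
theorem fderiv_leftLin_sub (u v p : SemiHeis D) :
    fderiv ℝ (fun q => leftLin q v) p (leftLin p u)
      - fderiv ℝ (fun q => leftLin q u) p (leftLin p v) = leftLin p ⁅u, v⁆ := by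
  have hs : ∀ w : SemiHeis D, Differentiable ℝ fun q : SemiHeis D => leftLin q w := fun w =>
    (contDiff_leftLin contDiff_id contDiff_const).differentiable (by simp)
  have key : ∀ w x : SemiHeis D, fderiv ℝ (fun q => leftLin q w) p (leftLin p x)
      = leftLin p (fderiv ℝ (fun q => leftLin q w) 1 x) := by
    intro w x
    have hm : HasFDerivAt (fun q : SemiHeis D => p * q)
        (LinearMap.toContinuousLinearMap (leftLin p)) 1 := by
      have h : (fun q : SemiHeis D => p * q)
          = fun q => p + LinearMap.toContinuousLinearMap (leftLin p) q := by
        funext q; exact mul_eq_add_leftLin p q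
      rw [h]
      exact (ContinuousLinearMap.hasFDerivAt _).const_add p
    have h1 : HasFDerivAt (fun q => leftLin (p * q) w) _ 1 :=
      HasFDerivAt.comp (g := fun q => leftLin q w) 1
        ((hs w (p * 1)).hasFDerivAt) hm
    have h2 : HasFDerivAt (fun q => leftLin (p * q) w)
        ((LinearMap.toContinuousLinearMap (leftLin p)).comp
          (fderiv ℝ (fun q => leftLin q w) 1)) 1 := by
      simp only [leftLin_mul]
      exact (LinearMap.toContinuousLinearMap (leftLin p)).hasFDerivAt.comp (1 : SemiHeis D)
        (hs w 1).hasFDerivAt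
    have h3 := congrArg (fun L => L x) (h1.unique h2)
    simpa using h3
  rw [key, key, ← map_sub]
  congr 1
  have h := lieBracket_leftInvField u v
  rw [VectorField.lieBracket_eq] at h
  have hE : ∀ w : SemiHeis D, leftInvField w = fun q => leftLin q w := fun w =>
    funext fun q => leftInvField_eq w q
  simp only [hE, leftLin_one] at h
  exact h

end SemiHeis

namespace LeftInvMetric

open SemiHeis

variable {D D' : LieDerivation ℝ Heis Heis} (M : LeftInvMetric D) (M' : LeftInvMetric D')

theorem metricAt_leftLin (p u v : SemiHeis D) :
    M.metricAt p (leftLin p u) (leftLin p v) = M.inner u v := by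
  simp only [metricAt, fderiv_mul_left, leftLin_inv_leftLin]

/-- The matrix of the differential of `φ` in the left-invariant orthonormal frames. -/
def diffMatrix (φ : SemiHeis D → SemiHeis D') (p : SemiHeis D) (i j : Fin 4) : ℝ :=
  M'.frame.repr (leftLin (φ p)⁻¹ (fderiv ℝ φ p (leftLin p (M.frame i)))) j

variable {M M'} {φ : SemiHeis D → SemiHeis D'}

theorem fderiv_frame (p : SemiHeis D) (i : Fin 4) :
    fderiv ℝ φ p (leftLin p (M.frame i))
      = ∑ j, diffMatrix M M' φ p i j • leftLin (φ p) (M'.frame j) := by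
  simp only [diffMatrix, ← map_smul, ← map_sum, M'.frame.sum_repr, leftLin_leftLin_inv]

theorem diffMatrix_mul {μ : ℝ}
    (h : ∀ p u v, M'.metricAt (φ p) (fderiv ℝ φ p u) (fderiv ℝ φ p v) = μ * M.metricAt p u v)
    (p : SemiHeis D) (i k : Fin 4) :
    ∑ j, diffMatrix M M' φ p i j * diffMatrix M M' φ p k j = if i = k then μ else 0 := by
  have h1 := h p (leftLin p (M.frame i)) (leftLin p (M.frame k))
  rw [metricAt_leftLin, frame_orthonormal] at h1
  simp only [metricAt, fderiv_mul_left, inner] at h1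
  simpa [diffMatrix] using h1

theorem contDiff_diffMatrix (hφ : ContDiff ℝ ∞ φ) (i j : Fin 4) :
    ContDiff ℝ ∞ fun p => diffMatrix M M' φ p i j := by
  have h1 : ContDiff ℝ ∞ fun p => leftLin (φ p)⁻¹ (fderiv ℝ φ p (leftLin p (M.frame i))) :=
    contDiff_leftLin (contDiff_inv hφ) ((hφ.fderiv_right (by simp)).clm_apply
      (contDiff_leftLin contDiff_id contDiff_const))
  exact (LinearMap.toContinuousLinearMap (M'.frame.coord j)).contDiff.comp h1

/-- The structure equation of the differential of `φ`: both frames bracket with constant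
structure constants. -/
theorem diffMatrix_structure (hφ : ContDiff ℝ ∞ φ) (p : SemiHeis D) (i j l : Fin 4) :
    fderiv ℝ (fun q => diffMatrix M M' φ q j l) p (leftLin p (M.frame i))
      - fderiv ℝ (fun q => diffMatrix M M' φ q i l) p (leftLin p (M.frame j))
      + ∑ a, ∑ b, diffMatrix M M' φ p i a * diffMatrix M M' φ p j b * M'.structConst a b l
      = ∑ k, M.structConst i j k * diffMatrix M M' φ p k l := by
  have hs : ∀ w : SemiHeis D, Differentiable ℝ fun q : SemiHeis D => leftLin q w := fun w =>
    (contDiff_leftLin contDiff_id contDiff_const).differentiable (by simp)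
  have hs' : ∀ w : SemiHeis D', Differentiable ℝ fun q : SemiHeis D' => leftLin q w := fun w =>
    (contDiff_leftLin contDiff_id contDiff_const).differentiable (by simp)
  have hφ1 : Differentiable ℝ φ := hφ.differentiable (by simp)
  have hφ2 : Differentiable ℝ (fderiv ℝ φ) :=
    (hφ.fderiv_right (m := ∞) (by simp)).differentiable (by simp)
  have hO : ∀ i j, Differentiable ℝ fun q => diffMatrix M M' φ q i j := fun i j =>
    (contDiff_diffMatrix hφ i j).differentiable (by simp)
  -- the derivative of `dφ(E_j)`, computed in two ways
  have key : ∀ (j : Fin 4) (w : SemiHeis D),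
      fderiv ℝ (fderiv ℝ φ) p w (leftLin p (M.frame j))
        + fderiv ℝ φ p (fderiv ℝ (fun q => leftLin q (M.frame j)) p w)
      = ∑ l, (fderiv ℝ (fun q => diffMatrix M M' φ q j l) p w • leftLin (φ p) (M'.frame l)
          + diffMatrix M M' φ p j l •
            fderiv ℝ (fun q => leftLin q (M'.frame l)) (φ p) (fderiv ℝ φ p w)) := by
    intro j w
    have h1 : HasFDerivAt (fun q => fderiv ℝ φ q (leftLin q (M.frame j))) _ p :=
      (hφ2 p).hasFDerivAt.clm_apply (hs (M.frame j) p).hasFDerivAt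
    have h2 : HasFDerivAt (fun q => ∑ l, diffMatrix M M' φ q j l • leftLin (φ q) (M'.frame l))
        _ p := HasFDerivAt.fun_sum fun l _ => (hO j l p).hasFDerivAt.smul
          (HasFDerivAt.comp (g := fun q => leftLin q (M'.frame l)) p
            (hs' (M'.frame l) (φ p)).hasFDerivAt (hφ1 p).hasFDerivAt)
    simp only [fderiv_frame (M' := M') (φ := φ)] at h1
    have h3 := congrArg (fun L => L w) (h1.unique h2)
    simp only [add_apply, ContinuousLinearMap.coe_comp, Function.comp_apply,
      ContinuousLinearMap.flip_apply, sum_apply, smul_apply,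
      ContinuousLinearMap.smulRight_apply] at h3
    rw [add_comm, h3]
    exact Finset.sum_congr rfl fun l _ => add_comm _ _
  have hsymm := (hφ.contDiffAt (x := p)).isSymmSndFDerivAt
    (by rw [minSmoothness_of_isRCLikeNormedField]; exact WithTop.coe_le_coe.2 le_top)
  have hi := key j (leftLin p (M.frame i))
  have hj := key i (leftLin p (M.frame j))
  rw [hsymm.eq] at hi
  have hc : fderiv ℝ φ p (leftLin p ⁅M.frame i, M.frame j⁆)
      = leftLin (φ p) (∑ l, (∑ k, M.structConst i j k * diffMatrix M M' φ p k l) • M'.frame l) := by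
    rw [← M.frame.sum_repr ⁅M.frame i, M.frame j⁆]
    simp only [map_sum, map_smul, fderiv_frame (M' := M') (φ := φ), Finset.smul_sum, Finset.sum_smul]
    rw [Finset.sum_comm]
    simp only [smul_smul, structConst]
  obtain ⟨F, hF⟩ : ∃ F : Fin 4 → Fin 4 → SemiHeis D', ∀ a b,
      fderiv ℝ (fun q => leftLin q (M'.frame b)) (φ p) (leftLin (φ p) (M'.frame a)) = F a b :=
    ⟨_, fun _ _ => rfl⟩
  have hc' : ∀ a b, F a b
      = F b a + leftLin (φ p) (∑ l, M'.structConst a b l • M'.frame l) := by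
    intro a b
    simp only [structConst, M'.frame.sum_repr]
    rw [← fderiv_leftLin_sub, hF, hF]
    abel
  have h1 := congrArg₂ (· - ·) hi hj
  simp only [add_sub_add_left_eq_sub, ← map_sub, fderiv_leftLin_sub] at h1
  rw [hc] at h1
  simp only [fderiv_frame (M' := M') (φ := φ), map_sum, map_smul, Finset.sum_add_distrib, hF]
    at h1
  have h2 : ∑ b, diffMatrix M M' φ p j b • ∑ a, diffMatrix M M' φ p i a • F a b
      = ∑ a, diffMatrix M M' φ p i a • ∑ b, diffMatrix M M' φ p j b • F b a
        + leftLin (φ p) (∑ l, (∑ a, ∑ b, diffMatrix M M' φ p i a * diffMatrix M M' φ p j b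
          * M'.structConst a b l) • M'.frame l) := by
    have h : ∀ a b, diffMatrix M M' φ p j b • diffMatrix M M' φ p i a • F a b
        = diffMatrix M M' φ p i a • diffMatrix M M' φ p j b • F b a
          + ∑ l, (diffMatrix M M' φ p i a * diffMatrix M M' φ p j b
          * M'.structConst a b l) • leftLin (φ p) (M'.frame l) := by
      intro a b
      rw [hc', smul_comm, smul_add, smul_add]
      simp only [map_sum, map_smul, Finset.smul_sum, smul_smul, mul_assoc]
    simp only [Finset.smul_sum]
    rw [Finset.sum_comm]
    simp only [h, Finset.sum_add_distrib, map_sum, map_smul, Finset.sum_smul]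
    congr 1
    conv_rhs => rw [Finset.sum_comm]
    exact Finset.sum_congr rfl fun a _ => Finset.sum_comm
  rw [h2] at h1
  have h3 : leftLin (φ p) (∑ l, (∑ k, M.structConst i j k * diffMatrix M M' φ p k l) • M'.frame l)
      = leftLin (φ p) (∑ l, (fderiv ℝ (fun q => diffMatrix M M' φ q j l) p (leftLin p (M.frame i))
      - fderiv ℝ (fun q => diffMatrix M M' φ q i l) p (leftLin p (M.frame j))
      + ∑ a, ∑ b, diffMatrix M M' φ p i a * diffMatrix M M' φ p j b * M'.structConst a b l)
        • M'.frame l) := by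
    simp only [map_sum, map_smul] at h1 ⊢
    rw [h1]
    simp only [add_smul, sub_smul, Finset.sum_add_distrib, Finset.sum_sub_distrib]
    abel
  have h4 := congrArg (fun x => M'.frame.repr (leftLin (φ p)⁻¹ x) l) h3
  simp only [leftLin_inv_leftLin, Module.Basis.repr_sum_self] at h4
  exact h4.symm

end LeftInvMetric
end

noncomputable section

/-! ### Contraction of tensors with a frame -/

/-- The contraction `∑ a, x a • f a` of the first slot of a tensor `f` on `ℝ⁴` with a vector. -/
def contract {E : Type*} [AddCommGroup E] [Module ℝ E] (x : Fin 4 → ℝ) (f : Fin 4 → E) : E :=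
  ∑ a, x a • f a

section contract

variable {E : Type*} [AddCommGroup E] [Module ℝ E]

theorem contract_add (x : Fin 4 → ℝ) (f g : Fin 4 → E) :
    contract x (f + g) = contract x f + contract x g := by
  simp [contract, Finset.sum_add_distrib]

theorem contract_sub (x : Fin 4 → ℝ) (f g : Fin 4 → E) :
    contract x (f - g) = contract x f - contract x g := by
  simp [contract, smul_sub, Finset.sum_sub_distrib]

theorem contract_neg (x : Fin 4 → ℝ) (f : Fin 4 → E) :
    contract x (-f) = -contract x f := by
  simp [contract]

theorem contract_smul (r : ℝ) (x : Fin 4 → ℝ) (f : Fin 4 → E) :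
    contract x (r • f) = r • contract x f := by
  simp only [contract, Finset.smul_sum, Pi.smul_apply]
  exact Finset.sum_congr rfl fun a _ => smul_comm _ _ _

theorem contract_zero (x : Fin 4 → ℝ) : contract x (0 : Fin 4 → E) = 0 := by
  simp [contract]

theorem add_contract (x y : Fin 4 → ℝ) (f : Fin 4 → E) :
    contract (x + y) f = contract x f + contract y f := by
  simp [contract, add_smul, Finset.sum_add_distrib]

theorem sub_contract (x y : Fin 4 → ℝ) (f : Fin 4 → E) :
    contract (x - y) f = contract x f - contract y f := by
  simp [contract, sub_smul, Finset.sum_sub_distrib]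

theorem smul_contract (r : ℝ) (x : Fin 4 → ℝ) (f : Fin 4 → E) :
    contract (r • x) f = r • contract x f := by
  simp [contract, Finset.smul_sum, smul_smul]

theorem contract_apply {ι : Type*} (x : Fin 4 → ℝ) (f : Fin 4 → ι → E) (i : ι) :
    contract x f i = contract x (fun a => f a i) := by
  simp [contract]

theorem map_contract {F : Type*} [AddCommGroup F] [Module ℝ F] (A : E →ₗ[ℝ] F)
    (x : Fin 4 → ℝ) (f : Fin 4 → E) : A (contract x f) = contract x (fun a => A (f a)) := by
  simp [contract]

theorem sum_contract {ι : Type*} (s : Finset ι) (x : ι → Fin 4 → ℝ) (f : Fin 4 → E) :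
    contract (∑ i ∈ s, x i) f = ∑ i ∈ s, contract (x i) f := by
  simp only [contract, Finset.sum_apply, Finset.sum_smul]
  exact Finset.sum_comm

theorem contract_sum {ι : Type*} (s : Finset ι) (x : Fin 4 → ℝ) (f : ι → Fin 4 → E) :
    contract x (∑ i ∈ s, f i) = ∑ i ∈ s, contract x (f i) := by
  simp only [contract, Finset.sum_apply, Finset.smul_sum]
  exact Finset.sum_comm

theorem contract_contract (x : Fin 4 → ℝ) (y : Fin 4 → Fin 4 → ℝ) (f : Fin 4 → E) :
    contract (contract x y) f = contract x (fun i => contract (y i) f) := by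
  change contract (∑ i, x i • y i) f = _
  rw [sum_contract]
  simp only [smul_contract]
  rfl

theorem contract_comm (x y : Fin 4 → ℝ) (f : Fin 4 → Fin 4 → E) :
    contract y (contract x f) = contract x (fun a => contract y (f a)) := by
  simp only [contract, Finset.sum_apply, Finset.smul_sum, Pi.smul_apply]
  rw [Finset.sum_comm]
  exact Finset.sum_congr rfl fun a _ => Finset.sum_congr rfl fun b _ => smul_comm _ _ _

/-- The sum over an orthogonal frame of squared length `μ` is `μ` times a trace. -/
theorem sum_contract_contract {O : Fin 4 → Fin 4 → ℝ} {μ : ℝ}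
    (hO : ∀ a b, ∑ k, O k a * O k b = if a = b then μ else 0) (f : Fin 4 → Fin 4 → E) :
    ∑ k, contract (O k) (contract (O k) f) = μ • ∑ a, f a a := by
  have h : ∀ k, contract (O k) (contract (O k) f) = ∑ b, ∑ a, (O k b * O k a) • f a b := by
    intro k
    simp [contract, Finset.smul_sum, smul_smul]
  simp only [h]
  rw [Finset.sum_comm, Finset.smul_sum]
  refine Finset.sum_congr rfl fun b _ => ?_
  rw [Finset.sum_comm]
  simp only [← Finset.sum_smul, hO]
  simp

/-- The action of the matrix `G` on the first slot of a tensor, plus the action `A` on the other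
slots. -/
def slotAction (G : Fin 4 → Fin 4 → ℝ) (A : E →ₗ[ℝ] E) : (Fin 4 → E) →ₗ[ℝ] (Fin 4 → E) where
  toFun f i := contract (G i) f + A (f i)
  map_add' f g := by
    funext i
    simp only [contract_add, Pi.add_apply, map_add]
    abel
  map_smul' r f := by
    funext i
    simp only [contract_smul, Pi.smul_apply, map_smul, RingHom.id_apply, smul_add]

theorem slotAction_apply (G : Fin 4 → Fin 4 → ℝ) (A : E →ₗ[ℝ] E) (f : Fin 4 → E) (i : Fin 4) :
    slotAction G A f i = contract (G i) f + A (f i) := rfl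

theorem contract_slotAction (G : Fin 4 → Fin 4 → ℝ) (A : E →ₗ[ℝ] E) (x : Fin 4 → ℝ)
    (f : Fin 4 → E) :
    contract x (slotAction G A f) = contract (contract x G) f + A (contract x f) := by
  have : slotAction G A f = (fun i => contract (G i) f) + fun i => A (f i) := rfl
  rw [this, contract_add, contract_contract, map_contract]

end contract

/-- The matrix `G` acting on all slots of a tensor of rank `2`. -/
def act2 (G : Fin 4 → Fin 4 → ℝ) : (Fin 4 → Fin 4 → ℝ) →ₗ[ℝ] (Fin 4 → Fin 4 → ℝ) :=
  slotAction G (slotAction G 0)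

/-- The matrix `G` acting on all slots of a tensor of rank `3`. -/
def act3 (G : Fin 4 → Fin 4 → ℝ) :
    (Fin 4 → Fin 4 → Fin 4 → ℝ) →ₗ[ℝ] (Fin 4 → Fin 4 → Fin 4 → ℝ) :=
  slotAction G (act2 G)

/-- The matrix `G` acting on all slots of a tensor of rank `4`. -/
def act4 (G : Fin 4 → Fin 4 → ℝ) :
    (Fin 4 → Fin 4 → Fin 4 → Fin 4 → ℝ) →ₗ[ℝ] (Fin 4 → Fin 4 → Fin 4 → Fin 4 → ℝ) :=
  slotAction G (act3 G)

theorem act2_apply (G : Fin 4 → Fin 4 → ℝ) (T : Fin 4 → Fin 4 → ℝ) (i j : Fin 4) :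
    act2 G T i j = contract (G i) (fun m => T m j) + contract (G j) (fun m => T i m) := by
  simp only [act2, slotAction_apply, LinearMap.zero_apply, contract_apply, Pi.add_apply, add_zero]

theorem act3_apply (G : Fin 4 → Fin 4 → ℝ) (T : Fin 4 → Fin 4 → Fin 4 → ℝ) (i j k : Fin 4) :
    act3 G T i j k = contract (G i) (fun m => T m j k) + contract (G j) (fun m => T i m k)
      + contract (G k) (fun m => T i j m) := by
  simp only [act3, slotAction_apply, act2_apply, contract_apply, Pi.add_apply, add_assoc]

theorem act4_apply (G : Fin 4 → Fin 4 → ℝ) (T : Fin 4 → Fin 4 → Fin 4 → Fin 4 → ℝ)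
    (i j k l : Fin 4) :
    act4 G T i j k l = contract (G i) (fun m => T m j k l) + contract (G j) (fun m => T i m k l)
      + contract (G k) (fun m => T i j m l) + contract (G l) (fun m => T i j k m) := by
  simp only [act4, slotAction_apply, act3_apply, contract_apply, Pi.add_apply, add_assoc]

theorem slotAction_add {E : Type*} [AddCommGroup E] [Module ℝ E] (G G' : Fin 4 → Fin 4 → ℝ)
    (A A' : E →ₗ[ℝ] E) : slotAction (G + G') (A + A') = slotAction G A + slotAction G' A' := by
  refine LinearMap.ext fun f => funext fun i => ?_
  simp only [slotAction_apply, LinearMap.add_apply, Pi.add_apply, add_contract]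
  abel

theorem slotAction_smul {E : Type*} [AddCommGroup E] [Module ℝ E] (r : ℝ)
    (G : Fin 4 → Fin 4 → ℝ) (A : E →ₗ[ℝ] E) :
    slotAction (r • G) (r • A) = r • slotAction G A := by
  refine LinearMap.ext fun f => funext fun i => ?_
  simp only [slotAction_apply, LinearMap.smul_apply, Pi.smul_apply, smul_contract, smul_add]

/-- Contraction commutes with passing from a matrix to its action on tensors. -/
theorem contract_act {E : Type*} [AddCommGroup E] [Module ℝ E]
    (A : (Fin 4 → Fin 4 → ℝ) → (E →ₗ[ℝ] E)) (hadd : ∀ G G', A (G + G') = A G + A G')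
    (hsmul : ∀ (r : ℝ) G, A (r • G) = r • A G) (x : Fin 4 → ℝ)
    (Γ : Fin 4 → Fin 4 → Fin 4 → ℝ) (f : E) :
    A (contract x Γ) f = contract x (fun k => A (Γ k) f) := by
  let L : (Fin 4 → Fin 4 → ℝ) →ₗ[ℝ] E :=
    { toFun := fun G => A G f
      map_add' := fun G G' => by rw [hadd]; rfl
      map_smul' := fun r G => by rw [hsmul]; rfl }
  exact map_contract L x Γ

theorem act2_add (G G' : Fin 4 → Fin 4 → ℝ) : act2 (G + G') = act2 G + act2 G' := by
  simp only [act2]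
  rw [← slotAction_add, ← slotAction_add, add_zero]

theorem act2_smul (r : ℝ) (G : Fin 4 → Fin 4 → ℝ) : act2 (r • G) = r • act2 G := by
  simp only [act2]
  rw [← slotAction_smul, ← slotAction_smul, smul_zero]

theorem act3_add (G G' : Fin 4 → Fin 4 → ℝ) : act3 (G + G') = act3 G + act3 G' := by
  simp only [act3, act2_add, slotAction_add]

theorem act3_smul (r : ℝ) (G : Fin 4 → Fin 4 → ℝ) : act3 (r • G) = r • act3 G := by
  simp only [act3, act2_smul, slotAction_smul]

theorem act4_add (G G' : Fin 4 → Fin 4 → ℝ) : act4 (G + G') = act4 G + act4 G' := by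
  simp only [act4, act3_add, slotAction_add]

theorem act4_smul (r : ℝ) (G : Fin 4 → Fin 4 → ℝ) : act4 (r • G) = r • act4 G := by
  simp only [act4, act3_smul, slotAction_smul]

section deriv

variable {X : Type*} [NormedAddCommGroup X] [NormedSpace ℝ X]
  {E : Type*} [NormedAddCommGroup E] [NormedSpace ℝ E]

theorem hasFDerivAt_contract {x : X → Fin 4 → ℝ} {f : X → Fin 4 → E} {p : X}
    (hx : DifferentiableAt ℝ x p) (hf : DifferentiableAt ℝ f p) :
    HasFDerivAt (fun q => contract (x q) (f q))
      (∑ a, (x p a • fderiv ℝ (fun q => f q a) p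
        + (fderiv ℝ (fun q => x q a) p).smulRight (f p a))) p := by
  refine HasFDerivAt.fun_sum fun a _ => ?_
  exact ((differentiableAt_pi.1 hx a).hasFDerivAt).smul ((differentiableAt_pi.1 hf a).hasFDerivAt)

theorem differentiableAt_contract {x : X → Fin 4 → ℝ} {f : X → Fin 4 → E} {p : X}
    (hx : DifferentiableAt ℝ x p) (hf : DifferentiableAt ℝ f p) :
    DifferentiableAt ℝ (fun q => contract (x q) (f q)) p :=
  (hasFDerivAt_contract hx hf).differentiableAt

theorem fderiv_contract {x : X → Fin 4 → ℝ} {f : X → Fin 4 → E} {p : X}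
    (hx : DifferentiableAt ℝ x p) (hf : DifferentiableAt ℝ f p) (w : X) :
    fderiv ℝ (fun q => contract (x q) (f q)) p w
      = contract (fderiv ℝ x p w) (f p) + contract (x p) (fderiv ℝ f p w) := by
  rw [(hasFDerivAt_contract hx hf).fderiv]
  have h1 : ∀ a, fderiv ℝ x p w a = fderiv ℝ (fun q => x q a) p w := by
    intro a
    rw [fderiv_pi fun i => differentiableAt_pi.1 hx i]
    rfl
  have h2 : ∀ a, fderiv ℝ f p w a = fderiv ℝ (fun q => f q a) p w := by
    intro a
    rw [fderiv_pi fun i => differentiableAt_pi.1 hf i]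
    rfl
  simp only [sum_apply, add_apply, smul_apply, ContinuousLinearMap.smulRight_apply, contract,
    h1, h2, Finset.sum_add_distrib]
  rw [add_comm]

/-- One step of the Leibniz rule for the components of a constant tensor in a moving frame `O`
whose derivative is `O_j ↦ ∑ m, Γ_jm O_m - O_j G`. -/
theorem fderiv_contract_frame {O : X → Fin 4 → Fin 4 → ℝ} {p w : X} {Γ G : Fin 4 → Fin 4 → ℝ}
    (hO : ∀ j, DifferentiableAt ℝ (fun q => O q j) p)
    (hD : ∀ j, fderiv ℝ (fun q => O q j) p w = contract (Γ j) (O p) - contract (O p j) G)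
    (A : E →ₗ[ℝ] E) {f : X → Fin 4 → E} (hf : DifferentiableAt ℝ f p) {Z : Fin 4 → E}
    (hZ : fderiv ℝ f p w = Z + slotAction G A (f p)) (j : Fin 4) :
    fderiv ℝ (fun q => contract (O q j) (f q)) p w
      = contract (Γ j) (fun m => contract (O p m) (f p)) + contract (O p j) Z
        + A (contract (O p j) (f p)) := by
  rw [fderiv_contract (hO j) hf, hD, hZ, sub_contract, contract_contract, contract_add,
    contract_slotAction]
  abel

variable {O : X → Fin 4 → Fin 4 → ℝ} {p w : X} {Γ G : Fin 4 → Fin 4 → ℝ}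

/-- If the components of a constant tensor `F` of rank `2` in a moving frame are constant, then
the connection matrices act compatibly. -/
theorem act2_eq (hO : ∀ j, DifferentiableAt ℝ (fun q => O q j) p)
    (hD : ∀ j, fderiv ℝ (fun q => O q j) p w = contract (Γ j) (O p) - contract (O p j) G)
    {T F : Fin 4 → Fin 4 → ℝ} (hT : ∀ q i j, T i j = contract (O q j) (contract (O q i) F))
    (i j : Fin 4) : act2 Γ T i j = contract (O p j) (contract (O p i) (act2 G F)) := by
  have d1 : ∀ i, DifferentiableAt ℝ (fun q => contract (O q i) F) p := fun i =>
    differentiableAt_contract (hO i) (differentiableAt_const F)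
  have s1 := fun i => fderiv_contract_frame hO hD (slotAction G 0) (differentiableAt_const F)
    (Z := -act2 G F) (by simp [act2]) i
  have s2 := fderiv_contract_frame hO hD 0 (d1 i) (s1 i) j
  have h0 : fderiv ℝ (fun q => contract (O q j) (contract (O q i) F)) p w = 0 := by
    simp only [← hT]; simp
  rw [h0] at s2
  simp only [contract_add, contract_neg, LinearMap.zero_apply, ← hT] at s2
  rw [contract_comm (Γ i) (O p j)] at s2
  simp only [← hT] at s2
  rw [act2_apply]
  linarith

/-- The analogue of `act2_eq` in rank `3`. -/
theorem act3_eq (hO : ∀ j, DifferentiableAt ℝ (fun q => O q j) p)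
    (hD : ∀ j, fderiv ℝ (fun q => O q j) p w = contract (Γ j) (O p) - contract (O p j) G)
    {T F : Fin 4 → Fin 4 → Fin 4 → ℝ}
    (hT : ∀ q i j k, T i j k = contract (O q k) (contract (O q j) (contract (O q i) F)))
    (i j k : Fin 4) :
    act3 Γ T i j k = contract (O p k) (contract (O p j) (contract (O p i) (act3 G F))) := by
  have d1 : ∀ i, DifferentiableAt ℝ (fun q => contract (O q i) F) p := fun i =>
    differentiableAt_contract (hO i) (differentiableAt_const F)
  have d2 : ∀ i j, DifferentiableAt ℝ (fun q => contract (O q j) (contract (O q i) F)) p :=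
    fun i j => differentiableAt_contract (hO j) (d1 i)
  have s1 := fun i => fderiv_contract_frame hO hD (act2 G) (differentiableAt_const F)
    (Z := -act3 G F) (by simp [act3]) i
  have s2 := fun j => fderiv_contract_frame hO hD (slotAction G 0) (d1 i) (s1 i) j
  have s3 := fderiv_contract_frame hO hD 0 (d2 i j) (s2 j) k
  have h0 : fderiv ℝ (fun q => contract (O q k) (contract (O q j) (contract (O q i) F))) p w
      = 0 := by
    simp only [← hT]; simp
  rw [h0] at s3
  simp only [contract_add, contract_neg, LinearMap.zero_apply, contract_comm (Γ _) (O p _),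
    ← hT] at s3
  rw [act3_apply]
  linarith

/-- The analogue of `act2_eq` in rank `4`. -/
theorem act4_eq (hO : ∀ j, DifferentiableAt ℝ (fun q => O q j) p)
    (hD : ∀ j, fderiv ℝ (fun q => O q j) p w = contract (Γ j) (O p) - contract (O p j) G)
    {T F : Fin 4 → Fin 4 → Fin 4 → Fin 4 → ℝ}
    (hT : ∀ q i j k l, T i j k l
      = contract (O q l) (contract (O q k) (contract (O q j) (contract (O q i) F))))
    (i j k l : Fin 4) : act4 Γ T i j k l
      = contract (O p l) (contract (O p k) (contract (O p j) (contract (O p i) (act4 G F)))) := by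
  have d1 : ∀ i, DifferentiableAt ℝ (fun q => contract (O q i) F) p := fun i =>
    differentiableAt_contract (hO i) (differentiableAt_const F)
  have d2 : ∀ i j, DifferentiableAt ℝ (fun q => contract (O q j) (contract (O q i) F)) p :=
    fun i j => differentiableAt_contract (hO j) (d1 i)
  have d3 : ∀ i j k, DifferentiableAt ℝ
      (fun q => contract (O q k) (contract (O q j) (contract (O q i) F))) p :=
    fun i j k => differentiableAt_contract (hO k) (d2 i j)
  have s1 := fun i => fderiv_contract_frame hO hD (act3 G) (differentiableAt_const F)
    (Z := -act4 G F) (by simp [act4]) i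
  have s2 := fun j => fderiv_contract_frame hO hD (act2 G) (d1 i) (s1 i) j
  have s3 := fun k => fderiv_contract_frame hO hD (slotAction G 0) (d2 i j) (s2 j) k
  have s4 := fderiv_contract_frame hO hD 0 (d3 i j k) (s3 k) l
  have h0 : fderiv ℝ
      (fun q => contract (O q l) (contract (O q k) (contract (O q j) (contract (O q i) F)))) p w
      = 0 := by
    simp only [← hT]; simp
  rw [h0] at s4
  simp only [contract_add, contract_neg, LinearMap.zero_apply, contract_comm (Γ _) (O p _),
    ← hT] at s4
  rw [act4_apply]
  linarith

end deriv

end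

noncomputable section

/-! ### Curvature and homotheties -/

/-- If the rows of a matrix are orthogonal of squared length `μ`, so are its columns. -/
theorem sum_mul_of_sum_mul {O : Fin 4 → Fin 4 → ℝ} {μ : ℝ} (hμ : 0 < μ)
    (h : ∀ i k, ∑ j, O i j * O k j = if i = k then μ else 0) (a b : Fin 4) :
    ∑ k, O k a * O k b = if a = b then μ else 0 := by
  have h1 : Matrix.of O * (μ⁻¹ • (Matrix.of O).transpose) = 1 := by
    ext i k
    have := h i k
    rw [Matrix.mul_smul, Matrix.smul_apply, Matrix.mul_apply]
    simp only [Matrix.of_apply, Matrix.transpose_apply, this, Matrix.one_apply, smul_eq_mul]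
    split_ifs
    · exact inv_mul_cancel₀ hμ.ne'
    · simp
  have h2 := mul_eq_one_comm.1 h1
  have h3 := congrFun (congrFun h2 a) b
  rw [Matrix.smul_mul, Matrix.smul_apply, Matrix.mul_apply] at h3
  simp only [Matrix.of_apply, Matrix.transpose_apply, Matrix.one_apply, smul_eq_mul] at h3
  split_ifs at h3 ⊢ with hab
  · field_simp at h3
    linarith
  · exact (mul_eq_zero.1 h3).resolve_left (inv_ne_zero hμ.ne')

/-- The Koszul formula in a moving frame: a family of matrices `A i` that is skew in the frame `O`
and solves the structure equation is the difference of the two Levi-Civita connections. -/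
theorem eq_of_structure {O : Fin 4 → Fin 4 → ℝ} {μ : ℝ} {A c c' Γ Γ' : Fin 4 → Fin 4 → Fin 4 → ℝ}
    (hμ : 0 < μ) (hrow : ∀ i k, ∑ j, O i j * O k j = if i = k then μ else 0)
    (hcol : ∀ a b, ∑ k, O k a * O k b = if a = b then μ else 0)
    (hskew : ∀ i j k, ∑ l, A i j l * O k l + ∑ l, A i k l * O j l = 0)
    (hΓ : ∀ i j k, Γ i j k = (c i j k - c j k i + c k i j) / 2)
    (hΓ' : ∀ i j k, Γ' i j k = (c' i j k - c' j k i + c' k i j) / 2)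
    (hstr : ∀ i j l, A i j l - A j i l + ∑ a, ∑ b, O i a * O j b * c' a b l
      = ∑ k, c i j k * O k l) (i j : Fin 4) :
    A i j = contract (Γ i j) O - contract (O j) (contract (O i) Γ') := by
  let C : Fin 4 → Fin 4 → Fin 4 → ℝ := fun i j k => ∑ a, ∑ b, ∑ l, O i a * O j b * O k l * c' a b l
  let B : Fin 4 → Fin 4 → Fin 4 → ℝ := fun i j k => ∑ l, A i j l * O k l
  have hB : ∀ i j k, B i j k + B i k j = 0 := hskew
  have hBC : ∀ i j k, B i j k - B j i k + C i j k = μ * c i j k := by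
    intro i j k
    have h1 : μ * c i j k = ∑ l, (∑ m, c i j m * O m l) * O k l := by
      simp only [Finset.sum_mul, mul_assoc]
      rw [Finset.sum_comm]
      simp only [← Finset.mul_sum, hrow]
      simp [mul_comm]
    have h2 : C i j k = ∑ l, (∑ a, ∑ b, O i a * O j b * c' a b l) * O k l := by
      simp only [C, Finset.sum_mul]
      conv_rhs => rw [Finset.sum_comm]
      refine Finset.sum_congr rfl fun a _ => ?_
      conv_rhs => rw [Finset.sum_comm]
      exact Finset.sum_congr rfl fun b _ => Finset.sum_congr rfl fun l _ => by ring
    rw [h1, h2]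
    simp only [← hstr, add_mul, sub_mul, Finset.sum_add_distrib, Finset.sum_sub_distrib, B]
  have hBΓ : ∀ i j k, B i j k = μ * Γ i j k - (C i j k - C j k i + C k i j) / 2 := by
    intro i j k
    rw [hΓ]
    linarith [hBC i j k, hBC j k i, hBC k i j, hB i j k, hB j k i, hB k i j]
  have hC : ∀ i j k, (C i j k - C j k i + C k i j) / 2
      = ∑ m, contract (O j) (contract (O i) Γ') m * O k m := by
    intro i j k
    simp only [C, contract, Fin.sum_univ_four, Pi.add_apply, Pi.smul_apply, smul_eq_mul, hΓ']
    ring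
  have hinv : ∀ (X : Fin 4 → ℝ) l, ∑ k, (∑ m, X m * O k m) * O k l = μ * X l := by
    intro X l
    simp only [Finset.sum_mul, mul_assoc]
    rw [Finset.sum_comm]
    simp only [← Finset.mul_sum, hcol]
    simp [mul_comm]
  funext l
  apply mul_left_cancel₀ hμ.ne'
  rw [← hinv (A i j) l]
  change ∑ k, B i j k * O k l = _
  simp only [hBΓ, hC, sub_mul, Finset.sum_sub_distrib, hinv, Pi.sub_apply, mul_sub]
  congr 1
  simp [contract, Finset.mul_sum, mul_assoc]

namespace LeftInvMetric

open SemiHeis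

variable {D D' : LieDerivation ℝ Heis Heis} {M : LeftInvMetric D} {M' : LeftInvMetric D'}
  {φ : SemiHeis D → SemiHeis D'} {μ : ℝ}

/-- The differential of a homothety intertwines the Levi-Civita connections. -/
theorem fderiv_diffMatrix (hφ : ContDiff ℝ ∞ φ) (hμ : 0 < μ)
    (h : ∀ p u v, M'.metricAt (φ p) (fderiv ℝ φ p u) (fderiv ℝ φ p v) = μ * M.metricAt p u v)
    (p : SemiHeis D) (i j : Fin 4) :
    fderiv ℝ (fun q => diffMatrix M M' φ q j) p (leftLin p (M.frame i))
      = contract (M.conn i j) (diffMatrix M M' φ p)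
        - contract (diffMatrix M M' φ p j) (contract (diffMatrix M M' φ p i) M'.conn) := by
  have hO : ∀ i j, Differentiable ℝ fun q => diffMatrix M M' φ q i j := fun i j =>
    (contDiff_diffMatrix hφ i j).differentiable (by simp)
  have hrow := diffMatrix_mul h
  have hcol := sum_mul_of_sum_mul hμ (hrow p)
  have hstr := diffMatrix_structure (M := M) (M' := M') hφ p
  obtain ⟨A, hA⟩ : ∃ A : Fin 4 → Fin 4 → Fin 4 → ℝ, ∀ i j l,
      fderiv ℝ (fun q => diffMatrix M M' φ q j l) p (leftLin p (M.frame i)) = A i j l :=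
    ⟨_, fun _ _ _ => rfl⟩
  -- `∑ l, A i j l * O k l` is skew in `j, k`
  have hskew : ∀ i j k, ∑ l, A i j l * diffMatrix M M' φ p k l
      + ∑ l, A i k l * diffMatrix M M' φ p j l = 0 := by
    intro i j k
    have h1 : HasFDerivAt
        (fun q => ∑ l, diffMatrix M M' φ q j l * diffMatrix M M' φ q k l) _ p :=
      HasFDerivAt.fun_sum fun l _ => (hO j l p).hasFDerivAt.mul (hO k l p).hasFDerivAt
    simp only [hrow] at h1
    have h2 := congrArg (fun L => L (leftLin p (M.frame i)))
      (h1.unique (hasFDerivAt_const _ _))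
    simp only [sum_apply, add_apply, smul_apply, hA, smul_eq_mul, zero_apply,
      Finset.sum_add_distrib] at h2
    rw [← h2, add_comm]
    simp only [mul_comm]
  simp only [hA] at hstr
  have h1 : fderiv ℝ (fun q => diffMatrix M M' φ q j) p (leftLin p (M.frame i)) = A i j := by
    funext l
    rw [← hA, fderiv_pi fun l => (hO j l p)]
    rfl
  rw [h1]
  exact eq_of_structure hμ (hrow p) hcol hskew (fun _ _ _ => rfl) (fun _ _ _ => rfl) hstr i j

theorem differentiable_diffMatrix (hφ : ContDiff ℝ ∞ φ) (j : Fin 4) :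
    Differentiable ℝ fun q => diffMatrix M M' φ q j :=
  differentiable_pi.2 fun l => (contDiff_diffMatrix hφ j l).differentiable (by simp)

theorem riem_eq_contract (M : LeftInvMetric D) (i j l : Fin 4) : (fun k => M.riem i j k l)
    = contract (M.conn j l) (M.conn i) - contract (M.conn i l) (M.conn j)
      - contract (M.structConst i j) (fun m => M.conn m l) := by
  funext k
  simp [riem, contract, Finset.sum_sub_distrib]

theorem contract_riem (M : LeftInvMetric D) (x y z : Fin 4 → ℝ) :
    contract z (contract y (contract x (fun i j l k => M.riem i j k l)))
      = contract (contract z (contract y M.conn)) (contract x M.conn)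
        - contract (contract z (contract x M.conn)) (contract y M.conn)
        - contract z (contract (contract y (contract x M.structConst)) M.conn) := by
  have e : (fun i j l k => M.riem i j k l) = (fun i j l => contract (M.conn j l) (M.conn i))
      - (fun i j l => contract (M.conn i l) (M.conn j))
      - (fun i j l => contract (M.structConst i j) (fun m => M.conn m l)) := by
    funext i j l
    exact riem_eq_contract M i j l
  have p1 : contract z (contract y (contract x
      (fun i j l => contract (M.conn j l) (M.conn i))))
      = contract (contract z (contract y M.conn)) (contract x M.conn) := by
    have h1 : contract x (fun i j l => contract (M.conn j l) (M.conn i))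
        = fun j l => contract (M.conn j l) (contract x M.conn) := by
      funext j l
      rw [contract_apply, contract_apply, contract_comm]
    have h2 : contract y (fun j l => contract (M.conn j l) (contract x M.conn))
        = fun l => contract (contract y M.conn l) (contract x M.conn) := by
      funext l
      rw [contract_apply, contract_apply, contract_contract]
    rw [h1, h2, contract_contract]
  have p2 : contract z (contract y (contract x
      (fun i j l => contract (M.conn i l) (M.conn j))))
      = contract (contract z (contract x M.conn)) (contract y M.conn) := by
    have h1 : contract x (fun i j l => contract (M.conn i l) (M.conn j))
        = fun j l => contract (contract x M.conn l) (M.conn j) := by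
      funext j l
      rw [contract_apply, contract_apply, contract_apply, contract_contract]
    have h2 : contract y (fun j l => contract (contract x M.conn l) (M.conn j))
        = fun l => contract (contract x M.conn l) (contract y M.conn) := by
      funext l
      rw [contract_apply, contract_comm]
    rw [h1, h2, contract_contract]
  have p3 : contract z (contract y (contract x
      (fun i j l => contract (M.structConst i j) (fun m => M.conn m l))))
      = contract z (contract (contract y (contract x M.structConst)) M.conn) := by
    congr 1
    funext l
    simp only [contract_apply, contract_contract]
  rw [e]
  simp only [contract_sub]
  rw [p1, p2, p3]

/-- The algebra of the proof of `riem_eq`: `h4` is the commutator of two derivatives of the row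
`O l`, evaluated with the connection equation, and `h5` is the structure equation, in which `x` and
`y` stand for the derivatives of the rows `O j` and `O i`. -/
theorem riem_eq_of_commutator {O : Fin 4 → Fin 4 → ℝ} {i j l : Fin 4} {x y : Fin 4 → ℝ}
    (hrow : ∀ i k, ∑ j, O i j * O k j = if i = k then μ else 0)
    (h4 : (contract (M.conn j l) fun m =>
          contract (M.conn i m) O - contract (O m) (contract (O i) M'.conn)) -
        (contract (contract (M.conn i l) O - contract (O l) (contract (O i) M'.conn))
            (contract (O j) M'.conn) + contract (O l) (contract x M'.conn)) -
      ((contract (M.conn i l) fun m =>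
          contract (M.conn j m) O - contract (O m) (contract (O j) M'.conn)) -
        (contract (contract (M.conn j l) O - contract (O l) (contract (O j) M'.conn))
            (contract (O i) M'.conn) + contract (O l) (contract y M'.conn))) =
      contract (M.structConst i j) fun m =>
        contract (M.conn m l) O - contract (O l) (contract (O m) M'.conn))
    (h5 : contract (M.structConst i j) O
      = x - y + contract (O j) (contract (O i) M'.structConst)) (k : Fin 4) :
    μ * M.riem i j k l
      = contract (O l) (contract (O k) (contract (O j) (contract (O i) M'.riem))) := by
  have h6 : contract (fun m => M.riem i j m l) O
      = contract (contract (O l) (contract (O j) M'.conn)) (contract (O i) M'.conn)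
        - contract (contract (O l) (contract (O i) M'.conn)) (contract (O j) M'.conn)
        - contract (O l) (contract (contract (O j) (contract (O i) M'.structConst)) M'.conn) := by
    have hc : contract (M.structConst i j) (fun m => contract (O l) (contract (O m) M'.conn))
        = contract (O l) (contract (x - y + contract (O j) (contract (O i) M'.structConst))
          M'.conn) := by
      rw [← h5, contract_contract, contract_comm]
    rw [riem_eq_contract, sub_contract, sub_contract, contract_contract, contract_contract,
      contract_contract]
    have hs : ∀ (x : Fin 4 → ℝ) (f g : Fin 4 → Fin 4 → ℝ),
        contract x (fun m => f m - g m) = contract x f - contract x g := fun x f g =>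
      contract_sub x f g
    rw [hs, hs, hs, hc, ← contract_contract (M.conn j l) O, ← contract_contract (M.conn i l) O,
      sub_contract, sub_contract, add_contract, sub_contract, contract_add, contract_sub] at h4
    have h7 := sub_eq_zero.2 h4
    rw [← sub_eq_zero, ← h7]
    abel
  have h7 : μ * M.riem i j k l = contract (O k) (contract (fun m => M.riem i j m l) O) := by
    simp only [contract, Finset.sum_apply, Pi.smul_apply, smul_eq_mul, Finset.mul_sum]
    rw [Finset.sum_comm]
    have : ∀ a, ∑ b, O k b * (M.riem i j a l * O a b)
        = M.riem i j a l * ∑ b, O k b * O a b := by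
      intro a
      rw [Finset.mul_sum]
      exact Finset.sum_congr rfl fun b _ => by ring
    simp only [this, hrow]
    simp [mul_comm]
  have h8 : contract (O l) (contract (O j) (contract (O i) (fun i j l k => M'.riem i j k l)))
      = fun a => contract (O l) (contract (O j) (contract (O i) M'.riem) a) := by
    funext a
    rw [contract_apply]
    refine congrArg _ (funext fun b => ?_)
    simp only [contract_apply]
  rw [h7, h6, ← contract_riem, h8, contract_comm (O k) (O l)]

/-- The curvature tensors correspond under a homothety. -/
theorem riem_eq (hφ : ContDiff ℝ ∞ φ) (hμ : 0 < μ)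
    (h : ∀ p u v, M'.metricAt (φ p) (fderiv ℝ φ p u) (fderiv ℝ φ p v) = μ * M.metricAt p u v)
    (p : SemiHeis D) (i j k l : Fin 4) :
    μ * M.riem i j k l = contract (diffMatrix M M' φ p l) (contract (diffMatrix M M' φ p k)
      (contract (diffMatrix M M' φ p j) (contract (diffMatrix M M' φ p i) M'.riem))) := by
  have hrow := diffMatrix_mul h p
  have hd : ∀ j, Differentiable ℝ fun q => diffMatrix M M' φ q j := differentiable_diffMatrix hφ
  have hd' : Differentiable ℝ (diffMatrix M M' φ) := differentiable_pi.2 hd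
  have hD := fderiv_diffMatrix hφ hμ h
  have hstr : ∀ i j, contract (M.structConst i j) (diffMatrix M M' φ p)
      = fderiv ℝ (fun q => diffMatrix M M' φ q j) p (leftLin p (M.frame i))
        - fderiv ℝ (fun q => diffMatrix M M' φ q i) p (leftLin p (M.frame j))
        + contract (diffMatrix M M' φ p j) (contract (diffMatrix M M' φ p i) M'.structConst) := by
    intro i j
    funext l
    have hp : ∀ j w, fderiv ℝ (fun q => diffMatrix M M' φ q j) p w l
        = fderiv ℝ (fun q => diffMatrix M M' φ q j l) p w := by
      intro j w
      rw [fderiv_pi fun l => ((contDiff_diffMatrix hφ j l).differentiable (by simp) p)]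
      rfl
    simp only [Pi.add_apply, Pi.sub_apply, hp, contract_apply]
    have := diffMatrix_structure (M := M) (M' := M') hφ p i j l
    simp only [contract, smul_eq_mul]
    rw [← this]
    congr 1
    rw [Finset.sum_comm]
    refine Finset.sum_congr rfl fun b _ => ?_
    rw [Finset.mul_sum]
    exact Finset.sum_congr rfl fun a _ => by ring
  -- second derivatives of the rows of the differential
  have h2 : ∀ i j, fderiv ℝ (fun q => fderiv ℝ (fun r => diffMatrix M M' φ r l) q
        (leftLin q (M.frame j))) p (leftLin p (M.frame i))
      = contract (M.conn j l) (fun m => contract (M.conn i m) (diffMatrix M M' φ p)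
          - contract (diffMatrix M M' φ p m) (contract (diffMatrix M M' φ p i) M'.conn))
        - (contract (contract (M.conn i l) (diffMatrix M M' φ p)
            - contract (diffMatrix M M' φ p l) (contract (diffMatrix M M' φ p i) M'.conn))
              (contract (diffMatrix M M' φ p j) M'.conn)
          + contract (diffMatrix M M' φ p l) (contract
            (fderiv ℝ (fun q => diffMatrix M M' φ q j) p (leftLin p (M.frame i))) M'.conn)) := by
    intro i j
    have e0 : fderiv ℝ (diffMatrix M M' φ) p (leftLin p (M.frame i))
        = fun m => contract (M.conn i m) (diffMatrix M M' φ p)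
          - contract (diffMatrix M M' φ p m) (contract (diffMatrix M M' φ p i) M'.conn) := by
      funext m
      rw [← hD, fderiv_pi fun m => hd m p]
      rfl
    have d1 : DifferentiableAt ℝ (fun q => contract (diffMatrix M M' φ q j) M'.conn) p :=
      differentiableAt_contract (hd j p) (differentiableAt_const _)
    have e1 := fderiv_contract (differentiableAt_const (M.conn j l)) (hd' p)
      (leftLin p (M.frame i))
    have e2 := fderiv_contract (hd j p) (differentiableAt_const M'.conn) (leftLin p (M.frame i))
    have e3 := fderiv_contract (hd l p) d1 (leftLin p (M.frame i))
    simp only [hD _ j l]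
    rw [fderiv_fun_sub (differentiableAt_contract (differentiableAt_const (M.conn j l)) (hd' p))
      (differentiableAt_contract (hd l p) d1), sub_apply, e1, e3, e2, e0, hD p i l]
    have z1 : ∀ f : Fin 4 → Fin 4 → ℝ, contract 0 f = 0 := fun f => by simp [contract]
    simp only [fderiv_fun_const, Pi.zero_apply, zero_apply, z1, contract_zero, zero_add,
      add_zero]
  -- they differ by the bracket of the frame
  have h3 : ∀ f : SemiHeis D → Fin 4 → ℝ, ContDiff ℝ ∞ f →
      fderiv ℝ (fun q => fderiv ℝ f q (leftLin q (M.frame j))) p (leftLin p (M.frame i))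
        - fderiv ℝ (fun q => fderiv ℝ f q (leftLin q (M.frame i))) p (leftLin p (M.frame j))
        = contract (M.structConst i j) (fun m => fderiv ℝ f p (leftLin p (M.frame m))) := by
    intro f hf
    have hs : ∀ w : SemiHeis D, Differentiable ℝ fun q : SemiHeis D => leftLin q w := fun w =>
      (contDiff_leftLin contDiff_id contDiff_const).differentiable (by simp)
    have hf2 : Differentiable ℝ (fderiv ℝ f) :=
      (hf.fderiv_right (m := ∞) (by simp)).differentiable (by simp)
    have hk : ∀ j w, fderiv ℝ (fun q => fderiv ℝ f q (leftLin q (M.frame j))) p w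
        = fderiv ℝ f p (fderiv ℝ (fun q => leftLin q (M.frame j)) p w)
          + fderiv ℝ (fderiv ℝ f) p w (leftLin p (M.frame j)) := by
      intro j w
      rw [((hf2 p).hasFDerivAt.clm_apply (hs (M.frame j) p).hasFDerivAt).fderiv]
      rfl
    have hsymm := (hf.contDiffAt (x := p)).isSymmSndFDerivAt
      (by rw [minSmoothness_of_isRCLikeNormedField]; exact WithTop.coe_le_coe.2 le_top)
    rw [hk, hk, hsymm.eq, add_sub_add_right_eq_sub, ← map_sub, fderiv_leftLin_sub]
    conv_lhs => rw [← M.frame.sum_repr ⁅M.frame i, M.frame j⁆]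
    simp only [map_sum, map_smul]
    rfl
  have h4 := h3 (fun r => diffMatrix M M' φ r l)
    (contDiff_pi.2 fun m => contDiff_diffMatrix hφ l m)
  rw [h2, h2] at h4
  simp only [hD p _ l] at h4
  have h5 := hstr i j
  exact riem_eq_of_commutator hrow h4 h5 k

end LeftInvMetric
end

noncomputable section

/-! ### Criticality, energy and symmetry under homotheties -/

theorem sum_contract_mul_contract {O : Fin 4 → Fin 4 → ℝ} {μ : ℝ}
    (hO : ∀ a b, ∑ k, O k a * O k b = if a = b then μ else 0) (f g : Fin 4 → ℝ) :
    ∑ k, contract (O k) f * contract (O k) g = μ * ∑ a, f a * g a := by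
  have h := sum_contract_contract hO (fun a b => f a * g b)
  rw [smul_eq_mul] at h
  rw [← h]
  refine Finset.sum_congr rfl fun k _ => ?_
  simp only [contract, Finset.sum_apply, Pi.smul_apply, smul_eq_mul, Finset.sum_mul,
    Finset.mul_sum]
  exact Finset.sum_congr rfl fun a _ => Finset.sum_congr rfl fun b _ => by ring

theorem sum_sum_contract_mul {O : Fin 4 → Fin 4 → ℝ} {μ : ℝ}
    (hO : ∀ a b, ∑ k, O k a * O k b = if a = b then μ else 0) (f g : Fin 4 → Fin 4 → ℝ) :
    ∑ k, ∑ l, contract (O l) (contract (O k) f) * contract (O l) (contract (O k) g)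
      = μ ^ 2 * ∑ a, ∑ b, f a b * g a b := by
  simp only [sum_contract_mul_contract hO]
  rw [← Finset.mul_sum, Finset.sum_comm]
  simp only [contract_apply, sum_contract_mul_contract hO]
  rw [← Finset.mul_sum, ← mul_assoc, ← pow_two, Finset.sum_comm]

namespace LeftInvMetric

open SemiHeis

variable {D D' : LieDerivation ℝ Heis Heis}

section tensors

variable (M : LeftInvMetric D)

theorem covRic_eq_act (k : Fin 4) : M.covRic k = -act2 (M.conn k) M.ric := by
  funext i j
  simp only [covRic, Pi.neg_apply, act2_apply, contract, smul_eq_mul, Finset.sum_add_distrib]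

theorem covCovRic_eq_act (l : Fin 4) : M.covCovRic l = -act3 (M.conn l) M.covRic := by
  funext k i j
  simp only [covCovRic, Pi.neg_apply, act3_apply, contract, smul_eq_mul, Finset.sum_add_distrib]

theorem covRiem_eq_act (p : Fin 4) : M.covRiem p = -act4 (M.conn p) M.riem := by
  funext i j k l
  simp only [covRiem, Pi.neg_apply, act4_apply, contract, smul_eq_mul, Finset.sum_add_distrib]

theorem contract_covRic (x : Fin 4 → ℝ) :
    contract x M.covRic = -act2 (contract x M.conn) M.ric := by
  rw [contract_act act2 act2_add act2_smul, ← contract_neg]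
  exact congrArg _ (funext fun k => M.covRic_eq_act k)

theorem contract_covCovRic (x : Fin 4 → ℝ) :
    contract x M.covCovRic = -act3 (contract x M.conn) M.covRic := by
  rw [contract_act act3 act3_add act3_smul, ← contract_neg]
  exact congrArg _ (funext fun k => M.covCovRic_eq_act k)

theorem contract_covRiem (x : Fin 4 → ℝ) :
    contract x M.covRiem = -act4 (contract x M.conn) M.riem := by
  rw [contract_act act4 act4_add act4_smul, ← contract_neg]
  exact congrArg _ (funext fun k => M.covRiem_eq_act k)

end tensors

variable {M : LeftInvMetric D} {M' : LeftInvMetric D'}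
  {φ : SemiHeis D → SemiHeis D'} {μ : ℝ}
  (hφ : ContDiff ℝ ∞ φ) (hμ : 0 < μ)
  (h : ∀ p u v, M'.metricAt (φ p) (fderiv ℝ φ p u) (fderiv ℝ φ p v) = μ * M.metricAt p u v)

/-- The Ricci tensors correspond under a homothety. -/
theorem ric_homothety (hφ : ContDiff ℝ ∞ φ) (hμ : 0 < μ)
    (h : ∀ p u v, M'.metricAt (φ p) (fderiv ℝ φ p u) (fderiv ℝ φ p v) = μ * M.metricAt p u v)
    (p : SemiHeis D) (i j : Fin 4) :
    M.ric i j = contract (diffMatrix M M' φ p j) (contract (diffMatrix M M' φ p i) M'.ric) := by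
  have hcol := sum_mul_of_sum_mul hμ (diffMatrix_mul h p)
  apply mul_left_cancel₀ hμ.ne'
  simp only [ric, Finset.mul_sum, riem_eq hφ hμ h p]
  generalize diffMatrix M M' φ p = O at *
  have hc : ∀ k, contract (O k) (contract (O j) (contract (O k) (contract (O i) M'.riem)))
      = contract (O k) (contract (O k)
          (fun a => contract (O j) (contract (O i) M'.riem a))) := fun k => by
    rw [contract_comm (O k) (O j)]
  simp only [hc]
  rw [sum_contract_contract hcol, smul_eq_mul]
  congr 1
  have : M'.ric = ∑ a, fun i j => M'.riem i a j a := by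
    funext i j
    simp [ric]
  rw [this, contract_sum, contract_sum]
  refine Finset.sum_congr rfl fun a _ => ?_
  rw [contract_apply]
  refine congrArg _ (funext fun c => ?_)
  simp only [contract_apply]

include hφ hμ h

/-- The components of `ρ` in the frame transported by the homothety are constant, so `act2_eq`
applies; the other covariant derivatives are handled in the same way. -/
theorem covRic_homothety (p : SemiHeis D) (k i j : Fin 4) :
    M.covRic k i j = contract (diffMatrix M M' φ p j) (contract (diffMatrix M M' φ p i)
      (contract (diffMatrix M M' φ p k) M'.covRic)) := by
  rw [contract_covRic, contract_neg, contract_neg, covRic_eq_act, Pi.neg_apply, Pi.neg_apply,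
    act2_eq (fun j => differentiable_diffMatrix hφ j p)
      (fun j => fderiv_diffMatrix hφ hμ h p k j) (fun q i j => ric_homothety hφ hμ h q i j) i j]

theorem covCovRic_homothety (p : SemiHeis D) (l k i j : Fin 4) :
    M.covCovRic l k i j = contract (diffMatrix M M' φ p j) (contract (diffMatrix M M' φ p i)
      (contract (diffMatrix M M' φ p k) (contract (diffMatrix M M' φ p l) M'.covCovRic))) := by
  rw [contract_covCovRic, contract_neg, contract_neg, contract_neg, covCovRic_eq_act,
    Pi.neg_apply, Pi.neg_apply, Pi.neg_apply,
    act3_eq (fun j => differentiable_diffMatrix hφ j p)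
      (fun j => fderiv_diffMatrix hφ hμ h p l j)
      (fun q k i j => covRic_homothety hφ hμ h q k i j) k i j]

theorem covRiem_homothety (p : SemiHeis D) (q i j k l : Fin 4) :
    μ * M.covRiem q i j k l = contract (diffMatrix M M' φ p l) (contract (diffMatrix M M' φ p k)
      (contract (diffMatrix M M' φ p j) (contract (diffMatrix M M' φ p i)
        (contract (diffMatrix M M' φ p q) M'.covRiem)))) := by
  have := act4_eq (T := μ • M.riem) (fun j => differentiable_diffMatrix hφ j p)
      (fun j => fderiv_diffMatrix hφ hμ h p q j)
      (fun r i j k l => riem_eq hφ hμ h r i j k l) i j k l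
  rw [contract_covRiem, contract_neg, contract_neg, contract_neg, contract_neg, ← this, map_smul,
    covRiem_eq_act]
  simp

theorem lapRic_homothety (p : SemiHeis D) (i j : Fin 4) :
    M.lapRic i j = μ * contract (diffMatrix M M' φ p j)
      (contract (diffMatrix M M' φ p i) M'.lapRic) := by
  have hcol := sum_mul_of_sum_mul hμ (diffMatrix_mul h p)
  have : M'.lapRic = ∑ a, M'.covCovRic a a := by
    funext i j
    simp [lapRic]
  simp only [lapRic, covCovRic_homothety hφ hμ h p]
  rw [← contract_sum, ← contract_sum, sum_contract_contract hcol, contract_smul, contract_smul,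
    this, smul_eq_mul]

theorem riemRic_homothety (p : SemiHeis D) (i j : Fin 4) :
    M.riemRic i j = μ * contract (diffMatrix M M' φ p j)
      (contract (diffMatrix M M' φ p i) M'.riemRic) := by
  have hcol := sum_mul_of_sum_mul hμ (diffMatrix_mul h p)
  have e : M'.riemRic = ∑ a, ∑ b, M'.ric a b • fun i j => M'.riem i a j b := by
    funext i j
    simp [riemRic, mul_comm]
  apply mul_left_cancel₀ hμ.ne'
  simp only [riemRic, Finset.mul_sum, ← mul_assoc, riem_eq hφ hμ h p, ric_homothety hφ hμ h p]
  rw [e]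
  generalize diffMatrix M M' φ p = O at *
  have hc : ∀ k l, contract (O l) (contract (O j) (contract (O k) (contract (O i) M'.riem)))
      = contract (O l) (contract (O k)
          (fun a => contract (O j) (contract (O i) M'.riem a))) := fun k l => by
    rw [contract_comm (O k) (O j)]
  simp only [hc]
  rw [sum_sum_contract_mul hcol]
  simp only [contract_sum, contract_smul, smul_eq_mul]
  rw [pow_two]
  congr 1
  refine Finset.sum_congr rfl fun a _ => Finset.sum_congr rfl fun b _ => ?_
  rw [mul_comm, contract_apply]
  congr 2

theorem scal_homothety : M.scal = μ * M'.scal := by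
  have hcol := sum_mul_of_sum_mul hμ (diffMatrix_mul h 1)
  simp only [scal, ric_homothety hφ hμ h 1]
  rw [sum_contract_contract hcol, smul_eq_mul]

theorem energy_homothety (t : ℝ) : M.energy t = μ ^ 2 * M'.energy t := by
  have hcol := sum_mul_of_sum_mul hμ (diffMatrix_mul h 1)
  have : M.ricNormSq = μ ^ 2 * M'.ricNormSq := by
    simp only [ricNormSq, ric_homothety hφ hμ h 1, pow_two (contract _ _)]
    rw [sum_sum_contract_mul hcol]
    simp only [pow_two (M'.ric _ _)]
  rw [energy, energy, this, scal_homothety hφ hμ h]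
  ring

theorem gradF_homothety (p : SemiHeis D) (t : ℝ) (i j : Fin 4) :
    M.gradF t i j = μ * contract (diffMatrix M M' φ p j)
      (contract (diffMatrix M M' φ p i) (M'.gradF t)) := by
  have hrow := diffMatrix_mul h p
  let δ : Fin 4 → Fin 4 → ℝ := fun i j => if i = j then 1 else 0
  have e : M'.gradF t = -M'.lapRic + (1 / 2 * M'.energy t) • δ - (2 : ℝ) • M'.riemRic
      - (2 * t * M'.scal) • M'.ric := by
    funext i j
    simp [gradF, δ]
  have hδ : contract (diffMatrix M M' φ p j) (contract (diffMatrix M M' φ p i) δ)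
      = if i = j then μ else 0 := by
    rw [← hrow]
    simp [contract, δ, mul_comm]
  rw [e]
  simp only [contract_sub, contract_add, contract_neg, contract_smul, hδ, smul_eq_mul]
  rw [gradF, lapRic_homothety hφ hμ h p, riemRic_homothety hφ hμ h p, ← ric_homothety hφ hμ h p,
    scal_homothety hφ hμ h, energy_homothety hφ hμ h]
  split_ifs <;> ring

/-- If the differential of a homothety at the identity is a linear map `ψ` of the Lie algebras,
then `ψ` intertwines the Ricci operators up to scale. -/
theorem ricOp_homothety (h1 : φ 1 = 1) (ψ : SemiHeis D →ₗ[ℝ] SemiHeis D')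
    (hψ : ∀ u, fderiv ℝ φ 1 u = ψ u) (x : SemiHeis D) :
    ψ (M.ricOp x) = μ • M'.ricOp (ψ x) := by
  have hcol := sum_mul_of_sum_mul hμ (diffMatrix_mul h 1)
  have hf : ∀ i, ψ (M.frame i) = ∑ j, diffMatrix M M' φ 1 i j • M'.frame j := by
    intro i
    have := fderiv_frame (M := M) (M' := M') (φ := φ) 1 i
    simpa only [h1, leftLin_one, hψ] using this
  have key : ψ ∘ₗ M.ricOp = μ • (M'.ricOp ∘ₗ ψ) := by
    refine M.frame.ext fun i => ?_
    simp only [LinearMap.comp_apply, LinearMap.smul_apply, ricOp, Module.Basis.constr_basis,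
      map_sum, map_smul, hf]
    simp only [ric_homothety hφ hμ h 1]
    generalize diffMatrix M M' φ 1 = O at *
    have hX : ∀ (X : Fin 4 → ℝ) l, ∑ j, contract (O j) X * O j l = μ * X l := by
      intro X l
      simp only [contract, smul_eq_mul, Finset.sum_mul]
      rw [Finset.sum_comm]
      have : ∀ a, ∑ j, O j a * X a * O j l = X a * ∑ j, O j a * O j l := by
        intro a
        rw [Finset.mul_sum]
        exact Finset.sum_congr rfl fun j _ => by ring
      simp only [this, hcol]
      simp [mul_comm]
    have hY : ∀ l, ∑ a, O i a * M'.ric a l = contract (O i) M'.ric l := by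
      intro l
      simp [contract]
    simp only [Finset.smul_sum, smul_smul]
    rw [Finset.sum_comm]
    simp only [← Finset.sum_smul, hX]
    rw [Finset.sum_comm]
    simp only [← Finset.sum_smul, ← Finset.mul_sum, hY]
  exact congrArg (fun L => L x) key

end LeftInvMetric

namespace Homothetic

variable {D D' D'' : LieDerivation ℝ Heis Heis} {M : LeftInvMetric D} {M' : LeftInvMetric D'}
  {M'' : LeftInvMetric D''}

theorem isCritical (h : Homothetic M M') {t : ℝ} (hM : M'.IsCritical t) : M.IsCritical t := by
  obtain ⟨φ, μ, h1, -, hμ, h⟩ := h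
  have h0 : M'.gradF t = 0 := funext fun i => funext fun j => hM i j
  intro i j
  rw [LeftInvMetric.gradF_homothety h1 hμ h 1, h0, contract_zero]
  simp [contract]

theorem isSymmetric (h : Homothetic M M') (hM : M'.IsSymmetric) : M.IsSymmetric := by
  obtain ⟨φ, μ, h1, -, hμ, h⟩ := h
  have h0 : M'.covRiem = 0 := by
    funext p i j k l
    exact hM p i j k l
  intro p i j k l
  apply mul_left_cancel₀ hμ.ne'
  rw [LeftInvMetric.covRiem_homothety h1 hμ h 1, h0]
  simp only [contract_zero, mul_zero]

theorem exists_energy_eq (h : Homothetic M M') :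
    ∃ μ : ℝ, 0 < μ ∧ ∀ t, M.energy t = μ ^ 2 * M'.energy t := by
  obtain ⟨φ, μ, h1, -, hμ, h⟩ := h
  exact ⟨μ, hμ, LeftInvMetric.energy_homothety h1 hμ h⟩

/-- Homotheties preserve Einstein metrics. -/
theorem exists_ric_eq (h : Homothetic M M') {r : ℝ}
    (hM : ∀ i j, M'.ric i j = if i = j then r else 0) :
    ∃ r' : ℝ, ∀ i j, M.ric i j = if i = j then r' else 0 := by
  obtain ⟨φ, μ, h1, -, hμ, h⟩ := h
  refine ⟨μ * r, fun i j => ?_⟩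
  have h2 := LeftInvMetric.diffMatrix_mul h 1 i j
  rw [LeftInvMetric.ric_homothety h1 hμ h 1]
  have : M'.ric = fun i j => if i = j then r else 0 := funext fun i => funext fun j => hM i j
  rw [this]
  have h3 : ∀ x y : Fin 4 → ℝ, contract y (contract x (fun i j => if i = j then r else 0))
      = (∑ j, x j * y j) * r := by
    intro x y
    simp [contract, Finset.mul_sum, mul_comm, mul_left_comm]
  rw [h3, h2]
  split_ifs <;> simp

theorem trans (h : Homothetic M M') (h' : Homothetic M' M'') : Homothetic M M'' := by
  obtain ⟨φ, μ, h1, h2, hμ, h⟩ := h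
  obtain ⟨φ', μ', h1', h2', hμ', h'⟩ := h'
  refine ⟨φ.trans φ', μ' * μ, h1'.comp h1, h2.comp h2', mul_pos hμ' hμ, fun p u v => ?_⟩
  have : fderiv ℝ (φ.trans φ') p = (fderiv ℝ φ' (φ p)).comp (fderiv ℝ φ p) :=
    fderiv_comp (g := φ') p (h1'.differentiable (by simp) _) (h1.differentiable (by simp) _)
  rw [this]
  simp only [ContinuousLinearMap.comp_apply, Equiv.trans_apply, h', h]
  ring

theorem symm (h : Homothetic M M') : Homothetic M' M := by
  obtain ⟨φ, μ, h1, h2, hμ, h⟩ := h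
  refine ⟨φ.symm, μ⁻¹, h2, h1, inv_pos.2 hμ, fun p u v => ?_⟩
  have hc : ∀ u, fderiv ℝ φ (φ.symm p) (fderiv ℝ φ.symm p u) = u := by
    intro u
    have h3 : fderiv ℝ (φ ∘ φ.symm) p = (fderiv ℝ φ (φ.symm p)).comp (fderiv ℝ φ.symm p) :=
      fderiv_comp (g := φ) p (h1.differentiable (by simp) _) (h2.differentiable (by simp) _)
    have h4 : (φ ∘ φ.symm : SemiHeis D' → SemiHeis D') = id := by
      funext x
      simp
    rw [h4, fderiv_id] at h3
    exact (congrArg (fun L => L u) h3).symm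
  have := h (φ.symm p) (fderiv ℝ φ.symm p u) (fderiv ℝ φ.symm p v)
  rw [hc, hc, Equiv.apply_symm_apply] at this
  rw [this, inv_mul_cancel_left₀ hμ.ne']

end Homothetic
end

noncomputable section

/-! ### Integration of Lie algebra isomorphisms -/

open SemiHeis

/-- A map whose differential is, in the left trivializations, conformal with a constant
factor pulls the metric back to a constant multiple. -/
theorem metricAt_of_leftLin {D D' : LieDerivation ℝ Heis Heis} {M : LeftInvMetric D}
    {M' : LeftInvMetric D'} {φ : SemiHeis D → SemiHeis D'} {μ : ℝ}
    (Ψ : SemiHeis D → SemiHeis D → SemiHeis D')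
    (hd : ∀ p u, fderiv ℝ φ p (leftLin p u) = leftLin (φ p) (Ψ p u))
    (hΨ : ∀ p u v, M'.inner (Ψ p u) (Ψ p v) = μ * M.inner u v) :
    ∀ p u v, M'.metricAt (φ p) (fderiv ℝ φ p u) (fderiv ℝ φ p v) = μ * M.metricAt p u v := by
  intro p u v
  rw [← leftLin_leftLin_inv p u, ← leftLin_leftLin_inv p v, hd, hd,
    LeftInvMetric.metricAt_leftLin, LeftInvMetric.metricAt_leftLin, hΨ]

namespace Heis

variable (D : LieDerivation ℝ Heis Heis) (r : ℝ) (w : Heis)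

/-- The primitive `∫₀ˢ exp (u r D) w du`. -/
def orbitInt (s : ℝ) : Heis := ∫ u in (0 : ℝ)..s, flow D (r * u) w

theorem continuous_flow_mul : Continuous fun u : ℝ => flow D (r * u) w :=
  ((contDiff_flow D).continuous.comp (continuous_const.mul continuous_id)).clm_apply
    continuous_const

theorem hasDerivAt_orbitInt (s : ℝ) : HasDerivAt (orbitInt D r w) (flow D (r * s) w) s :=
  intervalIntegral.integral_hasDerivAt_right
    ((continuous_flow_mul D r w).intervalIntegrable _ _)
    ((continuous_flow_mul D r w).stronglyMeasurableAtFilter _ _)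
    (continuous_flow_mul D r w).continuousAt

theorem lie_eq_smul (v w : Heis) :
    ⁅v, w⁆ = (v.coord 0 * w.coord 1 - v.coord 1 * w.coord 0) • mk 0 0 1 := by
  ext <;> simp [bracket_def]

theorem continuous_coord (i : Fin 3) : Continuous fun v : Heis => v.coord i :=
  continuous_apply i

/-- The area form `[v, w] = ω(v, w) e₃` along the curve `orbitInt` and its velocity. -/
def orbitArea (s : ℝ) : ℝ := (orbitInt D r w s).coord 0 * (flow D (r * s) w).coord 1
  - (orbitInt D r w s).coord 1 * (flow D (r * s) w).coord 0

theorem continuous_orbitArea : Continuous (orbitArea D r w) := by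
  have h : Continuous (orbitInt D r w) :=
    continuous_iff_continuousAt.2 fun s => (hasDerivAt_orbitInt D r w s).continuousAt
  have h' := continuous_flow_mul D r w
  exact (((continuous_coord 0).comp h).mul ((continuous_coord 1).comp h')).sub
    (((continuous_coord 1).comp h).mul ((continuous_coord 0).comp h'))

/-- The Heisenberg component of the one-parameter group of `ℝ ⋉ H³` with initial velocity
`(w, r)`. -/
def orbit (s : ℝ) : Heis := orbitInt D r w s
  + (1 / 2 * ∫ u in (0 : ℝ)..s, orbitArea D r w u) • mk 0 0 1

theorem lie_orbit (s : ℝ) (v : Heis) : ⁅v, orbit D r w s⁆ = ⁅v, orbitInt D r w s⁆ := by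
  ext <;> simp [bracket_def, orbit]

theorem orbit_lie (s : ℝ) (v : Heis) : ⁅orbit D r w s, v⁆ = ⁅orbitInt D r w s, v⁆ := by
  rw [← lie_skew, lie_orbit, lie_skew]

theorem orbit_zero : orbit D r w 0 = 0 := by
  simp [orbit, orbitInt]

theorem hasDerivAt_orbit (s : ℝ) : HasDerivAt (orbit D r w)
    (flow D (r * s) w + (1 / 2 : ℝ) • ⁅orbit D r w s, flow D (r * s) w⁆) s := by
  rw [orbit_lie, lie_eq_smul, smul_smul]
  exact (hasDerivAt_orbitInt D r w s).add (((intervalIntegral.integral_hasDerivAt_right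
    ((continuous_orbitArea D r w).intervalIntegrable _ _)
    ((continuous_orbitArea D r w).stronglyMeasurableAtFilter _ _)
    (continuous_orbitArea D r w).continuousAt).const_mul (1 / 2 : ℝ)).smul_const _)

theorem contDiff_flow_mul : ContDiff ℝ ∞ fun s : ℝ => flow D (r * s) w :=
  ((contDiff_flow D).comp (contDiff_const.mul contDiff_id)).clm_apply contDiff_const

theorem contDiff_orbitInt : ContDiff ℝ ∞ (orbitInt D r w) := by
  refine contDiff_infty_iff_deriv.2
    ⟨fun s => (hasDerivAt_orbitInt D r w s).differentiableAt, ?_⟩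
  rw [funext fun s => (hasDerivAt_orbitInt D r w s).deriv]
  exact contDiff_flow_mul D r w

theorem contDiff_orbit : ContDiff ℝ ∞ (orbit D r w) := by
  refine contDiff_infty_iff_deriv.2 ⟨fun s => (hasDerivAt_orbit D r w s).differentiableAt, ?_⟩
  rw [funext fun s => (hasDerivAt_orbit D r w s).deriv]
  have h : ContDiff ℝ ∞ fun s => ⁅orbitInt D r w s, flow D (r * s) w⁆ :=
    contDiff_lie (contDiff_orbitInt D r w) (contDiff_flow_mul D r w)
  simp only [orbit_lie]
  exact (contDiff_flow_mul D r w).add (h.const_smul (1 / 2 : ℝ))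

/-- If `A` intertwines the derivation `D'` with `r D + [w, ·]`, it intertwines the flows up to
conjugation with `orbit D r w`. -/
theorem map_flow (D' : LieDerivation ℝ Heis Heis) (A : Heis ≃ₗ[ℝ] Heis)
    (hD : ∀ u, A (D' u) = r • D (A u) + ⁅w, A u⁆) (s : ℝ) (u : Heis) :
    A (flow D' s u) = flow D (r * s) (A u) + ⁅orbit D r w s, flow D (r * s) (A u)⁆ := by
  -- integrate `(exp (s r D) w)' = r D (exp (s r D) w)`
  have hb : ∀ s, flow D (r * s) w = r • D (orbitInt D r w s) + w := by
    have hd : ∀ s, HasDerivAt (fun s => flow D (r * s) w - r • D (orbitInt D r w s)) 0 s := by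
      intro s
      have h1 : HasDerivAt (fun s => flow D (r * s) w) (r • D (flow D (r * s) w)) s :=
        (hasDerivAt_flow D w (r * s)).scomp s
          (((hasDerivAt_id s).const_mul r).congr_deriv (mul_one r))
      have h2 : HasDerivAt (fun s => D (orbitInt D r w s)) (D (flow D (r * s) w)) s :=
        (derCLM D).hasFDerivAt.comp_hasDerivAt s (hasDerivAt_orbitInt D r w s)
      exact (h1.sub (h2.const_smul r)).congr_deriv (sub_self _)
    intro s
    have := is_const_of_deriv_eq_zero (fun s => (hd s).differentiableAt)
      (fun s => (hd s).deriv) s 0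
    simp only [orbitInt, intervalIntegral.integral_same, mul_zero, flow_zero, map_zero, smul_zero,
      sub_zero] at this
    exact sub_eq_iff_eq_add'.1 this
  let Ac : Heis ≃L[ℝ] Heis := A.toContinuousLinearEquiv
  have hF : ∀ s, HasDerivAt (fun s => flow D (r * s) (A u)) (r • D (flow D (r * s) (A u))) s := by
    intro s
    exact (hasDerivAt_flow D (A u) (r * s)).scomp s (((hasDerivAt_id s).const_mul r).congr_deriv
      (mul_one r))
  have hg : ∀ s, HasDerivAt (fun s => Ac.symm (flow D (r * s) (A u)
      + ⁅orbitInt D r w s, flow D (r * s) (A u)⁆)) (D' (Ac.symm (flow D (r * s) (A u)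
      + ⁅orbitInt D r w s, flow D (r * s) (A u)⁆))) s := by
    intro s
    have h1 : HasDerivAt (fun s => ⁅orbitInt D r w s, flow D (r * s) (A u)⁆)
        (⁅orbitInt D r w s, r • D (flow D (r * s) (A u))⁆
          + ⁅flow D (r * s) w, flow D (r * s) (A u)⁆) s := by
      have := (isBoundedBilinearMap_lie.hasFDerivAt
        (orbitInt D r w s, flow D (r * s) (A u))).comp_hasDerivAt s
        ((hasDerivAt_orbitInt D r w s).prodMk (hF s))
      exact this
    refine (Ac.symm.hasFDerivAt.comp_hasDerivAt s ((hF s).add h1)).congr_deriv ?_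
    apply A.injective
    have hA : ∀ x, A (Ac.symm x) = x := A.apply_symm_apply
    rw [hD]
    change A (Ac.symm _) = _
    rw [hA, hA, hb]
    simp only [map_add, LieDerivation.apply_lie_eq_add, lie_add, add_lie, lie_smul, smul_lie,
      lie_lie_right, smul_add, add_zero]
    abel
  have h2 := flow_eq_of_hasDerivAt D' hg s
  have hA : ∀ x, A (Ac.symm x) = x := A.apply_symm_apply
  have h0 : Ac.symm (flow D (r * 0) (A u) + ⁅orbitInt D r w 0, flow D (r * 0) (A u)⁆) = u := by
    simp only [orbitInt, intervalIntegral.integral_same, zero_lie, mul_zero, flow_zero, add_zero]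
    exact A.symm_apply_apply u
  rw [h0] at h2
  rw [h2, hA, orbit_lie]

end Heis

/-- An isomorphism of Lie algebras that preserves the Heisenberg ideals and scales the inner
products by `μ`. -/
structure LieHomothety {D D' : LieDerivation ℝ Heis Heis} (M : LeftInvMetric D)
    (M' : LeftInvMetric D') (μ : ℝ) where of ::
  /-- The underlying isomorphism of Lie algebras. -/
  toEquiv : SemiHeis D ≃ₗ[ℝ] SemiHeis D'
  map_lie : ∀ u v, toEquiv ⁅u, v⁆ = ⁅toEquiv u, toEquiv v⁆
  map_inner : ∀ u v, M'.inner (toEquiv u) (toEquiv v) = μ * M.inner u v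
  /-- The isomorphism on the Heisenberg ideals. -/
  heisEquiv : Heis ≃ₗ[ℝ] Heis
  map_heis : ∀ v, toEquiv (mk v 0) = mk (heisEquiv v) 0

namespace LieHomothety

variable {D D' : LieDerivation ℝ Heis Heis} {M : LeftInvMetric D} {M' : LeftInvMetric D'} {μ : ℝ}
  (e : LieHomothety M M' μ)

/-- The `𝔥³`-component of the image of the generator of `ℝ`. -/
def w : Heis := (e.toEquiv (mk 0 1)).heis

/-- The `ℝ`-component of the image of the generator of `ℝ`. -/
def r : ℝ := (e.toEquiv (mk 0 1)).real

theorem apply_mk (v : Heis) (s : ℝ) :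
    e.toEquiv (mk v s) = mk (e.heisEquiv v + s • e.w) (s * e.r) := by
  have h : (mk v s : SemiHeis D) = mk v 0 + s • mk 0 1 := by
    apply SemiHeis.ext <;> simp
  rw [h, map_add, map_smul, e.map_heis]
  apply SemiHeis.ext <;> simp [w, r]

theorem r_ne_zero : e.r ≠ 0 := by
  intro h0
  have h : e.toEquiv (mk 0 1) = e.toEquiv (mk (e.heisEquiv.symm e.w) 0) := by
    rw [apply_mk, apply_mk, h0]
    apply SemiHeis.ext <;> simp
  have := congrArg SemiHeis.real (e.toEquiv.injective h)
  simp at this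

theorem heisEquiv_lie (u v : Heis) : e.heisEquiv ⁅u, v⁆ = ⁅e.heisEquiv u, e.heisEquiv v⁆ := by
  have h := e.map_lie (mk u 0) (mk v 0)
  have h' : ⁅(mk u 0 : SemiHeis D), (mk v 0 : SemiHeis D)⁆ = mk ⁅u, v⁆ 0 := by
    simp [SemiHeis.bracket_def]
  rw [h', e.map_heis, e.map_heis, e.map_heis] at h
  have := congrArg SemiHeis.heis h
  simpa [SemiHeis.bracket_def] using this

theorem heisEquiv_der (u : Heis) :
    e.heisEquiv (D u) = e.r • D' (e.heisEquiv u) + ⁅e.w, e.heisEquiv u⁆ := by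
  have h := e.map_lie (mk 0 1) (mk u 0)
  have h' : ⁅(mk 0 1 : SemiHeis D), (mk u 0 : SemiHeis D)⁆ = mk (D u) 0 := by
    simp [SemiHeis.bracket_def]
  rw [h', e.map_heis, e.map_heis, apply_mk] at h
  have := congrArg SemiHeis.heis h
  simp [SemiHeis.bracket_def] at this
  rw [this, add_comm]

/-- The curve `γ` such that `s ↦ (γ s, r s)` is the image of the one-parameter group `(0, s)`. -/
def curve (s : ℝ) : Heis := Heis.orbit D' e.r e.w s

/-- The isomorphism of the simply connected groups that integrates the isomorphism of the
Lie algebras. -/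
def groupEquiv : SemiHeis D ≃ SemiHeis D' where
  toFun p := mk (e.heisEquiv p.heis + e.curve p.real
    + (1 / 2 : ℝ) • ⁅e.heisEquiv p.heis, e.curve p.real⁆) (e.r * p.real)
  invFun q := mk (e.heisEquiv.symm (q.heis - e.curve (q.real / e.r)
    - (1 / 2 : ℝ) • ⁅q.heis, e.curve (q.real / e.r)⁆)) (q.real / e.r)
  left_inv p := by
    have h := e.r_ne_zero
    have h1 : e.r * p.real / e.r = p.real := by field_simp
    apply SemiHeis.ext
    · have key : ∀ a c : Heis, a + c + (1 / 2 : ℝ) • ⁅a, c⁆ - c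
          - (1 / 2 : ℝ) • ⁅a + c + (1 / 2 : ℝ) • ⁅a, c⁆, c⁆ = a := by
        intro a c
        ext <;> simp [Heis.bracket_def]
        ring
      refine (congrArg e.heisEquiv.symm ?_).trans (e.heisEquiv.symm_apply_apply p.heis)
      change _ - e.curve (e.r * p.real / e.r)
        - (1 / 2 : ℝ) • ⁅_, e.curve (e.r * p.real / e.r)⁆ = _
      rw [h1]
      exact key _ _
    · exact h1
  right_inv q := by
    have h := e.r_ne_zero
    have h1 : e.r * (q.real / e.r) = q.real := by field_simp
    apply SemiHeis.ext
    · have key : ∀ a c : Heis, a - c - (1 / 2 : ℝ) • ⁅a, c⁆ + c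
          + (1 / 2 : ℝ) • ⁅a - c - (1 / 2 : ℝ) • ⁅a, c⁆, c⁆ = a := by
        intro a c
        ext <;> simp [Heis.bracket_def]
        ring
      change e.heisEquiv (e.heisEquiv.symm _) + _
        + (1 / 2 : ℝ) • ⁅e.heisEquiv (e.heisEquiv.symm _), _⁆ = _
      rw [LinearEquiv.apply_symm_apply]
      exact key _ _
    · exact h1

theorem contDiff_groupEquiv : ContDiff ℝ ∞ e.groupEquiv := by
  have h1 : ContDiff ℝ ∞ fun p : SemiHeis D => e.heisEquiv p.heis :=
    (e.heisEquiv.toContinuousLinearEquiv).contDiff.comp (contDiff_heis contDiff_id)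
  have h2 : ContDiff ℝ ∞ fun p : SemiHeis D => e.curve p.real :=
    (Heis.contDiff_orbit D' e.r e.w).comp (contDiff_real contDiff_id)
  exact contDiff_mk ((h1.add h2).add ((contDiff_lie h1 h2).const_smul (1 / 2 : ℝ)))
    (contDiff_const.mul (contDiff_real contDiff_id))

theorem contDiff_groupEquiv_symm : ContDiff ℝ ∞ e.groupEquiv.symm := by
  have h0 : ContDiff ℝ ∞ fun q : SemiHeis D' => q.real / e.r :=
    (contDiff_real contDiff_id).div_const _
  have h2 : ContDiff ℝ ∞ fun q : SemiHeis D' => e.curve (q.real / e.r) :=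
    (Heis.contDiff_orbit D' e.r e.w).comp h0
  have h1 : ContDiff ℝ ∞ fun q : SemiHeis D' => q.heis := contDiff_heis contDiff_id
  exact contDiff_mk ((e.heisEquiv.symm.toContinuousLinearEquiv).contDiff.comp
    ((h1.sub h2).sub ((contDiff_lie h1 h2).const_smul (1 / 2 : ℝ)))) h0

theorem groupEquiv_one : e.groupEquiv 1 = 1 := by
  apply SemiHeis.ext <;> simp [groupEquiv, one_def, curve, Heis.orbit_zero]

theorem fderiv_groupEquiv_apply (p x : SemiHeis D) :
    fderiv ℝ e.groupEquiv p x = mk (e.heisEquiv x.heis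
      + x.real • (Heis.flow D' (e.r * p.real) e.w
        + (1 / 2 : ℝ) • ⁅e.curve p.real, Heis.flow D' (e.r * p.real) e.w⁆)
      + (1 / 2 : ℝ) • (⁅e.heisEquiv p.heis, x.real • (Heis.flow D' (e.r * p.real) e.w
        + (1 / 2 : ℝ) • ⁅e.curve p.real, Heis.flow D' (e.r * p.real) e.w⁆)⁆
        + ⁅e.heisEquiv x.heis, e.curve p.real⁆)) (e.r * x.real) := by
  have h1 : HasFDerivAt (fun p : SemiHeis D => e.heisEquiv p.heis) _ p :=
    (e.heisEquiv.toContinuousLinearEquiv).hasFDerivAt.comp p (heisL (D := D)).hasFDerivAt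
  have h2 : HasFDerivAt (fun p : SemiHeis D => e.curve p.real) _ p :=
    (Heis.hasDerivAt_orbit D' e.r e.w p.real).hasFDerivAt.comp p (realL (D := D)).hasFDerivAt
  have h3 : HasFDerivAt (fun p : SemiHeis D => ⁅e.heisEquiv p.heis, e.curve p.real⁆) _ p :=
    HasFDerivAt.comp (g := fun p : Heis × Heis => ⁅p.1, p.2⁆)
      (f := fun p : SemiHeis D => (e.heisEquiv p.heis, e.curve p.real)) p
      (Heis.isBoundedBilinearMap_lie.hasFDerivAt _) (h1.prodMk h2)
  have h4 : HasFDerivAt (fun p : SemiHeis D => inclL (D := D') (e.heisEquiv p.heis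
      + e.curve p.real + (1 / 2 : ℝ) • ⁅e.heisEquiv p.heis, e.curve p.real⁆)
      + (e.r * p.real) • (mk 0 1 : SemiHeis D')) _ p :=
    ((inclL (D := D')).hasFDerivAt.comp p
      ((h1.add h2).add (h3.const_smul (1 / 2 : ℝ)))).add
      (((realL (D := D)).hasFDerivAt.const_mul e.r).smul_const _)
  have h5 : (e.groupEquiv : SemiHeis D → SemiHeis D')
      = fun p : SemiHeis D => inclL (D := D') (e.heisEquiv p.heis
      + e.curve p.real + (1 / 2 : ℝ) • ⁅e.heisEquiv p.heis, e.curve p.real⁆)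
      + (e.r * p.real) • (mk 0 1 : SemiHeis D') := by
    funext p
    apply SemiHeis.ext <;> simp [groupEquiv]
  have h6 : fderiv ℝ e.groupEquiv p x = _ :=
    (congrArg (fun f => fderiv ℝ f p x) h5).trans (congrArg (fun L => L x) h4.fderiv)
  rw [h6]
  apply SemiHeis.ext
  · simp [IsBoundedBilinearMap.deriv_apply, curve]
  · simp

/-- The differential of `groupEquiv` in the left trivializations is the given isomorphism. -/
theorem fderiv_groupEquiv (p u : SemiHeis D) :
    fderiv ℝ e.groupEquiv p (leftLin p u) = leftLin (e.groupEquiv p) (e.toEquiv u) := by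
  have he : e.toEquiv u = SemiHeis.mk (e.heisEquiv u.heis + u.real • e.w) (u.real * e.r) :=
    e.apply_mk u.heis u.real
  have hf : e.heisEquiv (leftLin p u).heis = _ := (map_add e.heisEquiv _ _).trans
    (congrArg₂ (· + ·) (Heis.map_flow D' e.r e.w D e.heisEquiv e.heisEquiv_der p.real u.heis)
      ((map_smul e.heisEquiv (1 / 2 : ℝ) _).trans (congrArg ((1 / 2 : ℝ) • ·)
        ((e.heisEquiv_lie _ _).trans (congrArg (⁅e.heisEquiv p.heis, ·⁆)
      (Heis.map_flow D' e.r e.w D e.heisEquiv e.heisEquiv_der p.real u.heis))))))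
  rw [fderiv_groupEquiv_apply, hf, he]
  apply SemiHeis.ext
  · have key : ∀ (a c x y : Heis) (s : ℝ), x + ⁅c, x⁆ + (1 / 2 : ℝ) • ⁅a, x + ⁅c, x⁆⁆
        + s • (y + (1 / 2 : ℝ) • ⁅c, y⁆) + (1 / 2 : ℝ) • (⁅a, s • (y + (1 / 2 : ℝ) • ⁅c, y⁆)⁆
          + ⁅x + ⁅c, x⁆ + (1 / 2 : ℝ) • ⁅a, x + ⁅c, x⁆⁆, c⁆)
        = x + s • y + (1 / 2 : ℝ) • ⁅a + c + (1 / 2 : ℝ) • ⁅a, c⁆, x + s • y⁆ := by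
      intro a c x y s
      ext <;> simp [Heis.bracket_def]
      ring
    refine (key (e.heisEquiv p.heis) (e.curve p.real)
      (Heis.flow D' (e.r * p.real) (e.heisEquiv u.heis)) (Heis.flow D' (e.r * p.real) e.w)
      u.real).trans ?_
    rw [← map_smul, ← map_add]
    rfl
  · exact mul_comm _ _

theorem metricAt_groupEquiv (p u v : SemiHeis D) :
    M'.metricAt (e.groupEquiv p) (fderiv ℝ e.groupEquiv p u) (fderiv ℝ e.groupEquiv p v)
      = μ * M.metricAt p u v :=
  metricAt_of_leftLin (fun _ u => e.toEquiv u) e.fderiv_groupEquiv (fun _ => e.map_inner) p u v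

theorem homothetic (e : LieHomothety M M' μ) (hμ : 0 < μ) : Homothetic M M' :=
  ⟨e.groupEquiv, μ, e.contDiff_groupEquiv, e.contDiff_groupEquiv_symm, hμ, e.metricAt_groupEquiv⟩

theorem map_ricOp (hμ : 0 < μ) (x : SemiHeis D) :
    e.toEquiv (M.ricOp x) = μ • M'.ricOp (e.toEquiv x) :=
  LeftInvMetric.ricOp_homothety e.contDiff_groupEquiv hμ e.metricAt_groupEquiv e.groupEquiv_one
    e.toEquiv.toLinearMap (fun u => by
      have := e.fderiv_groupEquiv 1 u
      rwa [leftLin_one, e.groupEquiv_one, leftLin_one] at this) x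

/-- Unlike a general homothety, one that comes from an isomorphism of Lie algebras preserves
algebraic Ricci solitons. -/
theorem isAlgebraicRicciSoliton (e : LieHomothety M M' μ) (hμ : 0 < μ)
    (h : M'.IsAlgebraicRicciSoliton) : M.IsAlgebraicRicciSoliton := by
  obtain ⟨r, E, hE⟩ := h
  refine ⟨μ * r, ⟨μ • (e.toEquiv.symm.toLinearMap ∘ₗ E.toLinearMap ∘ₗ e.toEquiv.toLinearMap), ?_⟩,
    fun x => ?_⟩
  · intro u v
    apply e.toEquiv.injective
    simp [e.map_lie, smul_sub]
  · apply e.toEquiv.injective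
    rw [e.map_ricOp hμ, hE]
    change _ = e.toEquiv ((μ * r) • x + μ • e.toEquiv.symm (E (e.toEquiv x)))
    simp [smul_smul]

end LieHomothety
end

noncomputable section

/-! ### Normal form of left-invariant metrics -/

open SemiHeis

/-- The inner product on the Lie algebra as a bilinear map. -/
def LeftInvMetric.innerL {D : LieDerivation ℝ Heis Heis} (M : LeftInvMetric D) :
    SemiHeis D →ₗ[ℝ] SemiHeis D →ₗ[ℝ] ℝ :=
  LinearMap.mk₂ ℝ M.inner
    (fun u u' v => by simp [LeftInvMetric.inner, add_mul, Finset.sum_add_distrib])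
    (fun r u v => by simp [LeftInvMetric.inner, mul_assoc, Finset.mul_sum])
    (fun u v v' => by simp [LeftInvMetric.inner, mul_add, Finset.sum_add_distrib])
    (fun r u v => by
      simp only [LeftInvMetric.inner, map_smul, Finsupp.smul_apply, smul_eq_mul, Finset.mul_sum]
      exact Finset.sum_congr rfl fun i _ => by ring)

theorem LeftInvMetric.innerL_apply {D : LieDerivation ℝ Heis Heis} (M : LeftInvMetric D)
    (u v : SemiHeis D) : M.innerL u v = M.inner u v := rfl

namespace LieHomothety

variable {D D' : LieDerivation ℝ Heis Heis} {M : LeftInvMetric D} {M' : LeftInvMetric D'} {μ : ℝ}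

/-- An isomorphism of the Lie algebras that maps the Heisenberg ideal into the Heisenberg ideal. -/
def ofEquiv (ψ : SemiHeis D ≃ₗ[ℝ] SemiHeis D') (hlie : ∀ u v, ψ ⁅u, v⁆ = ⁅ψ u, ψ v⁆)
    (hinner : ∀ u v, M'.inner (ψ u) (ψ v) = μ * M.inner u v)
    (hheis : ∀ v, (ψ (mk v 0)).real = 0) : LieHomothety M M' μ :=
  let L : Heis →ₗ[ℝ] Heis :=
    (heisL (D := D')).toLinearMap ∘ₗ ψ.toLinearMap ∘ₗ (inclL (D := D)).toLinearMap
  have hL : ∀ v, ψ (mk v 0) = mk (L v) 0 := fun v => SemiHeis.ext rfl (hheis v)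
  have hinj : Function.Injective L := fun v w h => by
    have h1 : ψ (mk v 0) = ψ (mk w 0) := by rw [hL, hL, h]
    exact congrArg SemiHeis.heis (ψ.injective h1)
  { toEquiv := ψ
    map_lie := hlie
    map_inner := hinner
    heisEquiv := LinearEquiv.ofInjectiveEndo L hinj
    map_heis := hL }

theorem lie_lie_of_real_eq_zero {x y z : SemiHeis D} (hx : x.real = 0) (hy : y.real = 0)
    (hz : z.real = 0) : ⁅x, ⁅y, z⁆⁆ = 0 := by
  apply SemiHeis.ext <;> simp [SemiHeis.bracket_def, hx, hy, hz, Heis.lie_lie_right]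

/-- A basis with the brackets of `bracketMetric a b H c d 0` whose vectors are orthogonal and of
the same length gives an isomorphic homothety. -/
theorem exists_of_basis {a b H c d : ℝ} (f : Module.Basis (Fin 4) ℝ (SemiHeis D))
    (hf : ∀ i j, M.inner (f i) (f j) = if i = j then μ else 0)
    (h0 : (f 0).real = 0) (h1 : (f 1).real = 0) (h2 : (f 2).real = 0)
    (h01 : ⁅f 0, f 1⁆ = f 2) (h03 : ⁅f 0, f 3⁆ = a • f 0 + b • f 1 + H • f 2)
    (h13 : ⁅f 1, f 3⁆ = c • f 0 + d • f 1) :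
    Nonempty (LieHomothety (bracketMetric a b H c d 0) M μ) := by
  have h02 : ⁅f 0, f 2⁆ = 0 := by rw [← h01]; exact lie_lie_of_real_eq_zero h0 h0 h1
  have h12 : ⁅f 1, f 2⁆ = 0 := by rw [← h01]; exact lie_lie_of_real_eq_zero h1 h0 h1
  have h23 : ⁅f 2, f 3⁆ = (a + d) • f 2 := by
    rw [← h01, lie_lie, h13, h03]
    have h10 : ⁅f 1, f 0⁆ = -f 2 := by rw [← lie_skew, h01]
    simp only [lie_add, lie_smul, lie_self, h01, h10, h12, smul_zero]
    module
  let e := (bracketMetric a b H c d 0).frame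
  obtain ⟨k01, k02, k12, k03, k13, k23⟩ := bracketMetric_brackets a b H c d 0
  let ψ : SemiHeis (bracketDer a b H c d 0) ≃ₗ[ℝ] SemiHeis D := e.equiv f (Equiv.refl _)
  have hψ : ∀ i, ψ (e i) = f i := fun i => by simp [ψ]
  have key : ∀ i j, ψ ⁅e i, e j⁆ = ⁅f i, f j⁆ := by
    have hlt : ∀ i j, i < j → ψ ⁅e i, e j⁆ = ⁅f i, f j⁆ := by
      intro i j hij
      fin_cases i <;> fin_cases j <;> first | exact absurd hij (by decide) | skip
      · exact (congrArg ψ k01).trans ((hψ 2).trans h01.symm)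
      · exact (congrArg ψ k02).trans ((map_zero ψ).trans h02.symm)
      · refine (congrArg ψ k03).trans (Eq.trans ?_ h03.symm)
        simp only [map_add, map_smul]
        exact congrArg₂ _ (congrArg₂ _ (congrArg _ (hψ 0)) (congrArg _ (hψ 1)))
          (congrArg _ (hψ 2))
      · exact (congrArg ψ k12).trans ((map_zero ψ).trans h12.symm)
      · refine (congrArg ψ k13).trans (Eq.trans ?_ h13.symm)
        simp only [map_add, map_smul, zero_smul, add_zero]
        exact congrArg₂ _ (congrArg _ (hψ 0)) (congrArg _ (hψ 1))
      · refine (congrArg ψ k23).trans (Eq.trans ?_ h23.symm)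
        rw [map_smul]
        exact congrArg _ (hψ 2)
    intro i j
    rcases lt_trichotomy i j with h | h | h
    · exact hlt i j h
    · rw [h, lie_self, lie_self, map_zero]
    · rw [← lie_skew, map_neg, hlt j i h, lie_skew]
  refine ⟨ofEquiv ψ ?_ ?_ ?_⟩
  · intro u v
    rw [← e.sum_repr u, ← e.sum_repr v]
    simp only [sum_lie, lie_sum, smul_lie, lie_smul, map_sum, map_smul, key, hψ]
  · intro u v
    have hB : ∀ x y : Fin 4 → ℝ, M.inner (∑ i, x i • f i) (∑ j, y j • f j)
        = μ * ∑ i, x i * y i := by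
      intro x y
      rw [← M.innerL_apply]
      have hBf : ∀ i j, M.innerL (f i) (f j) = if i = j then μ else 0 := hf
      simp only [map_sum, map_smul, LinearMap.sum_apply, LinearMap.smul_apply, hBf, smul_eq_mul]
      simp [Finset.mul_sum, mul_comm, mul_left_comm]
    have hψu : ∀ u, ψ u = ∑ i, e.repr u i • f i := by
      intro u
      conv_lhs => rw [← e.sum_repr u]
      simp only [map_sum, map_smul, hψ]
    rw [hψu, hψu, hB]
    rfl
  · intro v
    have hv : (mk v 0 : SemiHeis (bracketDer a b H c d 0))
        = v.coord 0 • e 0 + v.coord 1 • e 1 + v.coord 2 • e 2 := by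
      have he : ∀ i, e i = (coordEquiv (bracketDer a b H c d 0)).symm (Pi.single i 1) :=
        fun i => by simp [e, bracketMetric]
      have hs : ∀ x, (coordEquiv (bracketDer a b H c d 0)).symm x
          = SemiHeis.mk (Heis.mk (x 0) (x 1) (x 2)) (x 3) := fun _ => rfl
      simp only [he, hs]
      apply SemiHeis.ext
      · ext <;> simp
      · simp
    rw [hv]
    simp only [map_add, map_smul, hψ, real_add, real_smul, h0, h1, h2]
    simp

end LieHomothety
end

noncomputable section

open SemiHeis

namespace LeftInvMetric

variable {D : LieDerivation ℝ Heis Heis} (M : LeftInvMetric D)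

theorem inner_comm (u v : SemiHeis D) : M.inner u v = M.inner v u := by
  simp only [inner, mul_comm]

theorem inner_self_pos {u : SemiHeis D} (hu : u ≠ 0) : 0 < M.inner u u := by
  have h0 : 0 ≤ M.inner u u := Finset.sum_nonneg fun i _ => mul_self_nonneg _
  refine lt_of_le_of_ne h0 fun h => hu ?_
  have h1 := (Finset.sum_eq_zero_iff_of_nonneg fun i _ => mul_self_nonneg _).1 h.symm
  apply M.frame.repr.injective
  ext i
  simpa using h1 i (Finset.mem_univ i)

/-- Three linear conditions leave room for a unit vector. -/
theorem exists_unit (L : SemiHeis D →ₗ[ℝ] (Fin 3 → ℝ)) : ∃ u, M.inner u u = 1 ∧ L u = 0 := by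
  have hker : LinearMap.ker L ≠ ⊥ := by
    apply LinearMap.ker_ne_bot_of_finrank_lt
    rw [Module.finrank_eq_card_basis M.frame]
    simp
  obtain ⟨u, hu, hu0⟩ := (Submodule.ne_bot_iff _).1 hker
  have hp := M.inner_self_pos hu0
  refine ⟨(√(M.inner u u))⁻¹ • u, ?_, by rw [map_smul, LinearMap.mem_ker.1 hu, smul_zero]⟩
  rw [← innerL_apply, map_smul, map_smul, LinearMap.smul_apply, innerL_apply, smul_eq_mul,
    smul_eq_mul, ← mul_assoc, ← mul_inv, Real.mul_self_sqrt hp.le, inv_mul_cancel₀ hp.ne']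

/-- Four orthogonal vectors of the same length form a basis. -/
theorem exists_basis {μ : ℝ} (hμ : 0 < μ) (f : Fin 4 → SemiHeis D)
    (hf : ∀ i j, M.inner (f i) (f j) = if i = j then μ else 0) :
    ∃ F : Module.Basis (Fin 4) ℝ (SemiHeis D), ∀ i, F i = f i := by
  have hli : LinearIndependent ℝ f := by
    refine Fintype.linearIndependent_iff.2 fun g hg i => ?_
    have h := congrArg (fun x => M.innerL x (f i)) hg
    simp only [map_sum, map_smul, LinearMap.sum_apply, LinearMap.smul_apply, innerL_apply, hf,
      map_zero, LinearMap.zero_apply, smul_eq_mul] at h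
    simpa [hμ.ne'] using h
  have hcard : Fintype.card (Fin 4) = Module.finrank ℝ (SemiHeis D) :=
    (Module.finrank_eq_card_basis M.frame).symm
  exact ⟨basisOfLinearIndependentOfCardEqFinrank hli hcard,
    congrFun (coe_basisOfLinearIndependentOfCardEqFinrank hli hcard)⟩

end LeftInvMetric

namespace LieHomothety

variable {D : LieDerivation ℝ Heis Heis} {M : LeftInvMetric D} {μ : ℝ}

theorem exists_of_orthogonal {a b H c d : ℝ} (hμ : 0 < μ) (f : Fin 4 → SemiHeis D)
    (hf : ∀ i j, M.inner (f i) (f j) = if i = j then μ else 0)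
    (h0 : (f 0).real = 0) (h1 : (f 1).real = 0) (h2 : (f 2).real = 0)
    (h01 : ⁅f 0, f 1⁆ = f 2) (h03 : ⁅f 0, f 3⁆ = a • f 0 + b • f 1 + H • f 2)
    (h13 : ⁅f 1, f 3⁆ = c • f 0 + d • f 1) :
    Nonempty (LieHomothety (bracketMetric a b H c d 0) M μ) := by
  obtain ⟨F, hF⟩ := M.exists_basis hμ f hf
  simp only [← hF] at hf h0 h1 h2 h01 h03 h13
  exact exists_of_basis F hf h0 h1 h2 h01 h03 h13

/-- Every left-invariant metric is isomorphic, up to scale, to some `bracketMetric a b H c d 0`: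
the vector `e₄` is normal to the Heisenberg ideal, `e₃` spans its centre, and `e₁, e₂` are rotated
until `[e₂, e₄]` has no `e₃`-component. -/
theorem exists_normalForm (M : LeftInvMetric D) : ∃ a b H c d μ : ℝ, 0 < μ ∧
    Nonempty (LieHomothety (bracketMetric a b H c d 0) M μ) := by
  let E : Fin 3 → SemiHeis D :=
    ![mk (Heis.mk 1 0 0) 0, mk (Heis.mk 0 1 0) 0, mk (Heis.mk 0 0 1) 0]
  obtain ⟨g3, h33, hg3⟩ := M.exists_unit (LinearMap.pi fun i => M.innerL.flip (E i))
  have hE : ∀ u : SemiHeis D, u.real = 0 →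
      u = u.heis.coord 0 • E 0 + u.heis.coord 1 • E 1 + u.heis.coord 2 • E 2 := by
    intro u hu
    apply SemiHeis.ext
    · ext <;> simp [E]
    · simp [E, hu]
  have hn : ∀ u : SemiHeis D, u.real = 0 → M.innerL g3 u = 0 := by
    intro u hu
    have h : ∀ i, M.innerL g3 (E i) = 0 := fun i => congrFun hg3 i
    rw [hE u hu]
    simp only [map_add, map_smul, h, smul_zero, add_zero]
  have hz : E 2 ≠ 0 := by
    intro h
    have := congrArg (fun u : SemiHeis D => u.heis.coord 2) h
    simp [E] at this
  have hzp := M.inner_self_pos hz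
  set ν := √(M.inner (E 2) (E 2)) with hν
  have hνp : 0 < ν := Real.sqrt_pos.2 hzp
  have hνν : ν * ν = M.innerL (E 2) (E 2) := Real.mul_self_sqrt hzp.le
  set g2 : SemiHeis D := ν⁻¹ • E 2 with hg2
  have r2 : g2.real = 0 := by simp [hg2, E]
  have h22 : M.innerL g2 g2 = 1 := by
    rw [hg2, map_smul, map_smul, LinearMap.smul_apply, smul_eq_mul, smul_eq_mul, ← hνν]
    field_simp
  let L : SemiHeis D →ₗ[ℝ] ℝ :=
    { toFun := fun u => M.innerL ⁅u, g3⁆ g2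
      map_add' := fun u v => by simp only [add_lie, map_add, LinearMap.add_apply]
      map_smul' := fun r u => by simp only [smul_lie, map_smul, LinearMap.smul_apply,
        RingHom.id_apply] }
  obtain ⟨g1, h11, hg1⟩ := M.exists_unit
    (LinearMap.pi ![(realL (D := D)).toLinearMap, M.innerL.flip g2, L])
  have r1 : g1.real = 0 := congrFun hg1 0
  have h12 : M.innerL g1 g2 = 0 := congrFun hg1 1
  have hL1 : M.innerL ⁅g1, g3⁆ g2 = 0 := congrFun hg1 2
  obtain ⟨g0, h00, hg0⟩ := M.exists_unit
    (LinearMap.pi ![(realL (D := D)).toLinearMap, M.innerL.flip g2, M.innerL.flip g1])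
  have r0 : g0.real = 0 := congrFun hg0 0
  have h02 : M.innerL g0 g2 = 0 := congrFun hg0 1
  have h01 : M.innerL g0 g1 = 0 := congrFun hg0 2
  have hsymm : ∀ u v, M.innerL u v = M.innerL v u := M.inner_comm
  let g : Fin 4 → SemiHeis D := ![g0, g1, g2, g3]
  have hg : ∀ i j, M.innerL (g i) (g j) = if i = j then 1 else 0 := by
    have h10 := (hsymm g1 g0).trans h01
    have h20 := (hsymm g2 g0).trans h02
    have h21 := (hsymm g2 g1).trans h12
    have h30 := hn g0 r0
    have h31 := hn g1 r1
    have h32 := hn g2 r2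
    have h03 := (hsymm g0 g3).trans h30
    have h13 := (hsymm g1 g3).trans h31
    have h23 := (hsymm g2 g3).trans h32
    intro i j
    fin_cases i <;> fin_cases j <;> simp [g] <;> assumption
  obtain ⟨G, hG⟩ := M.exists_basis one_pos g hg
  -- the components of a vector of the Heisenberg ideal
  have hexp : ∀ u : SemiHeis D, u.real = 0 →
      u = M.innerL u g0 • g0 + M.innerL u g1 • g1 + M.innerL u g2 • g2 := by
    intro u hu
    have hrep : ∀ i, M.innerL u (g i) = G.repr u i := by
      intro i
      conv_lhs => rw [← G.sum_repr u]
      simp only [map_sum, map_smul, LinearMap.sum_apply, LinearMap.smul_apply, hG, hg]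
      simp
    have h3 : G.repr u 3 = 0 := by
      rw [← hrep]
      exact (hsymm _ _).trans (hn u hu)
    conv_lhs => rw [← G.sum_repr u]
    rw [Fin.sum_univ_four, h3, zero_smul, add_zero, ← hrep, ← hrep, ← hrep, hG, hG, hG]
    rfl
  have hbr : ∀ u v : SemiHeis D, (⁅u, v⁆ : SemiHeis D).real = 0 := fun u v => by
    simp [SemiHeis.bracket_def]
  obtain ⟨κ, hκ⟩ : ∃ κ : ℝ, ⁅g0, g1⁆ = κ • g2 := by
    refine ⟨(⁅g0, g1⁆ : SemiHeis D).heis.coord 2 * ν, ?_⟩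
    rw [hg2, smul_smul, mul_assoc, mul_inv_cancel₀ hνp.ne', mul_one]
    apply SemiHeis.ext
    · ext <;> simp [E, SemiHeis.bracket_def, Heis.bracket_def, r0, r1]
    · simp [E, SemiHeis.bracket_def]
  -- otherwise the Heisenberg ideal would be abelian
  have hκ0 : κ ≠ 0 := by
    rintro rfl
    rw [zero_smul] at hκ
    have h10 : ⁅g1, g0⁆ = 0 := by rw [← lie_skew, hκ, neg_zero]
    have hc : ∀ u : SemiHeis D, u.real = 0 → ⁅u, g2⁆ = 0 := by
      intro u hu
      apply SemiHeis.ext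
      · ext <;> simp [hg2, E, SemiHeis.bracket_def, Heis.bracket_def, hu]
      · simp [SemiHeis.bracket_def]
    have hc' : ∀ u : SemiHeis D, u.real = 0 → ⁅g2, u⁆ = 0 := by
      intro u hu
      rw [← lie_skew, hc u hu, neg_zero]
    have h := congrArg₂ (fun u v : SemiHeis D => (⁅u, v⁆ : SemiHeis D))
      (hexp (E 0) (by simp [E])) (hexp (E 1) (by simp [E]))
    simp only [add_lie, lie_add, smul_lie, lie_smul, hκ, h10, lie_self, hc _ r0, hc _ r1,
      hc' _ r0, hc' _ r1, smul_zero, add_zero] at h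
    have := congrArg (fun u : SemiHeis D => u.heis.coord 2) h
    simp [E, SemiHeis.bracket_def, Heis.bracket_def] at this
  have e03 := hexp ⁅g0, g3⁆ (hbr _ _)
  have e13 := hexp ⁅g1, g3⁆ (hbr _ _)
  rw [hL1, zero_smul, add_zero] at e13
  -- the common length `κ⁻¹` makes the bracket of the first two vectors equal to the third
  refine ⟨κ⁻¹ * M.innerL ⁅g0, g3⁆ g0, κ⁻¹ * M.innerL ⁅g0, g3⁆ g1, κ⁻¹ * M.innerL ⁅g0, g3⁆ g2,
    κ⁻¹ * M.innerL ⁅g1, g3⁆ g0, κ⁻¹ * M.innerL ⁅g1, g3⁆ g1, κ⁻¹ * κ⁻¹,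
    mul_self_pos.2 (inv_ne_zero hκ0),
    exists_of_orthogonal (mul_self_pos.2 (inv_ne_zero hκ0)) (fun i => κ⁻¹ • g i) ?_ ?_ ?_ ?_ ?_
      ?_ ?_⟩
  · intro i j
    rw [← LeftInvMetric.innerL_apply, map_smul, map_smul, LinearMap.smul_apply, hg]
    split_ifs <;> simp
  · simp [g, r0]
  · simp [g, r1]
  · simp [g, r2]
  · change ⁅κ⁻¹ • g0, κ⁻¹ • g1⁆ = κ⁻¹ • g2
    rw [smul_lie, lie_smul, hκ, smul_smul κ⁻¹ κ, inv_mul_cancel₀ hκ0, one_smul]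
  · change ⁅κ⁻¹ • g0, κ⁻¹ • g3⁆ = _ • κ⁻¹ • g0 + _ • κ⁻¹ • g1 + _ • κ⁻¹ • g2
    rw [smul_lie, lie_smul]
    conv_lhs => rw [e03]
    module
  · change ⁅κ⁻¹ • g1, κ⁻¹ • g3⁆ = _ • κ⁻¹ • g0 + _ • κ⁻¹ • g1
    rw [smul_lie, lie_smul]
    conv_lhs => rw [e13]
    module

/-- The effect on the parameters of a rotation by `(x, y)` in the plane of `e₁, e₂`, of a
reflection `ε` in this plane, and of a sign `δ` of `e₄`. -/
theorem exists_move {a b H c d a' b' H' c' d' x y ε δ : ℝ} (hxy : x ^ 2 + y ^ 2 = 1)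
    (hε : ε ^ 2 = 1) (hδ : δ ^ 2 = 1) (hyH : y = 0 ∨ H = 0)
    (ha : a' = δ * ((a * x + c * y) * x + (b * x + d * y) * y))
    (hb : b' = δ * ε * (-y * (a * x + c * y) + x * (b * x + d * y)))
    (hH : H' = δ * ε * H * x)
    (hc : c' = δ * ε * (x * (-a * y + c * x) + y * (-b * y + d * x)))
    (hd : d' = δ * (-y * (-a * y + c * x) + x * (-b * y + d * x))) :
    Nonempty (LieHomothety (bracketMetric a' b' H' c' d' 0) (bracketMetric a b H c d 0) 1) := by
  have hD : ∀ v, bracketDer a b H c d 0 v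
      = Heis.mk (-(a * v.coord 0 + c * v.coord 1)) (-(b * v.coord 0 + d * v.coord 1))
        (-(H * v.coord 0 + 0 * v.coord 1 + (a + d) * v.coord 2)) := fun _ => rfl
  have hin : ∀ u v, (bracketMetric a b H c d 0).inner u v = u.heis.coord 0 * v.heis.coord 0
      + u.heis.coord 1 * v.heis.coord 1 + u.heis.coord 2 * v.heis.coord 2
      + u.real * v.real := fun u v => by
    rw [LeftInvMetric.inner, Fin.sum_univ_four]
    rfl
  subst ha hb hH hc hd
  refine exists_of_orthogonal one_pos ![mk (Heis.mk x y 0) 0, mk (Heis.mk (-(ε * y)) (ε * x) 0) 0,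
    mk (Heis.mk 0 0 ε) 0, mk 0 δ] ?_ rfl rfl rfl ?_ ?_ ?_
  · intro i j
    fin_cases i <;> fin_cases j <;> simp [hin] <;>
      first
      | ring1
      | linear_combination hxy
      | linear_combination hε
      | linear_combination hδ
      | linear_combination ε ^ 2 * hxy + hε
  · apply SemiHeis.ext
    · ext <;> simp [SemiHeis.bracket_def, Heis.bracket_def]
      linear_combination ε * hxy
    · simp [SemiHeis.bracket_def]
  · apply SemiHeis.ext
    · ext
      · simp [SemiHeis.bracket_def, hD]
        linear_combination (-δ * (a * x + c * y)) * hxy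
          + δ * y * (-c * y ^ 2 - y * a * x + x ^ 2 * b + y * x * d) * hε
      · simp [SemiHeis.bracket_def, hD]
        linear_combination (-δ * (b * x + d * y)) * hxy
          + δ * x * (-d * y * x + y * x * a + y ^ 2 * c - b * x ^ 2) * hε
      · simp [SemiHeis.bracket_def, hD]
        linear_combination (-δ * H * x) * hε
    · simp [SemiHeis.bracket_def]
  · apply SemiHeis.ext
    · ext
      · simp [SemiHeis.bracket_def, hD]
        linear_combination (-δ * ε * (c * x - a * y)) * hxy
      · simp [SemiHeis.bracket_def, hD]
        linear_combination (-δ * ε * (d * x - b * y)) * hxy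
      · simp [SemiHeis.bracket_def, hD]
        tauto
    · simp [SemiHeis.bracket_def]

end LieHomothety
end

noncomputable section

/-! ### Two homotheties that do not come from `LieHomothety` -/

open SemiHeis

namespace Heis

@[fun_prop]
theorem contDiff_coord {E : Type*} [NormedAddCommGroup E] [NormedSpace ℝ E] {n : WithTop ℕ∞}
    {f : E → Heis} (hf : ContDiff ℝ n f) (i : Fin 3) : ContDiff ℝ n fun x => (f x).coord i :=
  (ContinuousLinearMap.proj (R := ℝ) (φ := fun _ : Fin 3 => ℝ) i).contDiff.comp hf

theorem contDiff_mk {E : Type*} [NormedAddCommGroup E] [NormedSpace ℝ E] {n : WithTop ℕ∞}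
    {x y z : E → ℝ} (hx : ContDiff ℝ n x) (hy : ContDiff ℝ n y) (hz : ContDiff ℝ n z) :
    ContDiff ℝ n fun t => Heis.mk (x t) (y t) (z t) := by
  refine contDiff_pi.2 fun i => ?_
  fin_cases i
  exacts [hx, hy, hz]

theorem hasDerivAt_mk {x y z : ℝ → ℝ} {x' y' z' t : ℝ} (hx : HasDerivAt x x' t)
    (hy : HasDerivAt y y' t) (hz : HasDerivAt z z' t) :
    HasDerivAt (fun t => Heis.mk (x t) (y t) (z t)) (Heis.mk x' y' z') t := by
  refine hasDerivAt_pi.2 fun i => ?_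
  fin_cases i
  exacts [hx, hy, hz]

end Heis

namespace SemiHeis

variable {D : LieDerivation ℝ Heis Heis}

theorem hasDerivAt_mk {v : ℝ → Heis} {s : ℝ → ℝ} {v' : Heis} {s' t : ℝ}
    (hv : HasDerivAt v v' t) (hs : HasDerivAt s s' t) :
    HasDerivAt (fun t => (mk (v t) (s t) : SemiHeis D)) (mk v' s') t :=
  hv.prodMk hs

@[fun_prop]
theorem contDiff_heis_id {n : WithTop ℕ∞} : ContDiff ℝ n fun p : SemiHeis D => p.heis :=
  contDiff_heis contDiff_id

@[fun_prop]
theorem contDiff_real_id {n : WithTop ℕ∞} : ContDiff ℝ n fun p : SemiHeis D => p.real :=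
  contDiff_real contDiff_id

end SemiHeis

theorem bracketMetric_inner (a b H c d : ℝ) (u v : SemiHeis (bracketDer a b H c d 0)) :
    (bracketMetric a b H c d 0).inner u v = u.heis.coord 0 * v.heis.coord 0
      + u.heis.coord 1 * v.heis.coord 1 + u.heis.coord 2 * v.heis.coord 2
      + u.real * v.real := by
  rw [LeftInvMetric.inner, Fin.sum_univ_four]
  rfl

theorem bracketDer_apply (a b H c d : ℝ) (v : Heis) : bracketDer a b H c d 0 v
      = Heis.mk (-(a * v.coord 0 + c * v.coord 1)) (-(b * v.coord 0 + d * v.coord 1))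
        (-(H * v.coord 0 + 0 * v.coord 1 + (a + d) * v.coord 2)) := rfl

theorem flow_rotation (a c s : ℝ) (u : Heis) :
    Heis.flow (bracketDer a (-c) 0 c a 0) s u
      = Heis.mk (Real.exp (-a * s) * (Real.cos (c * s) * u.coord 0 - Real.sin (c * s) * u.coord 1))
        (Real.exp (-a * s) * (Real.sin (c * s) * u.coord 0 + Real.cos (c * s) * u.coord 1))
        (Real.exp (-(2 * a) * s) * u.coord 2) := by
  let g : ℝ → Heis := fun s =>
    Heis.mk (Real.exp (-a * s) * (Real.cos (c * s) * u.coord 0 - Real.sin (c * s) * u.coord 1))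
        (Real.exp (-a * s) * (Real.sin (c * s) * u.coord 0 + Real.cos (c * s) * u.coord 1))
        (Real.exp (-(2 * a) * s) * u.coord 2)
  have hg : ∀ s, HasDerivAt g (bracketDer a (-c) 0 c a 0 (g s)) s := by
    intro s
    have he : ∀ k : ℝ, HasDerivAt (fun s => Real.exp (k * s)) (k * Real.exp (k * s)) s := by
      intro k
      exact ((hasDerivAt_id s).const_mul k).exp.congr_deriv (by simp [mul_comm])
    have hc : HasDerivAt (fun s => Real.cos (c * s)) (-(c * Real.sin (c * s))) s :=
      ((hasDerivAt_id s).const_mul c).cos.congr_deriv (by simp [mul_comm])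
    have hs : HasDerivAt (fun s => Real.sin (c * s)) (c * Real.cos (c * s)) s :=
      ((hasDerivAt_id s).const_mul c).sin.congr_deriv (by simp [mul_comm])
    refine (Heis.hasDerivAt_mk ((he (-a)).mul ((hc.mul_const _).sub (hs.mul_const _)))
      ((he (-a)).mul ((hs.mul_const _).add (hc.mul_const _)))
      ((he (-(2 * a))).mul_const _)).congr_deriv ?_
    rw [bracketDer_apply]
    ext <;> simp [g] <;> ring
  have h0 : g 0 = u := by
    ext <;> simp [g]
  have := Heis.flow_eq_of_hasDerivAt _ hg s
  rw [h0] at this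
  exact this

/-- The skew part of the action of `e₄` on the plane of `e₁, e₂` does not affect the isometry
class when the symmetric part is a multiple of the identity: the identity map of the charts is an
isometry, since the two flows differ by rotations. -/
theorem homothetic_untwist (a c : ℝ) :
    Homothetic (bracketMetric a (-c) 0 c a 0) (bracketMetric a 0 0 0 a 0) := by
  let φ : SemiHeis (bracketDer a (-c) 0 c a 0) ≃ SemiHeis (bracketDer a 0 0 0 a 0) :=
    { toFun := fun p => mk p.heis p.real
      invFun := fun p => mk p.heis p.real
      left_inv := fun _ => rfl
      right_inv := fun _ => rfl }
  have hφ : ContDiff ℝ ∞ φ := contDiff_mk (by fun_prop) (by fun_prop)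
  refine ⟨φ, 1, hφ, contDiff_mk (by fun_prop) (by fun_prop), one_pos,
    metricAt_of_leftLin (fun p u => mk (Heis.mk
      (Real.cos (c * p.real) * u.heis.coord 0 - Real.sin (c * p.real) * u.heis.coord 1)
      (Real.sin (c * p.real) * u.heis.coord 0 + Real.cos (c * p.real) * u.heis.coord 1)
      (u.heis.coord 2)) u.real) ?_ ?_⟩
  · intro p u
    have h1 : fderiv ℝ φ p (leftLin p u) = mk (leftLin p u).heis (leftLin p u).real := by
      let L : SemiHeis (bracketDer a (-c) 0 c a 0) →L[ℝ] SemiHeis (bracketDer a 0 0 0 a 0) :=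
        inclL.comp heisL + realL.smulRight (mk 0 1)
      have h2 : HasFDerivAt φ L p := by
        have h3 : ⇑φ = L := by
          funext q
          change mk q.heis q.real = L q
          apply SemiHeis.ext <;> simp [L]
        rw [h3]
        exact L.hasFDerivAt
      rw [h2.fderiv]
      apply SemiHeis.ext <;> simp [L]
    have hF : Heis.flow (bracketDer a (-c) 0 c a 0) p.real u.heis
        = Heis.flow (bracketDer a 0 0 0 a 0) p.real (Heis.mk
      (Real.cos (c * p.real) * u.heis.coord 0 - Real.sin (c * p.real) * u.heis.coord 1)
      (Real.sin (c * p.real) * u.heis.coord 0 + Real.cos (c * p.real) * u.heis.coord 1)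
      (u.heis.coord 2)) := by
      have h := flow_rotation a 0 p.real
      rw [neg_zero] at h
      rw [flow_rotation, h]
      ext <;> simp
    rw [h1]
    simp only [leftLin, LinearMap.coe_mk, AddHom.coe_mk, heis_mk, real_mk, hF]
    rfl
  · intro p u v
    have := Real.sin_sq_add_cos_sq (c * p.real)
    have e := bracketMetric_inner a (-c) 0 c a u v
    rw [e, bracketMetric_inner]
    simp only [heis_mk, real_mk, Heis.coord_mk_zero, Heis.coord_mk_one, Heis.coord_mk_two]
    linear_combination (u.heis.coord 0 * v.heis.coord 0 + u.heis.coord 1 * v.heis.coord 1) * this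

theorem flow_nilpotent (H c s : ℝ) (u : Heis) :
    Heis.flow (bracketDer 0 0 H c 0 0) s u = Heis.mk (u.coord 0 - c * s * u.coord 1) (u.coord 1)
      (u.coord 2 - H * (s * u.coord 0 - c * s ^ 2 / 2 * u.coord 1)) := by
  let g : ℝ → Heis := fun s => Heis.mk (u.coord 0 - c * s * u.coord 1) (u.coord 1)
      (u.coord 2 - H * (s * u.coord 0 - c * s ^ 2 / 2 * u.coord 1))
  have hg : ∀ s, HasDerivAt g (bracketDer 0 0 H c 0 0 (g s)) s := by
    intro s
    have h1 : HasDerivAt (fun s : ℝ => u.coord 0 - c * s * u.coord 1) _ s :=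
      ((((hasDerivAt_id s).const_mul c).mul_const (u.coord 1)).const_sub (u.coord 0))
    have h2 : HasDerivAt (fun s : ℝ => u.coord 2
        - H * (s * u.coord 0 - c * s ^ 2 / 2 * u.coord 1)) _ s :=
      (((((hasDerivAt_id s).mul_const (u.coord 0)).sub
        (((((hasDerivAt_id s).pow 2).const_mul c).div_const 2).mul_const (u.coord 1))).const_mul
        H).const_sub (u.coord 2))
    refine (Heis.hasDerivAt_mk h1 (hasDerivAt_const s (u.coord 1)) h2).congr_deriv ?_
    rw [bracketDer_apply]
    ext
    · simp [g]
    · simp [g]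
    · simp only [g, Heis.coord_mk_zero, Heis.coord_mk_one, Heis.coord_mk_two, id_eq]
      push_cast
      ring
  have h0 : g 0 = u := by
    ext <;> simp [g]
  have := Heis.flow_eq_of_hasDerivAt _ hg s
  rw [h0] at this
  exact this

/-- The isomorphism of nilpotent groups with differential `e₁ ↦ ν e₁`, `e₂ ↦ e₂ - H e₄`,
`e₃ ↦ ν e₃`, `e₄ ↦ H e₂ + e₄` at the identity, where `ν² = 1 + H²`; it does not preserve the
Heisenberg ideals. -/
theorem homothetic_nilpotent {H k ν : ℝ} (hν : 0 < ν) (hν2 : ν ^ 2 = 1 + H ^ 2) :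
    Homothetic (bracketMetric 0 0 H (k * ν) 0 0) (bracketMetric 0 0 0 k 0 0) := by
  -- `f` and `g` are found by integrating the prescribed differential
  let f : ℝ → ℝ → ℝ := fun y s => k * H * (y ^ 2 / 2 + H * s * y - s ^ 2 / 2)
  let g : ℝ → ℝ → ℝ := fun y s =>
    H * k / 2 * (s ^ 2 * y / 2 + H * s ^ 3 / 6 - H * s * y ^ 2 / 2) - k * H * y ^ 3 / 12
  let φ : SemiHeis (bracketDer 0 0 H (k * ν) 0 0) ≃ SemiHeis (bracketDer 0 0 0 k 0 0) :=
    { toFun := fun p => mk (Heis.mk (ν * p.heis.coord 0 + f (p.heis.coord 1) p.real)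
        (p.heis.coord 1 + H * p.real) (ν * p.heis.coord 2 + ν * H * p.real * p.heis.coord 0 / 2
          + g (p.heis.coord 1) p.real)) (p.real - H * p.heis.coord 1)
      invFun := fun q =>
        let y := (q.heis.coord 1 - H * q.real) / ν ^ 2
        let s := (q.real + H * q.heis.coord 1) / ν ^ 2
        let x := (q.heis.coord 0 - f y s) / ν
        mk (Heis.mk x y ((q.heis.coord 2 - ν * H * s * x / 2 - g y s) / ν)) s
      left_inv := fun p => by
        have h1 : (p.heis.coord 1 + H * p.real - H * (p.real - H * p.heis.coord 1)) / ν ^ 2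
            = p.heis.coord 1 := by
          rw [hν2]
          have : 1 + H ^ 2 ≠ 0 := by positivity
          field_simp
          ring
        have h2 : (p.real - H * p.heis.coord 1 + H * (p.heis.coord 1 + H * p.real)) / ν ^ 2
            = p.real := by
          rw [hν2]
          have : 1 + H ^ 2 ≠ 0 := by positivity
          field_simp
          ring
        simp only [heis_mk, real_mk, Heis.coord_mk_zero, Heis.coord_mk_one, Heis.coord_mk_two,
          h1, h2]
        have h3 : ∀ t : ℝ, (ν * p.heis.coord 0 + t - t) / ν = p.heis.coord 0 := fun t => by
          field_simp
          ring
        rw [h3]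
        apply SemiHeis.ext
        · ext
          · simp
          · simp
          · simp only [heis_mk, Heis.coord_mk_two]
            field_simp
            ring
        · simp
      right_inv := fun q => by
        have h1 : (q.heis.coord 1 - H * q.real) / ν ^ 2
            + H * ((q.real + H * q.heis.coord 1) / ν ^ 2) = q.heis.coord 1 := by
          rw [hν2]
          have : 1 + H ^ 2 ≠ 0 := by positivity
          field_simp
          ring
        have h2 : (q.real + H * q.heis.coord 1) / ν ^ 2
            - H * ((q.heis.coord 1 - H * q.real) / ν ^ 2) = q.real := by
          rw [hν2]
          have : 1 + H ^ 2 ≠ 0 := by positivity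
          field_simp
          ring
        apply SemiHeis.ext
        · ext
          · simp only [heis_mk, real_mk, Heis.coord_mk_zero, Heis.coord_mk_one]
            field_simp
            ring
          · exact h1
          · simp only [heis_mk, real_mk, Heis.coord_mk_zero, Heis.coord_mk_one,
              Heis.coord_mk_two]
            field_simp
            ring
        · exact h2 }
  have hφ : ContDiff ℝ ∞ φ := by
    refine contDiff_mk (Heis.contDiff_mk ?_ ?_ ?_) ?_ <;> (try simp only [f, g]) <;> fun_prop
  have hφ' : ContDiff ℝ ∞ φ.symm := by
    refine contDiff_mk (Heis.contDiff_mk ?_ ?_ ?_) ?_ <;> (try simp only [f, g]) <;> fun_prop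
  refine ⟨φ, ν ^ 2, hφ, hφ', by positivity,
    metricAt_of_leftLin (fun _ u => mk (Heis.mk (ν * u.heis.coord 0)
      (u.heis.coord 1 + H * u.real) (ν * u.heis.coord 2)) (u.real - H * u.heis.coord 1)) ?_ ?_⟩
  · intro p u
    have h1 := ((hφ.differentiable (by simp)) p).hasFDerivAt
    set w := leftLin p u with hw
    have hx : HasDerivAt (fun t : ℝ => p.heis.coord 0 + t * w.heis.coord 0) (w.heis.coord 0) 0 :=
      (((hasDerivAt_id (0 : ℝ)).mul_const _).const_add _).congr_deriv (one_mul _)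
    have hy : HasDerivAt (fun t : ℝ => p.heis.coord 1 + t * w.heis.coord 1) (w.heis.coord 1) 0 :=
      (((hasDerivAt_id (0 : ℝ)).mul_const _).const_add _).congr_deriv (one_mul _)
    have hz : HasDerivAt (fun t : ℝ => p.heis.coord 2 + t * w.heis.coord 2) (w.heis.coord 2) 0 :=
      (((hasDerivAt_id (0 : ℝ)).mul_const _).const_add _).congr_deriv (one_mul _)
    have hs : HasDerivAt (fun t : ℝ => p.real + t * w.real) w.real 0 :=
      (((hasDerivAt_id (0 : ℝ)).mul_const _).const_add _).congr_deriv (one_mul _)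
    have hl : HasDerivAt (fun t : ℝ => p + t • w) w 0 :=
      (((hasDerivAt_id (0 : ℝ)).smul_const w).const_add p).congr_deriv (one_smul _ _)
    have h2 : HasDerivAt (fun t : ℝ => φ (p + t • w)) (fderiv ℝ φ p w) 0 := by
      refine HasFDerivAt.comp_hasDerivAt (0 : ℝ) ?_ hl
      simpa using h1
    have hX := (hx.const_mul ν).add (((((hy.pow 2).div_const 2).add
      ((hs.const_mul H).mul hy)).sub ((hs.pow 2).div_const 2)).const_mul (k * H))
    have hY := hy.add (hs.const_mul H)
    have hS := hs.sub (hy.const_mul H)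
    have hZ := ((hz.const_mul ν).add (((hs.const_mul (ν * H)).mul hx).div_const 2)).add
      (((((((hs.pow 2).mul hy).div_const 2).add (((hs.pow 3).const_mul H).div_const 6)).sub
        (((hs.const_mul H).mul (hy.pow 2)).div_const 2)).const_mul (H * k / 2)).sub
        (((hy.pow 3).const_mul (k * H)).div_const 12))
    have h3 := hasDerivAt_mk (D := bracketDer 0 0 0 k 0 0) (Heis.hasDerivAt_mk hX hY hZ) hS
    have h4 := h2.unique h3
    rw [h4]
    simp only [hw, leftLin, LinearMap.coe_mk, AddHom.coe_mk, heis_mk, real_mk, flow_nilpotent, φ, f,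
      g, Equiv.coe_fn_mk]
    apply SemiHeis.ext
    · ext
      · simp [Heis.bracket_def]
        linear_combination -(k * p.real * u.heis.coord 1) * hν2
      · simp [Heis.bracket_def]
      · simp [Heis.bracket_def]
        linear_combination (k * p.real * u.heis.coord 1 * p.heis.coord 1 / 2) * hν2
    · simp [Heis.bracket_def]
  · intro p u v
    have e := bracketMetric_inner 0 0 H (k * ν) 0 u v
    rw [e, bracketMetric_inner]
    simp only [heis_mk, real_mk, Heis.coord_mk_zero, Heis.coord_mk_one, Heis.coord_mk_two]
    linear_combination (-u.heis.coord 1 * v.heis.coord 1 - u.real * v.real) * hν2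
end

noncomputable section

/-! ### Classification of the critical metrics -/

variable {D D' : LieDerivation ℝ Heis Heis} {M : LeftInvMetric D} {M' : LeftInvMetric D'}

theorem Homothetic.refl (M : LeftInvMetric D) : Homothetic M M :=
  ⟨Equiv.refl _, 1, contDiff_id, contDiff_id, one_pos, fun p u v => by
    simp only [Equiv.coe_refl, fderiv_id, ContinuousLinearMap.id_apply, id, one_mul]⟩

theorem InZeroEnergyFamilies.of_homothetic {t : ℝ} (h : Homothetic M M')
    (hM : InZeroEnergyFamilies M' t) : InZeroEnergyFamilies M t := by
  rcases hM with ⟨h1, h2⟩ | ⟨a, d, h1, h2, h3, h4⟩ | ⟨h1, h2⟩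
  exacts [Or.inl ⟨h.trans h1, h2⟩, Or.inr (Or.inl ⟨a, d, h1, h2, h.trans h3, h4⟩),
    Or.inr (Or.inr ⟨h.trans h1, h2⟩)]

theorem InNegativeEnergyFamilies.of_homothetic {t : ℝ} (h : Homothetic M M')
    (hM : InNegativeEnergyFamilies M' t) : InNegativeEnergyFamilies M t := by
  rcases hM with ⟨a, h1, h2, h3⟩ | ⟨a, c, d, h1, h2, h3, h4⟩ | ⟨d, H, h1, h2, h3, h4⟩
  exacts [Or.inl ⟨a, h1, h.trans h2, h3⟩, Or.inr (Or.inl ⟨a, c, d, h1, h2, h.trans h3, h4⟩),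
    Or.inr (Or.inr ⟨d, H, h1, h2, h.trans h3, h4⟩)]

/-- The three outcomes of the classification of critical metrics. -/
def IsClassified (M : LeftInvMetric D) (t : ℝ) : Prop :=
  M.IsSymmetric ∨ InZeroEnergyFamilies M t ∨ InNegativeEnergyFamilies M t

theorem IsClassified.of_homothetic {t : ℝ} (h : Homothetic M M') (hM : IsClassified M' t) :
    IsClassified M t :=
  hM.imp h.isSymmetric (Or.imp (.of_homothetic h) (.of_homothetic h))

namespace NormalForm

theorem homothetic_move {a b H c d a' b' H' c' d' : ℝ} (x y ε δ : ℝ) (hxy : x ^ 2 + y ^ 2 = 1)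
    (hε : ε ^ 2 = 1) (hδ : δ ^ 2 = 1) (hyH : y = 0 ∨ H = 0)
    (ha : a' = δ * ((a * x + c * y) * x + (b * x + d * y) * y))
    (hb : b' = δ * ε * (-y * (a * x + c * y) + x * (b * x + d * y)))
    (hH : H' = δ * ε * H * x)
    (hc : c' = δ * ε * (x * (-a * y + c * x) + y * (-b * y + d * x)))
    (hd : d' = δ * (-y * (-a * y + c * x) + x * (-b * y + d * x))) :
    Homothetic (bracketMetric a b H c d 0) (bracketMetric a' b' H' c' d' 0) :=
  ((LieHomothety.exists_move hxy hε hδ hyH ha hb hH hc hd).some.homothetic one_pos).symm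

theorem exists_sign (r : ℝ) : ∃ δ : ℝ, δ ^ 2 = 1 ∧ 0 ≤ δ * r := by
  rcases le_total 0 r with h | h
  exacts [⟨1, by norm_num, by linarith⟩, ⟨-1, by norm_num, by linarith⟩]

/-- For `H ≠ 0` only reflections preserve the normal form; they fix the signs of `H`, `c` and `d`. -/
theorem exists_homothetic_of_ne_zero (a b c d : ℝ) {H : ℝ} (hH : H ≠ 0) : ∃ a' b' H' c' d',
    0 < H' ∧ c' ≤ 0 ∧ 0 ≤ d' ∧
      Homothetic (bracketMetric a b H c d 0) (bracketMetric a' b' H' c' d' 0) := by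
  obtain ⟨δ, hδ, hd⟩ := exists_sign d
  obtain ⟨ε, hε, hc⟩ := exists_sign (-(δ * c))
  obtain ⟨x, hx, hH'⟩ := exists_sign (δ * ε * H)
  have hne : x * (δ * ε * H) ≠ 0 := by
    have h : ∀ {r : ℝ}, r ^ 2 = 1 → r ≠ 0 := by
      rintro r h rfl
      norm_num at h
    exact mul_ne_zero (h hx) (mul_ne_zero (mul_ne_zero (h hδ) (h hε)) hH)
  refine ⟨δ * a, δ * ε * b, x * (δ * ε * H), δ * ε * c, δ * d, lt_of_le_of_ne hH' hne.symm,
    by linarith, hd, homothetic_move x 0 ε δ (by linarith) hε hδ (Or.inl rfl) ?_ ?_ ?_ ?_ ?_⟩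
  · linear_combination -δ * a * hx
  · linear_combination -δ * ε * b * hx
  · ring
  · linear_combination -δ * ε * c * hx
  · linear_combination -δ * d * hx

/-- A rotation of the plane of `e₁, e₂` diagonalizes the symmetric part of the action of `e₄`. -/
theorem exists_rotation (a b c d : ℝ) : ∃ a' c' d', Nonempty
    (LieHomothety (bracketMetric a' (-c') 0 c' d' 0) (bracketMetric a b 0 c d 0) 1) := by
  set z : ℂ := ⟨a - d, b + c⟩ with hz
  set θ := z.arg / 2 with hθ
  have h1 : ‖z‖ * Real.cos (2 * θ) = a - d := by
    rw [hθ, mul_div_cancel₀ _ two_ne_zero, Complex.norm_mul_cos_arg]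
  have h2 : ‖z‖ * Real.sin (2 * θ) = b + c := by
    rw [hθ, mul_div_cancel₀ _ two_ne_zero, Complex.norm_mul_sin_arg]
  have h3 : (b + c) * Real.cos (2 * θ) = (a - d) * Real.sin (2 * θ) := by
    rw [← h1, ← h2]
    ring
  rw [Real.cos_two_mul', Real.sin_two_mul] at h3
  refine ⟨_, _, _, LieHomothety.exists_move (x := Real.cos θ) (y := Real.sin θ) (ε := 1) (δ := 1)
    (Real.cos_sq_add_sin_sq θ) (by norm_num) (by norm_num) (Or.inr rfl) rfl ?_ (by ring) rfl rfl⟩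
  linear_combination -h3

/-- The metrics with `H = 0` are normalized by rotations and reflections of the plane of `e₁, e₂`
and a change of sign of `e₄`. -/
theorem exists_homothetic_of_eq_zero (a b c d : ℝ) : ∃ a' c' d', 0 ≤ a' + d' ∧ a' ≤ d' ∧ 0 ≤ c' ∧
      Homothetic (bracketMetric a b 0 c d 0) (bracketMetric a' (-c') 0 c' d' 0) := by
  obtain ⟨a₁, c₁, d₁, ⟨e⟩⟩ := exists_rotation a b c d
  have h₁ := (e.homothetic one_pos).symm
  obtain ⟨δ, hδ, hp⟩ := exists_sign (a₁ + d₁)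
  obtain ⟨a₂, c₂, d₂, hp₂, hq₂, h₂⟩ : ∃ a' c' d', 0 ≤ a' + d' ∧ a' ≤ d' ∧
      Homothetic (bracketMetric a₁ (-c₁) 0 c₁ d₁ 0) (bracketMetric a' (-c') 0 c' d' 0) := by
    rcases le_total (δ * a₁) (δ * d₁) with h | h
    · exact ⟨_, _, _, by linarith, h, homothetic_move (c' := δ * c₁) 1 0 1 δ (by norm_num)
        (by norm_num) hδ (Or.inr rfl) (by ring) (by ring) (by ring) (by ring) (by ring)⟩
    · exact ⟨_, _, _, by linarith, h, homothetic_move (c' := δ * c₁) 0 1 1 δ (by norm_num)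
        (by norm_num) hδ (Or.inr rfl) (by ring) (by ring) (by ring) (by ring) (by ring)⟩
  obtain ⟨ε, hε, hc⟩ := exists_sign c₂
  exact ⟨_, _, _, hp₂, hq₂, hc, h₁.trans (h₂.trans (homothetic_move 1 0 ε 1 (by norm_num) hε
    (by norm_num) (Or.inr rfl) (by ring) (by ring) (by ring) (by ring) (by ring)))⟩

/-- The solutions with `a = d = 0` are brought to families (1) and (3) by `homothetic_nilpotent`;
the others form family (6). -/
theorem isClassified_of_ne_zero {a b H c d t : ℝ} (hH : 0 < H) (hc : c ≤ 0) (hd : 0 ≤ d)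
    (h : (bracketMetric a b H c d 0).IsCritical t) :
    IsClassified (bracketMetric a b H c d 0) t := by
  obtain ⟨h00, h11, h22, h33, h01, -, h03, -, h13⟩ := (isCritical_iff a b H c d t _ rfl).1 h
  obtain ⟨hT, rfl, hcl⟩ := classify_of_ne_zero hH.ne' h00 h11 h22 h33 h01 h03 h13
  right
  rcases hcl with ⟨rfl, rfl, hk⟩ | ⟨rfl, hd0, hL, hp⟩
  · left
    have hν : 0 < √(1 + H ^ 2) := Real.sqrt_pos.2 (by positivity)
    have hν2 : √(1 + H ^ 2) ^ 2 = 1 + H ^ 2 := Real.sq_sqrt (by positivity)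
    have hH1 : H ^ 2 + 1 ≠ 0 := by positivity
    rcases hk with rfl | hk
    · left
      have h := homothetic_nilpotent (k := 0) hν hν2
      rw [zero_mul] at h
      refine ⟨h, mul_right_cancel₀ hH1 ?_⟩
      unfold S at hT
      linear_combination hT
    · right
      right
      have h1 := homothetic_nilpotent (k := -1) hν hν2
      have h2 : -1 * √(1 + H ^ 2) = c := by
        have : √(1 + H ^ 2) = -c := by
          rw [Real.sqrt_eq_iff_mul_self_eq (by positivity) (by linarith)]
          linear_combination -hk
        rw [this]
        ring
      rw [h2] at h1
      refine ⟨h1, mul_right_cancel₀ hH1 ?_⟩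
      unfold S at hT
      rw [zero_add, hk] at hT
      linear_combination hT / 2
  · right
    right
    right
    obtain ⟨h1, h2⟩ := range6_of_eq (lt_of_le_of_ne hd hd0.symm) hH hL hp
    obtain rfl := eq_a6 hL
    refine ⟨d, H, h1, h2, .refl _, t6_mul.1 ?_⟩
    rw [hT]
    ring

/-- When `a = d` the skew part `c` is removed by `homothetic_untwist`, which leaves family (1), the
complex hyperbolic plane and family (4).  When `a ≠ d` the remaining cases are family (2), family
(5), and its limit `a + d = 0`, which is family (3) up to a rotation. -/
theorem isClassified_of_eq_zero {a c d t : ℝ} (hp : 0 ≤ a + d) (hq : a ≤ d) (hc : 0 ≤ c)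
    (h : (bracketMetric a (-c) 0 c d 0).IsCritical t) :
    IsClassified (bracketMetric a (-c) 0 c d 0) t := by
  obtain ⟨-, h1, h2, h3⟩ := (isCritical_zero_iff a c d t _ rfl).1 h
  rcases classify_zero h1 h2 h3 with ⟨rfl, h⟩ | ⟨hne, hT, h⟩
  · refine .of_homothetic (homothetic_untwist a c) ?_
    rcases eq_or_ne a (1 / 2) with rfl | ha
    · exact Or.inl isSymmetric_ch
    right
    have hT : t * S a 0 0 0 a = -(3 * (4 * a ^ 2 + 1)) := by
      have hS : S a (-c) 0 c a = S a 0 0 0 a := by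
        unfold S
        ring
      rw [← hS]
      refine h.resolve_left fun h => ha ?_
      nlinarith
    rcases eq_or_lt_of_le (show 0 ≤ a by linarith) with rfl | h0
    · left
      left
      exact ⟨.refl _, family1_t.1 (by rw [hT]; norm_num)⟩
    · right
      left
      exact ⟨a, (lt_or_gt_of_ne ha).imp (fun h => ⟨h0, h⟩) id, .refl _, t4_mul.1 hT⟩
  · right
    have hlt := lt_of_le_of_ne hq hne
    rcases h with ⟨rfl, hx⟩ | ⟨hc0, hx, hP⟩
    · left
      right
      left
      rw [neg_zero] at hT ⊢
      obtain ⟨h4, h5⟩ := range2_of_lt hp hlt hx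
      refine ⟨a, d, h4, h5, .refl _, (t2_mul h5).1 ?_⟩
      rw [hT]
      linear_combination -hx
    · have hcp := lt_of_le_of_ne hc hc0.symm
      rcases hp.eq_or_lt with h0 | h0
      · left
        right
        right
        rw [← h0] at hx hP hT
        have hc2 : c = 1 / 2 := by nlinarith
        have hd2 : d = 1 / 2 := by
          subst hc2
          nlinarith
        have ha2 : a = -1 / 2 := by linarith
        subst hc2 hd2 ha2
        have hr : √(1 / 2) ^ 2 = 1 / 2 := Real.sq_sqrt (by norm_num)
        refine ⟨homothetic_move (√(1 / 2)) (√(1 / 2)) (-1) 1 (by linarith) (by norm_num)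
          (by norm_num) (Or.inr rfl) ?_ ?_ (by ring) ?_ ?_, ?_⟩
        · ring
        · ring
        · linear_combination 2 * hr
        · ring
        · norm_num [S] at hT
          linarith
      · right
        right
        left
        have h4 := range5_of_pos hcp (by positivity) hP
        refine ⟨a, c, d, h4, (solves5_iff h4).2 ⟨h0, hlt, hP, hx⟩, .refl _,
          (t5_mul (range5_pos h4).2.1 hP hx).1 hT⟩

end NormalForm

theorem LeftInvMetric.IsCritical.isClassified {t : ℝ} (h : M.IsCritical t) :
    IsClassified M t := by
  obtain ⟨a, b, H, c, d, μ, hμ, ⟨e⟩⟩ := LieHomothety.exists_normalForm M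
  have h1 := (e.homothetic hμ).symm
  by_cases hH : H = 0
  · subst hH
    obtain ⟨a', c', d', hp, hq, hc, h2⟩ := NormalForm.exists_homothetic_of_eq_zero a b c d
    have h3 := h1.trans h2
    exact .of_homothetic h3 (NormalForm.isClassified_of_eq_zero hp hq hc (h3.symm.isCritical h))
  · obtain ⟨a', b', H', c', d', hH', hc, hd, h2⟩ :=
      NormalForm.exists_homothetic_of_ne_zero a b c d hH
    have h3 := h1.trans h2
    exact .of_homothetic h3 (NormalForm.isClassified_of_ne_zero hH' hc hd (h3.symm.isCritical h))
end

noncomputable section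

/-! ### Energy and algebraic Ricci solitons -/

variable {D : LieDerivation ℝ Heis Heis} {M : LeftInvMetric D}

namespace LeftInvMetric

theorem lie_frame (M : LeftInvMetric D) (i j : Fin 4) :
    ⁅M.frame i, M.frame j⁆ = ∑ m, M.structConst i j m • M.frame m :=
  (M.frame.sum_repr _).symm

theorem ricOp_frame (M : LeftInvMetric D) (i : Fin 4) :
    M.ricOp (M.frame i) = ∑ m, M.ric i m • M.frame m := by
  rw [ricOp, Module.Basis.constr_basis]

/-- The Leibniz rule for `Ric - r` on two vectors of the frame, in components. -/
theorem leibniz_frame_iff (M : LeftInvMetric D) (r : ℝ) (i j : Fin 4) :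
    (M.ricOp ⁅M.frame i, M.frame j⁆ - r • ⁅M.frame i, M.frame j⁆
      = ⁅M.frame i, M.ricOp (M.frame j) - r • M.frame j⁆
        - ⁅M.frame j, M.ricOp (M.frame i) - r • M.frame i⁆) ↔
    ∀ k, ∑ m, (M.structConst i j m * M.ric m k - M.ric i m * M.structConst m j k
      - M.ric j m * M.structConst i m k) = -r * M.structConst i j k := by
  have h1 : M.ricOp ⁅M.frame i, M.frame j⁆
      = ∑ k, (∑ m, M.structConst i j m * M.ric m k) • M.frame k := by
    rw [lie_frame, map_sum]
    simp only [map_smul, ricOp_frame, Finset.smul_sum, smul_smul]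
    rw [Finset.sum_comm]
    simp only [Finset.sum_smul]
  have h2 : ∀ i j, ⁅M.frame i, M.ricOp (M.frame j)⁆
      = ∑ k, (∑ m, M.ric j m * M.structConst i m k) • M.frame k := by
    intro i j
    rw [ricOp_frame, lie_sum]
    simp only [lie_smul, lie_frame, Finset.smul_sum, smul_smul]
    rw [Finset.sum_comm]
    simp only [Finset.sum_smul]
  have hs : ∀ i j k, M.structConst i j k = -M.structConst j i k := by
    intro i j k
    simp only [structConst]
    rw [← lie_skew, map_neg]
    rfl
  rw [M.frame.ext_elem_iff]
  refine forall_congr' fun k => ?_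
  rw [lie_sub, lie_sub, lie_smul, lie_smul, h1, h2, h2, ← lie_skew (M.frame j), lie_frame]
  simp only [map_sub, map_smul, map_neg, map_sum, Finsupp.sub_apply, Finsupp.smul_apply,
    Finsupp.neg_apply, Finsupp.finsetSum_apply, Module.Basis.repr_self, Finsupp.single_apply,
    smul_eq_mul, mul_ite, mul_one, mul_zero, Finset.sum_ite_eq', Finset.mem_univ, if_true,
    Finset.sum_sub_distrib, Finset.sum_neg_distrib, hs _ j k, mul_neg]
  constructor <;> intro h <;> linear_combination h

theorem isAlgebraicRicciSoliton_iff (M : LeftInvMetric D) : M.IsAlgebraicRicciSoliton ↔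
    ∃ r, ∀ i j k, ∑ m, (M.structConst i j m * M.ric m k - M.ric i m * M.structConst m j k
      - M.ric j m * M.structConst i m k) = -r * M.structConst i j k := by
  refine exists_congr fun r => ?_
  simp only [← leibniz_frame_iff]
  constructor
  · rintro ⟨E, hE⟩ i j
    simp only [hE, add_sub_cancel_left]
    exact E.apply_lie_eq_sub _ _
  · intro h
    have key : ∀ u v, M.ricOp ⁅u, v⁆ - r • ⁅u, v⁆
        = ⁅u, M.ricOp v - r • v⁆ - ⁅v, M.ricOp u - r • u⁆ := by
      intro u v
      refine Submodule.span_induction (p := fun u _ => M.ricOp ⁅u, v⁆ - r • ⁅u, v⁆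
        = ⁅u, M.ricOp v - r • v⁆ - ⁅v, M.ricOp u - r • u⁆) ?_ ?_ ?_ ?_ (M.frame.mem_span u)
      · rintro _ ⟨i, rfl⟩
        refine Submodule.span_induction (p := fun v _ => M.ricOp ⁅M.frame i, v⁆
          - r • ⁅M.frame i, v⁆ = ⁅M.frame i, M.ricOp v - r • v⁆
          - ⁅v, M.ricOp (M.frame i) - r • M.frame i⁆) ?_ ?_ ?_ ?_ (M.frame.mem_span v)
        · rintro _ ⟨j, rfl⟩
          exact h i j
        · simp
        · intro v w _ _ hv hw
          simp only [lie_add, add_lie, map_add, smul_add, lie_sub, lie_smul] at hv hw ⊢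
          linear_combination (norm := module) hv + hw
        · intro c v _ hv
          simp only [lie_smul, smul_lie, map_smul, lie_sub] at hv ⊢
          rw [smul_comm r c, ← smul_sub, hv, smul_comm r c]
          module
      · simp
      · intro v w _ _ hv hw
        simp only [lie_add, add_lie, map_add, smul_add, lie_sub, lie_smul] at hv hw ⊢
        linear_combination (norm := module) hv + hw
      · intro c v _ hv
        simp only [lie_smul, smul_lie, map_smul, lie_sub] at hv ⊢
        rw [smul_comm r c, ← smul_sub, hv, smul_comm r c]
        module
    exact ⟨⟨M.ricOp - r • LinearMap.id, key⟩, fun x => (add_sub_cancel _ _).symm⟩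

end LeftInvMetric

namespace NormalForm

variable {a b H c d t : ℝ}

theorem family1_isAlgebraicRicciSoliton : family1.IsAlgebraicRicciSoliton := by
  rw [family1, LeftInvMetric.isAlgebraicRicciSoliton_iff, structConst_eq, ric_eq]
  refine ⟨-3 / 2, ?_⟩
  simp [Fin.forall_fin_succ, Fin.sum_univ_four, sc, rc]
  norm_num

theorem family3_isAlgebraicRicciSoliton : family3.IsAlgebraicRicciSoliton := by
  rw [family3, LeftInvMetric.isAlgebraicRicciSoliton_iff, structConst_eq, ric_eq]
  refine ⟨-3 / 2, ?_⟩
  simp [Fin.forall_fin_succ, Fin.sum_univ_four, sc, rc]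
  norm_num

theorem family2_isAlgebraicRicciSoliton (h : Solves2 a d) :
    (family2 a d).IsAlgebraicRicciSoliton := by
  have h2 := h.2
  rw [family2, LeftInvMetric.isAlgebraicRicciSoliton_iff, structConst_eq, ric_eq]
  refine ⟨-3 / 2, fun i j k => ?_⟩
  rw [Fin.sum_univ_four]
  fin_cases i <;> fin_cases j <;> fin_cases k <;> simp [sc, rc] <;> first
    | ring1
    | linear_combination (a / 2) * h2
    | linear_combination (-a / 2) * h2
    | linear_combination (d / 2) * h2
    | linear_combination (-d / 2) * h2
    | linear_combination ((a + d) / 2) * h2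
    | linear_combination (-(a + d) / 2) * h2

theorem eq_zero_of_soliton (hH : H ≠ 0)
    (h : (bracketMetric a b H c d 0).IsAlgebraicRicciSoliton) : a = 0 ∧ b = 0 ∧ d = 0 := by
  rw [LeftInvMetric.isAlgebraicRicciSoliton_iff, structConst_eq, ric_eq] at h
  obtain ⟨r, h⟩ := h
  have h0 := h 0 1 0
  have h1 := h 0 1 1
  have h2 := h 1 2 2
  simp [Fin.sum_univ_four, sc, rc] at h0 h1 h2
  have e0 : a + 3 * d = 0 := by
    apply mul_left_cancel₀ hH
    linear_combination -2 * h0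
  have e1 : b = 0 := by
    apply mul_left_cancel₀ hH
    linear_combination h1
  have e2 : 3 * a + 4 * d = 0 := by
    apply mul_left_cancel₀ hH
    linear_combination -2 * h2
  exact ⟨by linarith, e1, by linarith⟩

theorem zero_of_soliton (h : (bracketMetric a (-c) 0 c d 0).IsAlgebraicRicciSoliton) :
    (a + d) * (a - d) * c = 0 ∧ (a = d → a * (4 * a ^ 2 - 1) = 0) := by
  rw [LeftInvMetric.isAlgebraicRicciSoliton_iff, structConst_eq, ric_eq] at h
  obtain ⟨r, h⟩ := h
  have h0 := h 0 1 2
  have h1 := h 0 3 1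
  have h2 := h 1 3 0
  have h3 := h 2 3 2
  simp [Fin.sum_univ_four, sc, rc] at h0 h1 h2 h3
  constructor
  · linear_combination (-1 / 4) * h1 - (1 / 4) * h2
  · rintro rfl
    linear_combination (1 / 3) * h3 - (2 * a / 3) * h0

theorem ric_conformal (h : 4 * a ^ 2 = 1) (i j : Fin 4) :
    (bracketMetric a (-c) 0 c a 0).ric i j = if i = j then -3 / 2 else 0 := by
  rw [ric_eq]
  fin_cases i <;> fin_cases j <;> simp [rc] <;> first
    | ring1
    | linear_combination (-2) * h
    | linear_combination (-4) * h
    | linear_combination (-3) * h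

/-- A critical soliton has zero energy or is Einstein. -/
theorem energy_eq_zero_or_einstein (hc : (bracketMetric a b H c d 0).IsCritical t)
    (hs : (bracketMetric a b H c d 0).IsAlgebraicRicciSoliton) :
    (bracketMetric a b H c d 0).energy t = 0 ∨
      ∃ r, ∀ i j, (bracketMetric a b H c d 0).ric i j = if i = j then r else 0 := by
  by_cases hH : H = 0
  · subst hH
    obtain ⟨a', c', d', ⟨e⟩⟩ := exists_rotation a b c d
    have h := e.homothetic one_pos
    replace hc := h.isCritical hc
    replace hs := e.isAlgebraicRicciSoliton one_pos hs
    suffices (bracketMetric a' (-c') 0 c' d' 0).energy t = 0 ∨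
        ∃ r, ∀ i j, (bracketMetric a' (-c') 0 c' d' 0).ric i j = if i = j then r else 0 by
      refine this.imp (fun h0 => ?_) (fun ⟨r, hr⟩ => h.symm.exists_ric_eq hr)
      obtain ⟨μ, -, hE⟩ := h.symm.exists_energy_eq
      rw [hE, h0, mul_zero]
    obtain ⟨hs1, hs2⟩ := zero_of_soliton hs
    obtain ⟨-, h1, h2, h3⟩ := (isCritical_zero_iff a' c' d' t _ rfl).1 hc
    rcases classify_zero h1 h2 h3 with ⟨rfl, h⟩ | ⟨hne, hT, ⟨rfl, hx⟩ | ⟨hc0, hx, hP⟩⟩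
    · rcases mul_eq_zero.1 (hs2 rfl) with rfl | h4
      · left
        have hT := h.resolve_left (by norm_num)
        rw [energy_zero_eq 0 c' 0 t _ rfl, hT]
        norm_num
      · exact Or.inr ⟨_, ric_conformal (by linarith)⟩
    · left
      rw [neg_zero] at hT ⊢
      refine energy_of_diagonal hx ?_
      rw [hT]
      linear_combination -hx
    · left
      rw [energy_of_skew hT hP hx]
      have : a' + d' = 0 := by
        have h4 := (mul_eq_zero.1 hs1).resolve_right hc0
        exact (mul_eq_zero.1 h4).resolve_right (sub_ne_zero.2 hne)
      rw [this]
      ring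
  · left
    obtain ⟨rfl, rfl, rfl⟩ := eq_zero_of_soliton hH hs
    obtain ⟨h00, h11, h22, h33, h01, -, h03, -, h13⟩ := (isCritical_iff 0 0 H c 0 t _ rfl).1 hc
    obtain ⟨hT, -, h⟩ := classify_of_ne_zero hH h00 h11 h22 h33 h01 h03 h13
    have h1 : c = 0 ∨ c ^ 2 = H ^ 2 + 1 := by
      rcases h with h | h
      exacts [h.2.2, absurd rfl h.2.1]
    rw [energy_eq 0 0 H c 0 t _ rfl, hT, ricNormSq_eq]
    unfold S
    rcases h1 with rfl | h1
    · ring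
    · linear_combination (3 / 4) * c ^ 2 * h1

theorem family4_not_einstein {r : ℝ} (ha : Range4 a)
    (h : ∀ i j, (family4 a).ric i j = if i = j then r else 0) : False := by
  rw [family4, ric_eq] at h
  have h0 := h 0 0
  have h2 := h 2 2
  simp [rc] at h0 h2
  have h4 : (a - 1 / 2) * (a + 1 / 2) = 0 := by linear_combination (h0 - h2) / 4
  rcases mul_eq_zero.1 h4 with h | h <;> rcases ha with ha | ha <;> linarith

theorem family5_not_einstein {r : ℝ} (hc : Range5 c) (hd : Solves5 c a d)
    (h : ∀ i j, (family5 a c d).ric i j = if i = j then r else 0) : False := by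
  rw [family5, ric_eq] at h
  have h1 := h 0 1
  simp [rc] at h1
  have h2 : (a - d) * c = 0 := by linear_combination (-1 / 2) * h1
  rcases mul_eq_zero.1 h2 with h | h
  · have := hd.1
    have := hd.2.1
    linarith
  · exact (range5_pos hc).1.ne' h

theorem family6_not_einstein {r : ℝ} (hH : Range6 H)
    (h : ∀ i j, (family6 a d H).ric i j = if i = j then r else 0) : False := by
  rw [family6, ric_eq] at h
  have h1 := h 1 3
  simp [rc] at h1
  exact hH.1.ne' h1

end NormalForm

theorem InZeroEnergyFamilies.isCritical {t : ℝ} (h : InZeroEnergyFamilies M t) :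
    M.IsCritical t := by
  rcases h with ⟨h, rfl⟩ | ⟨a, d, -, h2, h, rfl⟩ | ⟨h, rfl⟩
  exacts [h.isCritical NormalForm.family1_isCritical,
    h.isCritical (NormalForm.family2_isCritical h2), h.isCritical NormalForm.family3_isCritical]

theorem InZeroEnergyFamilies.energy_eq_zero {t : ℝ} (h : InZeroEnergyFamilies M t) :
    M.energy t = 0 := by
  rcases h with ⟨h, rfl⟩ | ⟨a, d, -, h2, h, rfl⟩ | ⟨h, rfl⟩ <;>
    obtain ⟨μ, -, hE⟩ := h.exists_energy_eq
  · rw [hE, NormalForm.family1_energy, mul_zero]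
  · rw [hE, NormalForm.family2_energy h2, mul_zero]
  · rw [hE, NormalForm.family3_energy, mul_zero]

theorem InNegativeEnergyFamilies.isCritical {t : ℝ} (h : InNegativeEnergyFamilies M t) :
    M.IsCritical t := by
  rcases h with ⟨a, -, h, rfl⟩ | ⟨a, c, d, h1, h2, h, rfl⟩ | ⟨d, H, -, h2, h, rfl⟩
  exacts [h.isCritical (NormalForm.family4_isCritical a),
    h.isCritical (NormalForm.family5_isCritical h1 h2),
    h.isCritical (NormalForm.family6_isCritical h2)]

theorem InNegativeEnergyFamilies.energy_neg {t : ℝ} (h : InNegativeEnergyFamilies M t) :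
    M.energy t < 0 := by
  rcases h with ⟨a, h1, h, rfl⟩ | ⟨a, c, d, h1, h2, h, rfl⟩ | ⟨d, H, h1, h2, h, rfl⟩ <;>
    obtain ⟨μ, hμ, hE⟩ := h.exists_energy_eq <;> rw [hE] <;>
    refine mul_neg_of_pos_of_neg (by positivity) ?_
  · rw [NormalForm.family4_energy]
    have : 0 < a := by
      rcases h1 with h1 | h1 <;> linarith
    have := sq_pos_of_pos this
    linarith
  · rw [NormalForm.family5_energy' h1 h2]
    have h3 := ((NormalForm.solves5_iff h1).1 h2).1
    have h4 := (NormalForm.range5_pos h1).1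
    have : 0 < (a + d) ^ 2 * c ^ 2 := by positivity
    linarith
  · exact NormalForm.family6_energy_neg h1 h2

theorem InNegativeEnergyFamilies.not_einstein {t r : ℝ} (h : InNegativeEnergyFamilies M t)
    (hr : ∀ i j, M.ric i j = if i = j then r else 0) : False := by
  rcases h with ⟨a, h1, h, -⟩ | ⟨a, c, d, h1, h2, h, -⟩ | ⟨d, H, h1, -, h, -⟩ <;>
    obtain ⟨r', hr'⟩ := h.symm.exists_ric_eq hr
  exacts [NormalForm.family4_not_einstein h1 hr', NormalForm.family5_not_einstein h1 h2 hr',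
    NormalForm.family6_not_einstein h1 hr']

/-- The soliton condition is not invariant under homotheties, so it is tested on the normal form of
the given metric; the energy and the Einstein condition are invariant. -/
theorem InNegativeEnergyFamilies.not_isAlgebraicRicciSoliton {t : ℝ}
    (h : InNegativeEnergyFamilies M t) : ¬M.IsAlgebraicRicciSoliton := by
  intro hs
  obtain ⟨a, b, H, c, d, μ, hμ, ⟨e⟩⟩ := LieHomothety.exists_normalForm M
  have h' := h.of_homothetic (e.homothetic hμ)
  rcases NormalForm.energy_eq_zero_or_einstein h'.isCritical
    (e.isAlgebraicRicciSoliton hμ hs) with h0 | ⟨r, hr⟩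
  · exact h'.energy_neg.ne h0
  · exact h'.not_einstein hr
end

theorem mainTheorem2 :
    -- classification of the non-symmetric critical metrics
    (∀ (D : LieDerivation ℝ Heis Heis) (M : LeftInvMetric D), ¬ M.IsSymmetric → ∀ t : ℝ,
      (M.IsCritical t ↔ InZeroEnergyFamilies M t ∨ InNegativeEnergyFamilies M t)) ∧
    -- sign of the energy
    (∀ (D : LieDerivation ℝ Heis Heis) (M : LeftInvMetric D) (t : ℝ),
      InZeroEnergyFamilies M t → M.energy t = 0) ∧
    (∀ (D : LieDerivation ℝ Heis Heis) (M : LeftInvMetric D) (t : ℝ),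
      InNegativeEnergyFamilies M t → M.energy t < 0) ∧
    -- the dependent parameters are determined by the free ones
    (∀ a, Range2 a → ∃! d, Solves2 a d) ∧
    (∀ c, Range5 c → ∃! p : ℝ × ℝ, Solves5 c p.1 p.2) ∧
    (∀ H, Range6 H → ∃! d, Solves6 H d) ∧
    (∀ H d, Range6 H → Solves6 H d → 0 < a6 H d) ∧
    -- the range of `t` in family (2)
    {t | ∃ a d, Range2 a ∧ Solves2 a d ∧ t = t2 a d} = Set.Ico (-3 / 4) (-1 / 4) ∧
    -- the energies of the normalized metrics in families (4)-(6)
    (∀ a, Range4 a → (family4 a).energy (t4 a) = -36 * a ^ 2) ∧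
    (∀ a c d, Range5 c → Solves5 c a d →
      (family5 a c d).energy (t5 c) = -(72 * c ^ 2 * (4 * c ^ 2 - 1)) / (8 * c ^ 2 - 7)) ∧
    (∀ a d H, Range6 H → Solves6 H d → a = a6 H d →
      (family6 a d H).energy (t6 a d H) =
        1 / 4 * (24 * a ^ 3 * d + 2 * a * d * (22 * d ^ 2 - 19 * H ^ 2 - 31)
          + 3 * d ^ 2 * (4 * d ^ 2 - 7 * H ^ 2 - 13)
          + 4 * a ^ 2 * (13 * d ^ 2 - 6 * H ^ 2 - 10))) ∧
    -- algebraic Ricci solitons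
    family1.IsAlgebraicRicciSoliton ∧
    (∀ a d, Range2 a → Solves2 a d → (family2 a d).IsAlgebraicRicciSoliton) ∧
    family3.IsAlgebraicRicciSoliton ∧
    (∀ (D : LieDerivation ℝ Heis Heis) (M : LeftInvMetric D) (t : ℝ),
      InNegativeEnergyFamilies M t → ¬ M.IsAlgebraicRicciSoliton) :=
  ⟨fun _ _ hM _ => ⟨fun h => h.isClassified.resolve_left hM,
      fun h => h.elim InZeroEnergyFamilies.isCritical InNegativeEnergyFamilies.isCritical⟩,
    fun _ _ _ h => h.energy_eq_zero, fun _ _ _ h => h.energy_neg,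
    fun _ ha => NormalForm.existsUnique_solves2 ha,
    fun _ hc => NormalForm.existsUnique_solves5 hc,
    fun _ hH => NormalForm.existsUnique_solves6 hH,
    fun _ _ hH hd => NormalForm.a6_pos hH hd,
    NormalForm.setOf_t2,
    fun a _ => NormalForm.family4_energy a,
    fun _ _ _ hc h => NormalForm.family5_energy hc h,
    fun a d H _ _ _ => NormalForm.family6_energy a d H,
    NormalForm.family1_isAlgebraicRicciSoliton,
    fun _ _ _ h => NormalForm.family2_isAlgebraicRicciSoliton h,
    NormalForm.family3_isAlgebraicRicciSoliton,
    fun _ _ _ h => h.not_isAlgebraicRicciSoliton⟩
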